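/- Let $k$ be an algebraically closed field of characteristic $0$, let $V$ be an $s$-dimensional $k$-vector space, and let $G\subset GL(V)$ be a finite subgroup. Put $V'=V\oplus k$, let $G'\subset SL(V')$ be the image of $G$ under $g\mapsto \mathrm{diag}(g,\det(g)^{-1})$, let $m\ge 1$, let $\xi\in k$ be a primitive $m$-th root of unity, let $C_m\subset GL(V')$ be generated by $\mathrm{diag}(1,\dots,1,\xi)$, and let $\widetilde G=G'C_m\subset GL(V')$. Paths are composed from right to left. For a finite subgroup $H\subset GL(W)$ the skew group algebra $\wedge W*H$ is graded by exterior degree, and $\Lambda(H)=e(\wedge W*H)e$ denotes its basic algebra, where $e=\sum_i e_i$ is a sum of orthogonal primitive idempotents of degree $0$ such that the modules $(\wedge W*H)e_i$ represent every isomorphism class of indecomposable projective modules exactly once. A bound quiver of $\Lambda(H)$ is a finite quiver $Q$ with a set $\theta$ of quadratic relations (linear combinations of paths of length two with common source and target) such that all sufficiently long paths lie in the two-sided ideal $(\theta)$, together with an algebra isomorphism $kQ/(\theta)\cong\Lambda(H)$ that maps the trivial paths to the $e_i$ and the arrows to elements of degree $1$. A graded Nakayama automorphism of $kQ/(\theta)$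 inducing the permutation $\nu$ of the vertices is an algebra automorphism, also denoted $\nu$, with $\nu(e_i)=e_{\nu i}$, which maps arrows to linear combinations of arrows and satisfies $f(ab)=f(b\,\nu(a))$ for some nondegenerate linear form $f$. Let $(Q_G,\theta_G)$ be a bound quiver of $\Lambda(G)$, let $\nu$ be a graded Nakayama automorphism of $kQ_G/(\theta_G)$ inducing the permutation $\nu$ of the vertices, and let $\widetilde\sigma$ be the automorphism with $\widetilde\sigma(\alpha)=(-1)^s\alpha$ for all arrows $\alpha$. Then the following data define a bound quiver $(Q_{\widetilde G},\theta_{\widetilde G})$ of $\Lambda(\widetilde G)$, the basic algebra of $\wedge V'*\widetilde G$: 1. The vertex set is $Q_{\widetilde G,0}=Q_{G,0}\times\mathbb Z/m\mathbb Z$. 2. The arrows are, for $t\in\mathbb Z/m\mathbb Z$, the copies $(\alpha,t):(i,t)\to(j,t)$ of the arrows $\alpha:i\to j$ of $Q_G$ and the connecting arrows $(\beta_i,t):(i,t)\to(\nu i,t+1)$, $i\in Q_{G,0}$. 3. The relations are, for $t\in\mathbb Z/m\mathbb Z$: the copies $(\varrho,t)$ of the $\varrho\in\theta_G$, obtained by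 replacing each path $\alpha_l\cdots\alpha_1$ by $(\alpha_l,t)\cdots(\alpha_1,t)$; the products $(\beta_{\nu i},t+1)(\beta_i,t)$, $i\in Q_{G,0}$; and $(\alpha,t)(\beta_{\nu^{-1}i},t-1)-(\beta_{\nu^{-1}j},t-1)(\nu^{-1}\widetilde\sigma\alpha,t-1)$ for the arrows $\alpha:i\to j$ of $Q_G$, where $\nu^{-1}\widetilde\sigma\alpha$ is written as a linear combination of arrows. 4. The Nakayama translation of $\Lambda(\widetilde G)$ is $(i,t)\mapsto(i,t-1)$: this permutation $\tilde\nu$ is induced by a graded Nakayama automorphism of $kQ_{\widetilde G}/(\theta_{\widetilde G})$; moreover, all maximal paths that are nonzero in this algebra have length $s+1$, for each vertex $x$ there is such a maximal path from $\tilde\nu(x)$ to $x$, every path of length $s+1$ from $\tilde\nu(x)$ to a vertex $y\ne x$ is zero in this algebra, and any two maximal nonzero paths with the same source are linearly dependent in it. -/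

import Mathlib

noncomputable section

universe u v w

/-! ### The path algebra of a quiver -/

/-- All paths of a quiver, with their source and target. -/
structure TotalPath (Q : Type u) [Quiver.{v} Q] where
  /-- the source of the path -/
  src : Q
  /-- the target of the path -/
  tgt : Q
  /-- the path itself -/
  path : Quiver.Path src tgt

/-- The underlying space of the path algebra `kQ`: the vector space with basis all paths of `Q`,
including the trivial path at each vertex. -/
def PathAlgebra (k : Type w) [Field k] (Q : Type u) [Quiver.{v} Q] :=
  TotalPath Q →₀ k

namespace PathAlgebra

variable {k : Type w} [Field k] {Q : Type u} [Quiver.{v} Q]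

instance : AddCommGroup (PathAlgebra k Q) := inferInstanceAs (AddCommGroup (TotalPath Q →₀ k))

instance : Module k (PathAlgebra k Q) := inferInstanceAs (Module k (TotalPath Q →₀ k))

variable (k) in
/-- A path as an element of the path algebra. -/
def ofPath {i j : Q} (p : Quiver.Path i j) : PathAlgebra k Q :=
  Finsupp.single (⟨i, j, p⟩ : TotalPath Q) (1 : k)

variable (k) in
/-- The trivial path at the vertex `i`. -/
def vertex (i : Q) : PathAlgebra k Q := ofPath k (Quiver.Path.nil : Quiver.Path i i)

variable (k) in
/-- An arrow as an element of the path algebra. -/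
def arrow {i j : Q} (a : i ⟶ j) : PathAlgebra k Q := ofPath k a.toPath

open Classical in
variable (k) in
/-- The product `p q` of two paths: first `q`, then `p` if the target of `q` is the source of `p`,
and `0` otherwise. -/
def pathMul (p q : TotalPath Q) : PathAlgebra k Q :=
  if h : q.tgt = p.src then ofPath k (q.path.comp (p.path.cast h.symm rfl)) else 0

variable (k Q) in
/-- The bilinear extension of the product of paths. -/
def mulLin : PathAlgebra k Q →ₗ[k] PathAlgebra k Q →ₗ[k] PathAlgebra k Q :=
  Finsupp.linearCombination k (fun p : TotalPath Q =>
    (Finsupp.linearCombination k (fun q : TotalPath Q => pathMul k p q) :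
      (TotalPath Q →₀ k) →ₗ[k] PathAlgebra k Q))

instance : Mul (PathAlgebra k Q) := ⟨fun a b => mulLin k Q a b⟩

theorem mul_eq (a b : PathAlgebra k Q) : a * b = mulLin k Q a b := rfl

theorem ofPath_mul {i j j' l : Q} (p : Quiver.Path j' l) (q : Quiver.Path i j) :
    ofPath k p * ofPath k q = pathMul k ⟨j', l, p⟩ ⟨i, j, q⟩ := by
  rw [mul_eq]
  unfold mulLin ofPath
  erw [Finsupp.linearCombination_single, one_smul, Finsupp.linearCombination_single, one_smul]

theorem ofPath_mul_ofPath {i j l : Q} (p : Quiver.Path j l) (q : Quiver.Path i j) :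
    ofPath k p * ofPath k q = ofPath k (q.comp p) := by
  rw [ofPath_mul]
  simp [pathMul]

theorem ofPath_mul_of_ne {i j j' l : Q} (p : Quiver.Path j' l) (q : Quiver.Path i j)
    (h : j ≠ j') : ofPath k p * ofPath k q = 0 := by
  rw [ofPath_mul]
  simp [pathMul, h]

/-- The paths span the path algebra. -/
theorem induction_ofPath {P : PathAlgebra k Q → Prop} (a : PathAlgebra k Q) (h0 : P 0)
    (hadd : ∀ x y, P x → P y → P (x + y))
    (hsmul : ∀ (c : k) (i j : Q) (p : Quiver.Path i j), P (c • ofPath k p)) : P a := by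
  refine Finsupp.induction_linear (motive := fun x : TotalPath Q →₀ k => P x) a h0 hadd ?_
  intro p c
  have : (Finsupp.single p c : TotalPath Q →₀ k) = c • Finsupp.single p (1 : k) := by simp
  rw [this]
  exact hsmul c p.src p.tgt p.path

instance : NonUnitalNonAssocRing (PathAlgebra k Q) :=
  { (inferInstance : AddCommGroup (PathAlgebra k Q)) with
    left_distrib := fun a b c => by simp only [mul_eq, map_add]
    right_distrib := fun a b c => by simp only [mul_eq, map_add, LinearMap.add_apply]
    zero_mul := fun a => by simp only [mul_eq, map_zero, LinearMap.zero_apply]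
    mul_zero := fun a => by simp only [mul_eq, map_zero] }

theorem smul_mul' (c : k) (a b : PathAlgebra k Q) : (c • a) * b = c • (a * b) := by
  simp only [mul_eq, map_smul, LinearMap.smul_apply]

theorem mul_smul' (c : k) (a b : PathAlgebra k Q) : a * (c • b) = c • (a * b) := by
  simp only [mul_eq, map_smul]

theorem ofPath_assoc {i j i' j' i'' j'' : Q} (p : Quiver.Path i j) (q : Quiver.Path i' j')
    (r : Quiver.Path i'' j'') :
    ofPath k p * ofPath k q * ofPath k r = ofPath k p * (ofPath k q * ofPath k r) := by
  by_cases h1 : j' = i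
  · subst h1
    rw [ofPath_mul_ofPath]
    by_cases h2 : j'' = i'
    · subst h2
      rw [ofPath_mul_ofPath, ofPath_mul_ofPath, ofPath_mul_ofPath, Quiver.Path.comp_assoc]
    · rw [ofPath_mul_of_ne _ _ h2, ofPath_mul_of_ne _ _ h2, mul_zero]
  · rw [ofPath_mul_of_ne _ _ h1, zero_mul]
    by_cases h2 : j'' = i'
    · subst h2
      rw [ofPath_mul_ofPath, ofPath_mul_of_ne _ _ h1]
    · rw [ofPath_mul_of_ne _ _ h2, mul_zero]

theorem assoc (a b c : PathAlgebra k Q) : a * b * c = a * (b * c) := by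
  induction a using induction_ofPath with
  | h0 => simp
  | hadd x y hx hy => simp only [add_mul, hx, hy]
  | hsmul s i j p =>
    induction b using induction_ofPath with
    | h0 => simp
    | hadd x y hx hy => simp only [add_mul, mul_add, hx, hy]
    | hsmul s' i' j' q =>
      induction c using induction_ofPath with
      | h0 => simp
      | hadd x y hx hy => simp only [mul_add, hx, hy]
      | hsmul s'' i'' j'' r =>
        simp only [smul_mul', mul_smul', ofPath_assoc]

variable [Fintype Q]

instance : One (PathAlgebra k Q) := ⟨∑ i : Q, vertex k i⟩

theorem one_eq : (1 : PathAlgebra k Q) = ∑ i : Q, vertex k i := rfl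

theorem one_mul' (a : PathAlgebra k Q) : 1 * a = a := by
  induction a using induction_ofPath with
  | h0 => simp
  | hadd x y hx hy => simp only [mul_add, hx, hy]
  | hsmul c i j p =>
    rw [mul_smul', one_eq, Finset.sum_mul, Finset.sum_eq_single j]
    · rw [vertex, ofPath_mul_ofPath, Quiver.Path.comp_nil]
    · intro l _ hl
      exact ofPath_mul_of_ne _ _ hl.symm
    · simp

theorem mul_one' (a : PathAlgebra k Q) : a * 1 = a := by
  induction a using induction_ofPath with
  | h0 => simp
  | hadd x y hx hy => simp only [add_mul, hx, hy]
  | hsmul c i j p =>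
    rw [smul_mul', one_eq, Finset.mul_sum, Finset.sum_eq_single i]
    · rw [vertex, ofPath_mul_ofPath, Quiver.Path.nil_comp]
    · intro l _ hl
      exact ofPath_mul_of_ne _ _ hl
    · simp

instance : Ring (PathAlgebra k Q) :=
  { (inferInstance : NonUnitalNonAssocRing (PathAlgebra k Q)) with
    mul_assoc := assoc
    one_mul := one_mul'
    mul_one := mul_one' }

instance : Algebra k (PathAlgebra k Q) := Algebra.ofModule smul_mul' mul_smul'

end PathAlgebra

/-! ### Bound quivers -/

section BoundQuiver

open PathAlgebra

variable {k : Type w} [Field k] {Q : Type u} [Quiver.{v} Q]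

variable (k Q) in
/-- The space `kQ₁` spanned by the arrows. -/
def arrowSpan : Submodule k (PathAlgebra k Q) :=
  Submodule.span k {x | ∃ (i j : Q) (a : i ⟶ j), x = arrow k a}

/-- A quadratic relation: a linear combination of paths of length two with a common source and a
common target. -/
def IsQuadraticRelation (r : PathAlgebra k Q) : Prop :=
  ∃ i j : Q, r ∈ Submodule.span k
    {x : PathAlgebra k Q | ∃ p : Quiver.Path i j, p.length = 2 ∧ x = ofPath k p}

variable [Fintype Q]

/-- The algebra `kQ/(θ)`, the quotient of the path algebra by the two-sided ideal generated
by `θ`. -/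
abbrev BoundAlgebra (θ : Set (PathAlgebra k Q)) : Type (max u v w) :=
  RingQuot (fun a b : PathAlgebra k Q => a ∈ θ ∧ b = 0)

/-- The canonical projection `kQ → kQ/(θ)`. -/
abbrev toBound (θ : Set (PathAlgebra k Q)) : PathAlgebra k Q →ₐ[k] BoundAlgebra θ :=
  RingQuot.mkAlgHom k (fun a b : PathAlgebra k Q => a ∈ θ ∧ b = 0)

end BoundQuiver

/-- A primitive idempotent: nonzero, and not the sum of two nonzero orthogonal idempotents. -/
def IsPrimitiveIdempotent {A : Type*} [Ring A] (f : A) : Prop :=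
  IsIdempotentElem f ∧ f ≠ 0 ∧
    ∀ x y : A, IsIdempotentElem x → IsIdempotentElem y → x * y = 0 → y * x = 0 → f = x + y →
      x = 0 ∨ y = 0

/-- Pairwise orthogonal primitive idempotents `e i` such that the left modules `A (e i)` represent
each isomorphism class of indecomposable projective modules `A f` exactly once. The
algebra `e A e`, `e = ∑ i, e i`, is then the basic algebra of `A`. -/
structure IsBasicFamily {A : Type*} [Ring A] {ι : Type*} (e : ι → A) : Prop where
  orthogonal : OrthogonalIdempotents e
  primitive : ∀ i, IsPrimitiveIdempotent (e i)
  not_iso : ∀ i j, i ≠ j → IsEmpty (Ideal.span {e i} ≃ₗ[A] Ideal.span {e j})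
  exists_iso : ∀ f : A, IsPrimitiveIdempotent f →
    ∃ i, Nonempty (Ideal.span {f} ≃ₗ[A] Ideal.span {e i})

/-- `(Q, θ)` is a bound quiver of the basic algebra of the graded algebra `A = ⨁ 𝒜 d`: the
relations are quadratic, long paths vanish in `kQ/(θ)`, and `φ` identifies `kQ/(θ)` with the
basic algebra `e A e`, the trivial paths with the homogeneous primitive idempotents `e i`, and
the arrows with elements of degree one. -/
structure IsBoundQuiverOfBasic {k : Type*} [Field k] {Q : Type u} [Quiver.{v} Q] [Fintype Q]
    {A : Type*} [Ring A] [Algebra k A] (𝒜 : ℕ → Submodule k A) (θ : Set (PathAlgebra k Q)) :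
    Prop where
  quadratic : ∀ r ∈ θ, IsQuadraticRelation r
  nilpotent : ∃ N : ℕ, ∀ (i j : Q) (p : Quiver.Path i j), N ≤ p.length →
    toBound θ (PathAlgebra.ofPath k p) = 0
  exists_iso : ∃ e : Q → A, IsBasicFamily e ∧ (∀ i, e i ∈ 𝒜 0) ∧
    ∃ φ : BoundAlgebra θ →ₙₐ[k] A, Function.Injective φ ∧
      Set.range φ = {x | ∃ a : A, x = (∑ i, e i) * a * (∑ i, e i)} ∧
      (∀ i, φ (toBound θ (PathAlgebra.vertex k i)) = e i) ∧
      ∀ (i j : Q) (a : i ⟶ j), φ (toBound θ (PathAlgebra.arrow k a)) ∈ 𝒜 1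

/-! ### Nakayama automorphism and Nakayama translation -/

section Nakayama

open PathAlgebra

variable {k : Type w} [Field k] {Q : Type u} [Quiver.{v} Q] [Fintype Q]

/-- `N` is a graded Nakayama automorphism of `kQ/(θ)` that induces the permutation `ν` of the
vertices: there is a nondegenerate linear form `f` with `f (a b) = f (b N(a))`, and `N` maps the
trivial path at `i` to the one at `ν i` and arrows to linear combinations of arrows. -/
structure IsNakayamaAutomorphism (θ : Set (PathAlgebra k Q)) (ν : Equiv.Perm Q)
    (N : BoundAlgebra θ ≃ₐ[k] BoundAlgebra θ) : Prop where
  frobenius : ∃ f : BoundAlgebra θ →ₗ[k] k,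
    (∀ a, (∀ b, f (a * b) = 0) → a = 0) ∧ (∀ b, (∀ a, f (a * b) = 0) → b = 0) ∧
      ∀ a b, f (a * b) = f (b * N a)
  map_vertex : ∀ i, N (toBound θ (vertex k i)) = toBound θ (vertex k (ν i))
  map_arrow : ∀ (i j : Q) (a : i ⟶ j), ∃ x ∈ arrowSpan k Q,
    N (toBound θ (arrow k a)) = toBound θ x

/-- A maximal bound path: nonzero in `kQ/(θ)`, while every prolongation by an arrow is zero. -/
def IsMaximalBoundPath (θ : Set (PathAlgebra k Q)) {i j : Q} (p : Quiver.Path i j) : Prop :=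
  toBound θ (ofPath k p) ≠ 0 ∧
    (∀ (l : Q) (a : j ⟶ l), toBound θ (ofPath k (p.cons a)) = 0) ∧
    ∀ (h : Q) (a : h ⟶ i), toBound θ (ofPath k (a.toPath.comp p)) = 0

/-- `(Q, θ)` is a stable translation quiver of Loewy length `l + 1` with Nakayama
translation `ν`. -/
structure IsStableTranslationQuiver (θ : Set (PathAlgebra k Q)) (ν : Equiv.Perm Q) (l : ℕ) :
    Prop where
  length_eq : ∀ (i j : Q) (p : Quiver.Path i j), IsMaximalBoundPath θ p → p.length = l
  exists_path : ∀ i : Q, ∃ p : Quiver.Path (ν i) i, IsMaximalBoundPath θ p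
  no_path : ∀ i j : Q, j ≠ i → ∀ p : Quiver.Path (ν i) j, p.length = l →
    toBound θ (ofPath k p) = 0
  dependent : ∀ (i j j' : Q) (p : Quiver.Path i j) (q : Quiver.Path i j'),
    IsMaximalBoundPath θ p → IsMaximalBoundPath θ q →
      ¬ LinearIndependent k ![toBound θ (ofPath k p), toBound θ (ofPath k q)]

end Nakayama

/-! ### The quiver of the cyclic extension -/

section CyclicQuiver

open PathAlgebra

/-- The vertex set `Q₀ × ℤ/m`, with elements `⟨i, t⟩`; the permutation `ν` enters its arrows. -/
@[ext]
structure CyclicVertex {Q : Type u} (ν : Equiv.Perm Q) (m : ℕ) : Type u where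
  /-- the vertex of the original quiver -/
  vert : Q
  /-- the index of the copy -/
  index : ZMod m

/-- The identification of the vertex set with `Q₀ × ℤ/m`. -/
def cyclicVertexEquiv {Q : Type u} (ν : Equiv.Perm Q) (m : ℕ) :
    CyclicVertex ν m ≃ Q × ZMod m where
  toFun x := (x.vert, x.index)
  invFun x := ⟨x.1, x.2⟩

instance {Q : Type u} [Fintype Q] (ν : Equiv.Perm Q) (m : ℕ) [NeZero m] :
    Fintype (CyclicVertex ν m) := Fintype.ofEquiv (Q × ZMod m) (cyclicVertexEquiv ν m).symm

variable {Q : Type u} [Quiver.{v} Q]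

/-- The arrows: `(α, t) : (i, t) → (j, t)` for each arrow `α : i → j`, and
`(β_i, t) : (i, t) → (ν i, t + 1)` for each vertex `i`. -/
inductive CyclicArrow (ν : Equiv.Perm Q) (m : ℕ) :
    CyclicVertex ν m → CyclicVertex ν m → Type (max u v)
  | copy {i j : Q} (a : i ⟶ j) (t : ZMod m) : CyclicArrow ν m ⟨i, t⟩ ⟨j, t⟩
  | conn (i : Q) (t : ZMod m) : CyclicArrow ν m ⟨i, t⟩ ⟨ν i, t + 1⟩

instance (ν : Equiv.Perm Q) (m : ℕ) : Quiver.{max u v} (CyclicVertex ν m) where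
  Hom := CyclicArrow ν m

/-- The embedding of `Q` as the copy with index `t`. -/
def copyPrefunctor (ν : Equiv.Perm Q) (m : ℕ) (t : ZMod m) : Q ⥤q CyclicVertex ν m where
  obj i := ⟨i, t⟩
  map a := CyclicArrow.copy a t

/-- The linear map `r ↦ (r, t)`, sending a path `α_l ⋯ α_1` to `(α_l, t) ⋯ (α_1, t)`. -/
def copyMap (k : Type w) [Field k] (ν : Equiv.Perm Q) (m : ℕ) (t : ZMod m) :
    PathAlgebra k Q →ₗ[k] PathAlgebra k (CyclicVertex ν m) :=
  Finsupp.linearCombination k (fun p : TotalPath Q =>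
    ofPath k ((copyPrefunctor ν m t).mapPath p.path))

/-- The connecting arrow `(β_i, t)` as an element of the path algebra. -/
def connArrow (k : Type w) [Field k] (ν : Equiv.Perm Q) (m : ℕ) (i : Q) (t : ZMod m) :
    PathAlgebra k (CyclicVertex ν m) :=
  arrow (Q := CyclicVertex ν m) k (CyclicArrow.conn i t)

/-- The relations of the cyclic extension, for `kQ/(θ)` with Nakayama automorphism `N`. In
`commute`, `x` is the linear combination of arrows that represents `ν⁻¹ (σ̃ α)`, where `σ̃` is the
automorphism multiplying every arrow by `(-1) ^ s`. -/
inductive CyclicRelation {k : Type w} [Field k] [Fintype Q] (θ : Set (PathAlgebra k Q))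
    (ν : Equiv.Perm Q) (N : BoundAlgebra θ ≃ₐ[k] BoundAlgebra θ) (s m : ℕ) [NeZero m] :
    PathAlgebra k (CyclicVertex ν m) → Prop
  | copy (r : PathAlgebra k Q) (hr : r ∈ θ) (t : ZMod m) :
      CyclicRelation θ ν N s m (copyMap k ν m t r)
  | square (i : Q) (t : ZMod m) :
      CyclicRelation θ ν N s m (connArrow k ν m (ν i) (t + 1) * connArrow k ν m i t)
  | commute {i j : Q} (a : i ⟶ j) (t : ZMod m) (x : PathAlgebra k Q) (hx : x ∈ arrowSpan k Q)
      (hN : toBound θ x = N.symm (toBound θ ((-1 : k) ^ s • arrow k a))) :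
      CyclicRelation θ ν N s m
        (copyMap k ν m t (arrow k a) * connArrow k ν m (ν.symm i) (t - 1) -
          connArrow k ν m (ν.symm j) (t - 1) * copyMap k ν m (t - 1) x)

/-- The relation set of the cyclic extension. -/
def cyclicRelations {k : Type w} [Field k] [Fintype Q] (θ : Set (PathAlgebra k Q))
    (ν : Equiv.Perm Q) (N : BoundAlgebra θ ≃ₐ[k] BoundAlgebra θ) (s m : ℕ) [NeZero m] :
    Set (PathAlgebra k (CyclicVertex ν m)) :=
  {r | CyclicRelation θ ν N s m r}

/-- The permutation `(i, t) ↦ (i, t - 1)`. -/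
def cyclicShift {Q : Type u} (ν : Equiv.Perm Q) (m : ℕ) : Equiv.Perm (CyclicVertex ν m) where
  toFun x := ⟨x.vert, x.index - 1⟩
  invFun x := ⟨x.vert, x.index + 1⟩
  left_inv x := by simp
  right_inv x := by simp

end CyclicQuiver

/-! ### Skew group algebras of exterior algebras -/

section SkewGroup

variable {k : Type w} [Field k] {V : Type u} [AddCommGroup V] [Module k V]

/-- `GL(V)` acts on the exterior algebra by algebra automorphisms. -/
instance exteriorAction : MulSemiringAction (V ≃ₗ[k] V) (ExteriorAlgebra k V) where
  smul g x := ExteriorAlgebra.map (g : V →ₗ[k] V) x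
  one_smul x := by
    change ExteriorAlgebra.map (LinearMap.id : V →ₗ[k] V) x = x
    rw [ExteriorAlgebra.map_id]; rfl
  mul_smul g h x := by
    change ExteriorAlgebra.map ((g : V →ₗ[k] V) ∘ₗ (h : V →ₗ[k] V)) x = _
    rw [← ExteriorAlgebra.map_comp_map]; rfl
  smul_zero g := map_zero (ExteriorAlgebra.map (g : V →ₗ[k] V))
  smul_add g := map_add (ExteriorAlgebra.map (g : V →ₗ[k] V))
  smul_one g := map_one (ExteriorAlgebra.map (g : V →ₗ[k] V))
  smul_mul g := map_mul (ExteriorAlgebra.map (g : V →ₗ[k] V))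

instance exteriorAction_comm : SMulCommClass (V ≃ₗ[k] V) k (ExteriorAlgebra k V) where
  smul_comm g c x := map_smul (ExteriorAlgebra.map (g : V →ₗ[k] V)) c x

/-- The skew group algebra `⋀V * G`, with product `(a g) (b h) = a g(b) gh`. -/
abbrev ExteriorSkew (G : Subgroup (V ≃ₗ[k] V)) : Type (max u w) :=
  SkewMonoidAlgebra (ExteriorAlgebra k V) G

/-- The part of degree `d` of `⋀V * G`, spanned by the `x g` with `x ∈ ⋀^d V` and `g ∈ G`. -/
def exteriorSkewDegree (G : Subgroup (V ≃ₗ[k] V)) (d : ℕ) : Submodule k (ExteriorSkew G) :=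
  Submodule.span k
    {y | ∃ x ∈ ⋀[k]^d V, ∃ g : G, y = SkewMonoidAlgebra.single g x}

/-- The embedding `GL(V) → SL(V ⊕ k)`, `g ↦ diag(g, det(g)⁻¹)`. -/
def detEmbedding : (V ≃ₗ[k] V) →* ((V × k) ≃ₗ[k] (V × k)) where
  toFun g := LinearEquiv.prodCongr g (LinearEquiv.smulOfUnit (LinearEquiv.det g)⁻¹)
  map_one' := by
    ext x <;> simp [LinearEquiv.smulOfUnit, DistribMulAction.toLinearEquiv]
  map_mul' g h := by
    ext x <;> simp [LinearEquiv.smulOfUnit, mul_comm, mul_left_comm, Units.smul_def]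

/-- The transformation `diag(1, …, 1, ξ)` of `V ⊕ k`. -/
def lastScaling (V : Type u) [AddCommGroup V] [Module k V] (ξ : kˣ) :
    (V × k) ≃ₗ[k] (V × k) :=
  LinearEquiv.prodCongr (LinearEquiv.refl k V) (LinearEquiv.smulOfUnit ξ)

/-- The group `G̃ = G' C_m` generated by the image `G'` of `G` in `SL(V ⊕ k)` and by
`diag(1, …, 1, ξ)`. -/
def cyclicExtension (G : Subgroup (V ≃ₗ[k] V)) (ξ : kˣ) : Subgroup ((V × k) ≃ₗ[k] (V × k)) :=
  G.map detEmbedding ⊔ Subgroup.zpowers (lastScaling V ξ)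

end SkewGroup

end

/-!
Let `y` be the last basis vector of `V ⊕ k`, and let `ε_t` be the idempotents of the group algebra
of the central subgroup `C_m`. In the skew group algebra of `⋀V'` every element is uniquely of the
form `∑ t, (a_t + b_t y) ε_t` with `a_t`, `b_t` in `⋀V * G`, where `y² = 0`, `y ε_t = ε_(t+1) y`
and `y a = τ(a) y` for the automorphism `τ` that multiplies `v ∈ V` by `-1` and `g ∈ G` by `det g`.
Up to the sign `(-1)^s` on `V`, this `τ` is the Nakayama automorphism of the Frobenius algebra
`⋀V * G`, so it becomes `ν` and that sign on the basic algebra: an intertwiner `u` of degree `0`,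
unique up to a unit, moves `e_i` to `e_(ν i)` past `τ`. Hence the elements `u y e_i ε_t` are the
connecting arrows, `y a = τ(a) y` is the commutation relation, and comparing normal forms shows
that there are no further relations. The Nakayama automorphism of `⋀V' * G̃` multiplies `g` by its
determinant, which is `1` on `G'` and `ξ` on the generator of `C_m`, so it fixes `e_i` and sends
`ε_t` to `ε_(t-1)`.
-/

noncomputable section

universe u v w

namespace PathAlgebra

variable {k : Type w} [Field k] {Q : Type u} [Quiver.{v} Q]

section LinearLift

variable {M : Type*} [AddCommMonoid M] [Module k M]

variable (k) in
/-- The linear map on `kQ` with prescribed values on the paths. -/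
def linearLift (g : TotalPath Q → M) : PathAlgebra k Q →ₗ[k] M :=
  Finsupp.linearCombination k g

@[simp]
theorem linearLift_ofPath (g : TotalPath Q → M) {i j : Q} (p : Quiver.Path i j) :
    linearLift k g (ofPath k p) = g ⟨i, j, p⟩ := by
  unfold linearLift ofPath
  erw [Finsupp.linearCombination_single, one_smul]

theorem linearMap_ext {f g : PathAlgebra k Q →ₗ[k] M}
    (h : ∀ {i j : Q} (p : Quiver.Path i j), f (ofPath k p) = g (ofPath k p)) : f = g := by
  ext x
  induction x using induction_ofPath with
  | h0 => simp only [map_zero]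
  | hadd x y hx hy => simp only [map_add, hx, hy]
  | hsmul c i j p => simp only [map_smul, h p]

theorem map_mul_of_ofPath {C : Type*} [Ring C] [Algebra k C] (f : PathAlgebra k Q →ₗ[k] C)
    (h : ∀ {i j i' j' : Q} (p : Quiver.Path i j) (q : Quiver.Path i' j'),
      f (ofPath k p * ofPath k q) = f (ofPath k p) * f (ofPath k q)) (x y : PathAlgebra k Q) :
    f (x * y) = f x * f y := by
  have hbilin : (mulLin k Q).compr₂ f = (LinearMap.mul k C).compl₁₂ f f :=
    linearMap_ext fun p => linearMap_ext fun q => h p q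
  exact LinearMap.congr_fun₂ hbilin x y

end LinearLift

theorem arrow_mul_ofPath {i j l : Q} (a : j ⟶ l) (p : Quiver.Path i j) :
    arrow k a * ofPath k p = ofPath k (p.cons a) :=
  ofPath_mul_ofPath _ _

theorem vertex_mul_ofPath {i j : Q} (p : Quiver.Path i j) :
    vertex k j * ofPath k p = ofPath k p :=
  ofPath_mul_ofPath _ _

theorem ofPath_mul_vertex {i j : Q} (p : Quiver.Path i j) :
    ofPath k p * vertex k i = ofPath k p := by
  rw [vertex, ofPath_mul_ofPath, Quiver.Path.nil_comp]

theorem orthogonalIdempotents_vertex [Fintype Q] :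
    OrthogonalIdempotents (fun i : Q => vertex k i) where
  idem _ := vertex_mul_ofPath _
  ortho _ _ h := ofPath_mul_of_ne _ _ h.symm

theorem mem_of_arrow_mul_mem (S : Submodule k (PathAlgebra k Q)) (hvertex : ∀ i, vertex k i ∈ S)
    (harrow : ∀ {i j : Q} (a : i ⟶ j), ∀ x ∈ S, arrow k a * x ∈ S) (x : PathAlgebra k Q) :
    x ∈ S := by
  induction x using induction_ofPath with
  | h0 => exact S.zero_mem
  | hadd x y hx hy => exact S.add_mem hx hy
  | hsmul c i j p =>
    refine S.smul_mem _ ?_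
    induction p with
    | nil => exact hvertex i
    | cons p a ih => exact arrow_mul_ofPath (k := k) a p ▸ harrow a _ ih

end PathAlgebra

/-- Elements `vertex i` and `arrow a` of a ring that satisfy the relations between the trivial
paths and the arrows of `kQ`, that is, the data of a homomorphism from `kQ` which need not
preserve `1`. -/
structure QuiverRepresentation (Q : Type u) [Quiver.{v} Q] (C : Type*) [Ring C] where
  /-- the image of the trivial path at `i` -/
  vertex : Q → C
  /-- the image of the arrow `a` -/
  arrow : ∀ {i j : Q}, (i ⟶ j) → C
  orthogonal : OrthogonalIdempotents vertex
  vertex_mul_arrow : ∀ {i j : Q} (a : i ⟶ j), vertex j * arrow a = arrow a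
  arrow_mul_vertex : ∀ {i j : Q} (a : i ⟶ j), arrow a * vertex i = arrow a

namespace QuiverRepresentation

variable {k : Type w} [Field k] {Q : Type u} [Quiver.{v} Q]
variable {C : Type*} [Ring C] [Algebra k C] (E : QuiverRepresentation Q C)

/-- The product of the elements attached to the arrows of a path. -/
def evalPath {i : Q} : ∀ {j : Q}, Quiver.Path i j → C
  | _, .nil => E.vertex i
  | _, .cons p a => E.arrow a * evalPath p

theorem vertex_mul_evalPath {i j : Q} (p : Quiver.Path i j) :
    E.vertex j * E.evalPath p = E.evalPath p := by
  cases p with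
  | nil => exact E.orthogonal.idem i
  | cons p a => rw [evalPath, ← mul_assoc, E.vertex_mul_arrow]

theorem evalPath_mul_vertex {i j : Q} (p : Quiver.Path i j) :
    E.evalPath p * E.vertex i = E.evalPath p := by
  induction p with
  | nil => exact E.orthogonal.idem i
  | cons p a ih => rw [evalPath, mul_assoc, ih]

theorem evalPath_comp {i j l : Q} (p : Quiver.Path i j) (q : Quiver.Path j l) :
    E.evalPath (p.comp q) = E.evalPath q * E.evalPath p := by
  induction q with
  | nil => rw [Quiver.Path.comp_nil, evalPath, vertex_mul_evalPath]
  | cons q a ih => rw [Quiver.Path.comp_cons, evalPath, evalPath, ih, mul_assoc]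

theorem evalPath_mul_of_ne {i j i' j' : Q} (p : Quiver.Path i j) (q : Quiver.Path i' j')
    (h : i ≠ j') : E.evalPath p * E.evalPath q = 0 := by
  rw [← E.evalPath_mul_vertex p, ← E.vertex_mul_evalPath q, mul_assoc, ← mul_assoc (E.vertex i),
    E.orthogonal.ortho h, zero_mul, mul_zero]

open PathAlgebra (linearLift linearLift_ofPath ofPath ofPath_mul_ofPath ofPath_mul_of_ne)

variable (k) in
/-- The homomorphism from the path algebra determined by the images of the trivial paths and the
arrows. -/
def lift : PathAlgebra k Q →ₙₐ[k] C :=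
  { linearLift k fun p : TotalPath Q => E.evalPath p.path with
    map_zero' := map_zero (linearLift k fun p : TotalPath Q => E.evalPath p.path)
    map_mul' := PathAlgebra.map_mul_of_ofPath (linearLift k fun p => E.evalPath p.path)
      fun {i j i' j'} p q => by
        by_cases h : i = j'
        · subst h
          rw [ofPath_mul_ofPath, linearLift_ofPath, linearLift_ofPath, linearLift_ofPath,
            evalPath_comp]
        · rw [ofPath_mul_of_ne _ _ (Ne.symm h), map_zero, linearLift_ofPath, linearLift_ofPath,
            E.evalPath_mul_of_ne p q h] }

theorem lift_ofPath {i j : Q} (p : Quiver.Path i j) : E.lift k (ofPath k p) = E.evalPath p :=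
  linearLift_ofPath (k := k) (fun p : TotalPath Q => E.evalPath p.path) p

theorem lift_vertex (i : Q) : E.lift k (PathAlgebra.vertex k i) = E.vertex i :=
  E.lift_ofPath _

theorem lift_arrow {i j : Q} (a : i ⟶ j) : E.lift k (PathAlgebra.arrow k a) = E.arrow a :=
  (E.lift_ofPath _).trans (E.arrow_mul_vertex a)

end QuiverRepresentation

namespace PathAlgebra

variable {k : Type w} [Field k] {Q : Type u} [Quiver.{v} Q]

variable (k Q) in
/-- The projection of `kQ` to the component of degree `d`, which is spanned by the paths of
length `d`. -/
def lengthPart (d : ℕ) : PathAlgebra k Q →ₗ[k] PathAlgebra k Q :=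
  linearLift k fun p : TotalPath Q => if p.path.length = d then ofPath k p.path else 0

theorem lengthPart_ofPath (d : ℕ) {i j : Q} (p : Quiver.Path i j) :
    lengthPart k Q d (ofPath k p) = if p.length = d then ofPath k p else 0 :=
  linearLift_ofPath _ p

open Finset in
theorem lengthPart_mul (d : ℕ) (x y : PathAlgebra k Q) :
    lengthPart k Q d (x * y) =
      ∑ c ∈ antidiagonal d, lengthPart k Q c.1 x * lengthPart k Q c.2 y := by
  have hbilin : (mulLin k Q).compr₂ (lengthPart k Q d) =
      ∑ c ∈ antidiagonal d, (mulLin k Q).compl₁₂ (lengthPart k Q c.1) (lengthPart k Q c.2) := by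
    refine linearMap_ext fun {i j} p => linearMap_ext fun {i' j'} q => ?_
    simp only [LinearMap.sum_apply, LinearMap.compr₂_apply, LinearMap.compl₁₂_apply, ← mul_eq,
      lengthPart_ofPath]
    by_cases h : j' = i
    · subst h
      rw [ofPath_mul_ofPath, lengthPart_ofPath, Quiver.Path.length_comp]
      split_ifs with hd
      · rw [sum_eq_single (p.length, q.length)]
        · simp [ofPath_mul_ofPath]
        · rintro ⟨a, b⟩ - hab
          by_cases ha : p.length = a <;> by_cases hb : q.length = b <;> simp_all
        · simp only [HasAntidiagonal.mem_antidiagonal]; omega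
      · refine (sum_eq_zero fun c hc => ?_).symm
        rw [HasAntidiagonal.mem_antidiagonal] at hc
        by_cases ha : p.length = c.1 <;> by_cases hb : q.length = c.2 <;> simp [ha, hb]
        omega
    · rw [ofPath_mul_of_ne _ _ h, map_zero]
      refine (sum_eq_zero fun c _ => ?_).symm
      split_ifs <;> simp [ofPath_mul_of_ne _ _ h]
  simpa only [LinearMap.sum_apply, LinearMap.compr₂_apply, LinearMap.compl₁₂_apply, ← mul_eq] using
    LinearMap.congr_fun₂ hbilin x y

theorem lengthPart_zero_mem (x : PathAlgebra k Q) :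
    lengthPart k Q 0 x ∈ Submodule.span k (Set.range (vertex k : Q → PathAlgebra k Q)) := by
  induction x using induction_ofPath with
  | h0 => exact map_zero (lengthPart k Q 0) ▸ zero_mem _
  | hadd x y hx hy => exact map_add (lengthPart k Q 0) x y ▸ add_mem hx hy
  | hsmul c i j p =>
    rw [map_smul, lengthPart_ofPath]
    refine Submodule.smul_mem _ _ ?_
    cases p with
    | nil => exact Submodule.subset_span ⟨i, rfl⟩
    | cons p a => exact zero_mem _

theorem lengthPart_one_mem (x : PathAlgebra k Q) : lengthPart k Q 1 x ∈ arrowSpan k Q := by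
  induction x using induction_ofPath with
  | h0 => exact map_zero (lengthPart k Q 1) ▸ zero_mem _
  | hadd x y hx hy => exact map_add (lengthPart k Q 1) x y ▸ add_mem hx hy
  | hsmul c i j p =>
    rw [map_smul, lengthPart_ofPath]
    refine Submodule.smul_mem _ _ ?_
    match p with
    | .nil => exact zero_mem _
    | .cons .nil a => exact Submodule.subset_span ⟨_, _, a, rfl⟩
    | .cons (.cons p b) a => simp

theorem lengthPart_one_of_mem_arrowSpan {x : PathAlgebra k Q} (hx : x ∈ arrowSpan k Q) :
    lengthPart k Q 1 x = x := by
  refine LinearMap.eqOn_span' (f := lengthPart k Q 1) (g := LinearMap.id) ?_ hx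
  rintro _ ⟨i, j, a, rfl⟩
  exact (lengthPart_ofPath 1 a.toPath).trans (if_pos rfl)

theorem lengthPart_of_isQuadraticRelation {d : ℕ} (hd : d ≠ 2) {r : PathAlgebra k Q}
    (hr : IsQuadraticRelation r) : lengthPart k Q d r = 0 := by
  obtain ⟨i, j, hr⟩ := hr
  refine LinearMap.eqOn_span' (f := lengthPart k Q d) (g := 0) ?_ hr
  rintro _ ⟨p, hp, rfl⟩
  exact (lengthPart_ofPath d p).trans (if_neg (by omega))

variable (k Q) in
/-- The ideal of `kQ` spanned by the paths of length at least `n`. -/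
def longPaths (n : ℕ) : TwoSidedIdeal (PathAlgebra k Q) :=
  .mk' {x | ∀ d < n, lengthPart k Q d x = 0} (fun _ _ => map_zero _)
    (fun hx hy d hd => by rw [map_add, hx d hd, hy d hd, add_zero])
    (fun hx d hd => by rw [map_neg, hx d hd, neg_zero])
    (fun hy d hd => by
      rw [lengthPart_mul]
      exact Finset.sum_eq_zero fun c hc => by
        rw [hy _ ((Finset.HasAntidiagonal.antidiagonal.snd_le hc).trans_lt hd), mul_zero])
    (fun hx d hd => by
      rw [lengthPart_mul]
      exact Finset.sum_eq_zero fun c hc => by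
        rw [hx _ ((Finset.HasAntidiagonal.antidiagonal.fst_le hc).trans_lt hd), zero_mul])

theorem mem_longPaths {n : ℕ} {x : PathAlgebra k Q} :
    x ∈ longPaths k Q n ↔ ∀ d < n, lengthPart k Q d x = 0 :=
  TwoSidedIdeal.mem_mk' ..

end PathAlgebra

namespace BoundAlgebra

open PathAlgebra

variable {k : Type w} [Field k] {Q : Type u} [Quiver.{v} Q] [Fintype Q]
variable {θ : Set (PathAlgebra k Q)}

theorem toBound_eq_zero {r : PathAlgebra k Q} (hr : r ∈ θ) : toBound θ r = 0 :=
  (RingQuot.mkAlgHom_rel k ⟨hr, rfl⟩).trans (map_zero _)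

theorem toBound_surjective : Function.Surjective (toBound θ) := RingQuot.mkAlgHom_surjective k _

theorem mem_of_toBound_eq_zero {J : TwoSidedIdeal (PathAlgebra k Q)} (hθ : ∀ r ∈ θ, r ∈ J)
    {x : PathAlgebra k Q} (hx : toBound θ x = 0) : x ∈ J := by
  have hrel : ∀ ⦃a b⦄, a ∈ θ ∧ b = 0 → J.ringCon.mk' a = J.ringCon.mk' b := by
    rintro a _ ⟨ha, rfl⟩
    exact (RingCon.eq _).2 ((TwoSidedIdeal.mem_iff J a).1 (hθ a ha))
  have hmk : RingQuot.mkRingHom (fun a b : PathAlgebra k Q => a ∈ θ ∧ b = 0) x = 0 := by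
    rw [← hx, toBound, ← RingQuot.mkAlgHom_coe k]; rfl
  rw [← TwoSidedIdeal.ker_ringCon_mk' J, TwoSidedIdeal.mem_ker,
    ← RingQuot.lift_mkRingHom_apply J.ringCon.mk' hrel, hmk, map_zero]

theorem eq_of_toBound_eq {C : Type*} [Ring C] [Algebra k C] {ψ : PathAlgebra k Q →ₙₐ[k] C}
    (hψ : ∀ r ∈ θ, ψ r = 0) {x y : PathAlgebra k Q} (h : toBound θ x = toBound θ y) :
    ψ x = ψ y := by
  rw [← sub_eq_zero, ← map_sub, ← TwoSidedIdeal.mem_ker]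
  refine mem_of_toBound_eq_zero (fun r hr => (TwoSidedIdeal.mem_ker ψ).2 (hψ r hr)) ?_
  rw [map_sub, h, sub_self]

/-- The factorization through `kQ/(θ)` of a homomorphism on `kQ`, possibly not unital, that
kills `θ`. -/
def lift {C : Type*} [Ring C] [Algebra k C] (ψ : PathAlgebra k Q →ₙₐ[k] C)
    (hψ : ∀ r ∈ θ, ψ r = 0) : BoundAlgebra θ →ₙₐ[k] C :=
  have key {x y} := eq_of_toBound_eq (x := x) (y := y) hψ
  have hinv b : toBound θ (Function.surjInv toBound_surjective b) = b :=
    Function.surjInv_eq toBound_surjective b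
  { toFun := fun b => ψ (Function.surjInv (toBound_surjective (θ := θ)) b)
    map_smul' := fun c b => by
      rw [MonoidHom.id_apply, ← map_smul]
      exact key (by rw [hinv, map_smul, hinv])
    map_zero' := by
      rw [← map_zero ψ]
      exact key (by rw [hinv, map_zero])
    map_add' := fun a b => by
      rw [← map_add]
      exact key (by rw [hinv, map_add, hinv, hinv])
    map_mul' := fun a b => by
      rw [← map_mul]
      exact key (by rw [hinv, map_mul, hinv, hinv]) }

theorem lift_toBound {C : Type*} [Ring C] [Algebra k C] {ψ : PathAlgebra k Q →ₙₐ[k] C}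
    (hψ : ∀ r ∈ θ, ψ r = 0) (x : PathAlgebra k Q) : lift ψ hψ (toBound θ x) = ψ x :=
  eq_of_toBound_eq hψ (Function.surjInv_eq toBound_surjective _)

theorem injOn_toBound_arrowSpan (hθ : ∀ r ∈ θ, IsQuadraticRelation r) :
    Set.InjOn (toBound θ) (arrowSpan k Q) := by
  intro x hx y hy h
  have hlong : x - y ∈ longPaths k Q 2 := by
    refine mem_of_toBound_eq_zero (θ := θ) (fun r hr => mem_longPaths.2 fun d hd => ?_) ?_
    · exact lengthPart_of_isQuadraticRelation hd.ne (hθ r hr)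
    · rw [map_sub, h, sub_self]
  rw [← sub_eq_zero, ← lengthPart_one_of_mem_arrowSpan (sub_mem hx hy)]
  exact mem_longPaths.1 hlong 1 one_lt_two

end BoundAlgebra

section Graded

variable {R : Type*} [CommRing R] {A : Type*} [Ring A] [Algebra R A]
variable (𝒜 : ℕ → Submodule R A) [GradedAlgebra 𝒜]

theorem gradedProj_mem (d : ℕ) (a : A) : GradedAlgebra.proj 𝒜 d a ∈ 𝒜 d := by
  rw [GradedAlgebra.proj_apply]
  exact SetLike.coe_mem _

variable {𝒜} in
theorem gradedProj_of_mem {d : ℕ} {a : A} (h : a ∈ 𝒜 d) : GradedAlgebra.proj 𝒜 d a = a := by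
  rw [GradedAlgebra.proj_apply, DirectSum.decompose_of_mem_same 𝒜 h]

variable {𝒜} in
theorem gradedProj_of_mem_ne {d d' : ℕ} {a : A} (h : a ∈ 𝒜 d) (hd : d ≠ d') :
    GradedAlgebra.proj 𝒜 d' a = 0 := by
  rw [GradedAlgebra.proj_apply, DirectSum.decompose_of_mem_ne 𝒜 h hd]

theorem gradedProj_zero_mul (a b : A) :
    GradedAlgebra.proj 𝒜 0 (a * b) = GradedAlgebra.proj 𝒜 0 a * GradedAlgebra.proj 𝒜 0 b :=
  map_mul (GradedRing.projZeroRingHom 𝒜) a b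

variable {𝒜} in
theorem gradedProj_mul_of_left_mem {d : ℕ} {a : A} (h : a ∈ 𝒜 d) (j : ℕ) (b : A) :
    GradedAlgebra.proj 𝒜 (d + j) (a * b) = a * GradedAlgebra.proj 𝒜 j b := by
  simp only [GradedAlgebra.proj_apply]
  exact DirectSum.coe_decompose_mul_add_of_left_mem 𝒜 h

variable {𝒜} in
theorem gradedProj_mul_of_right_mem {d : ℕ} {b : A} (h : b ∈ 𝒜 d) (j : ℕ) (a : A) :
    GradedAlgebra.proj 𝒜 (j + d) (a * b) = GradedAlgebra.proj 𝒜 j a * b := by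
  simp only [GradedAlgebra.proj_apply]
  exact DirectSum.coe_decompose_mul_add_of_right_mem 𝒜 h

theorem exists_sum_gradedProj (a : A) :
    ∃ s : Finset ℕ, a = ∑ d ∈ s, GradedAlgebra.proj 𝒜 d a := by
  classical
  refine ⟨(DirectSum.decompose 𝒜 a).support, ?_⟩
  simp only [GradedAlgebra.proj_apply]
  exact (DirectSum.sum_support_decompose 𝒜 a).symm

theorem eq_zero_of_gradedProj {a : A} (h : ∀ d, GradedAlgebra.proj 𝒜 d a = 0) : a = 0 := by
  obtain ⟨s, hs⟩ := exists_sum_gradedProj 𝒜 a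
  exact hs.trans (Finset.sum_eq_zero fun d _ => h d)

theorem gradedProj_mul_eq_zero {a b : A} {j : ℕ} (ha : GradedAlgebra.proj 𝒜 0 a = 0)
    (hb : ∀ d < j, GradedAlgebra.proj 𝒜 d b = 0) :
    ∀ d < j + 1, GradedAlgebra.proj 𝒜 d (a * b) = 0 := by
  intro d hd
  obtain ⟨s, hs⟩ := exists_sum_gradedProj 𝒜 a
  obtain ⟨t, ht⟩ := exists_sum_gradedProj 𝒜 b
  rw [hs, ht, Finset.sum_mul_sum, map_sum]
  refine Finset.sum_eq_zero fun x _ => ?_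
  rw [map_sum]
  refine Finset.sum_eq_zero fun y _ => ?_
  by_cases hx : x = 0
  · rw [hx, ha, zero_mul, map_zero]
  by_cases hy : y < j
  · rw [hb y hy, mul_zero, map_zero]
  · exact gradedProj_of_mem_ne
      (SetLike.GradedMul.mul_mem (gradedProj_mem 𝒜 x a) (gradedProj_mem 𝒜 y b)) (by omega)

theorem isNilpotent_of_gradedProj_zero {n : ℕ} (hn : ∀ d, n < d → 𝒜 d = ⊥) {a : A}
    (ha : GradedAlgebra.proj 𝒜 0 a = 0) : IsNilpotent a := by
  have hpow (j : ℕ) : ∀ d < j, GradedAlgebra.proj 𝒜 d (a ^ j) = 0 := by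
    induction j with
    | zero => exact fun d hd => absurd hd d.not_lt_zero
    | succ j ih => exact pow_succ' a j ▸ gradedProj_mul_eq_zero 𝒜 ha ih
  refine ⟨n + 1, eq_zero_of_gradedProj 𝒜 fun d => ?_⟩
  rcases Nat.lt_or_ge d (n + 1) with hd | hd
  · exact hpow _ d hd
  · exact (Submodule.mem_bot R).1 (hn d hd ▸ gradedProj_mem 𝒜 d _)

theorem eq_zero_of_isIdempotentElem_of_gradedProj {n : ℕ} (hn : ∀ d, n < d → 𝒜 d = ⊥) {a : A}
    (hi : IsIdempotentElem a) (ha : GradedAlgebra.proj 𝒜 0 a = 0) : a = 0 := by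
  obtain ⟨j, hj⟩ := isNilpotent_of_gradedProj_zero 𝒜 hn ha
  rw [← hi.pow_succ_eq j, pow_succ, hj, zero_mul]

theorem exists_mul_eq_gradedProj_zero {n : ℕ} (hn : ∀ d, n < d → 𝒜 d = ⊥) {z : A}
    (he : IsIdempotentElem (GradedAlgebra.proj 𝒜 0 z)) (hz : z * GradedAlgebra.proj 𝒜 0 z = z) :
    ∃ w, w * z = GradedAlgebra.proj 𝒜 0 z := by
  have hnil : IsNilpotent (GradedAlgebra.proj 𝒜 0 z - z) :=
    isNilpotent_of_gradedProj_zero 𝒜 hn <| by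
      rw [map_sub, gradedProj_of_mem (gradedProj_mem 𝒜 0 z), sub_self]
  obtain ⟨v, hv⟩ := hnil.isUnit_one_sub
  have hvz : (v : A) * GradedAlgebra.proj 𝒜 0 z = z := by
    rw [hv, sub_mul, sub_mul, one_mul, he.eq, hz, sub_sub_cancel]
  exact ⟨(v⁻¹ : Aˣ), by rw [Units.inv_mul_eq_iff_eq_mul, hvz]⟩

end Graded

section Idempotents

variable {A B : Type*} [Ring A] [Ring B]

/-- A full element of a ring: the two-sided ideal it generates is the whole ring. For an
idempotent `E` this is the condition under which the corner `E A E` is Morita equivalent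
to `A`. -/
def IsFull (E : A) : Prop := 1 ∈ TwoSidedIdeal.span {E}

theorem IsFull.map_one_eq_zero {E : A} (hE : IsFull E) {M : Type*} [AddGroup M] (T : A →+ M)
    (hT : ∀ a b, T (a * E * b) = 0) : T 1 = 0 := by
  refine (AddSubgroup.closure_le T.ker).2 ?_
    (TwoSidedIdeal.mem_span_iff_mem_addSubgroup_closure.1 hE)
  rintro _ ⟨_, ⟨a, -, _, rfl, rfl⟩, b, -, rfl⟩
  exact hT a b

theorem IsFull.eq_zero_of_map_mul {E : A} (hE : IsFull E) (π : A →+* B) {x : B}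
    (h : ∀ a, π (E * a) * x = 0) : x = 0 := by
  have hT := hE.map_one_eq_zero ((AddMonoidHom.mulRight x).comp π.toAddMonoidHom)
    fun a b => show π (a * E * b) * x = 0 by rw [mul_assoc, map_mul, mul_assoc, h, mul_zero]
  simpa using hT

theorem IsFull.eq_zero_of_mul_map {E : A} (hE : IsFull E) (π : A →+* B) {x : B}
    (h : ∀ a, x * π (a * E) = 0) : x = 0 := by
  have hT := hE.map_one_eq_zero ((AddMonoidHom.mulLeft x).comp π.toAddMonoidHom)
    fun a b => show x * π (a * E * b) = 0 by rw [map_mul, ← mul_assoc, h, zero_mul]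
  simpa using hT

theorem IsFull.map {E : A} (hE : IsFull E) (π : A →+* B) : IsFull (π E) := by
  have hcomap : E ∈ (TwoSidedIdeal.span {π E}).comap π :=
    (TwoSidedIdeal.mem_comap π).2 (TwoSidedIdeal.subset_span rfl)
  have hone := TwoSidedIdeal.mem_span_iff.1 hE _ (Set.singleton_subset_iff.2 hcomap)
  rwa [TwoSidedIdeal.mem_comap, map_one] at hone

/-- Mutually inverse elements between two idempotents give an isomorphism of the left ideals they
generate. -/
def spanSingletonEquiv {f g p q : A} (hf : q * p = f) (hg : p * q = g) (hp : p * f = p)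
    (hq : q * g = q) : Ideal.span {f} ≃ₗ[A] Ideal.span {g} where
  toFun x := ⟨x.1 * q, by
    rw [← hq, ← mul_assoc]
    exact Ideal.mul_mem_left _ _ (Ideal.mem_span_singleton_self g)⟩
  invFun x := ⟨x.1 * p, by
    rw [← hp, ← mul_assoc]
    exact Ideal.mul_mem_left _ _ (Ideal.mem_span_singleton_self f)⟩
  map_add' x y := Subtype.ext (add_mul _ _ _)
  map_smul' c x := Subtype.ext (mul_assoc _ _ _)
  left_inv x := by
    have hff : f * f = f := by nth_rw 1 [← hf, mul_assoc, hp, hf]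
    obtain ⟨a, ha⟩ := Ideal.mem_span_singleton'.1 x.2
    refine Subtype.ext ?_
    change x.1 * q * p = x.1
    rw [mul_assoc, hf, ← ha, mul_assoc, hff]
  right_inv x := by
    have hgg : g * g = g := by nth_rw 1 [← hg, mul_assoc, hq, hg]
    obtain ⟨a, ha⟩ := Ideal.mem_span_singleton'.1 x.2
    refine Subtype.ext ?_
    change x.1 * p * q = x.1
    rw [mul_assoc, hg, ← ha, mul_assoc, hgg]

theorem exists_mul_of_spanSingletonEquiv {f g : A} (hf : IsIdempotentElem f)
    (hg : IsIdempotentElem g) (ψ : Ideal.span {f} ≃ₗ[A] Ideal.span {g}) :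
    ∃ b c : A, b * c = f ∧ f * b = b ∧ b * g = b ∧ g * c = c := by
  let F : Ideal.span {f} := ⟨f, Ideal.mem_span_singleton_self f⟩
  let K : Ideal.span {g} := ⟨g, Ideal.mem_span_singleton_self g⟩
  have hb : (ψ F : A) * g = ψ F := by
    obtain ⟨a, ha⟩ := Ideal.mem_span_singleton'.1 (ψ F).2
    rw [← ha, mul_assoc, hg.eq]
  have hF : f • ψ F = ψ F := by rw [← map_smul, show f • F = F from Subtype.ext hf]
  have hK : g • ψ.symm K = ψ.symm K := by rw [← map_smul, show g • K = K from Subtype.ext hg]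
  have hFK : (ψ F : A) • ψ.symm K = F := by
    rw [← map_smul, show (ψ F : A) • K = ψ F from Subtype.ext hb, ψ.symm_apply_apply]
  exact ⟨ψ F, ψ.symm K, congrArg Subtype.val hFK, congrArg Subtype.val hF, hb,
    congrArg Subtype.val hK⟩

theorem span_singleton_lt_of_orthogonal {x y : A} (hx : IsIdempotentElem x)
    (hy : IsIdempotentElem y) (hxy : x * y = 0) (hyx : y * x = 0) (hy0 : y ≠ 0) :
    Ideal.span {x} < Ideal.span {x + y} := by
  have hle : Ideal.span {x} ≤ Ideal.span {x + y} := by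
    rw [Ideal.span_singleton_le_iff_mem, Ideal.mem_span_singleton']
    exact ⟨x, by rw [mul_add, hx.eq, hxy, add_zero]⟩
  refine lt_of_le_of_ne hle fun h => hy0 ?_
  have hy_mem : y ∈ Ideal.span {x} := by
    rw [h, Ideal.mem_span_singleton']
    exact ⟨y, by rw [mul_add, hyx, hy.eq, zero_add]⟩
  obtain ⟨a, ha⟩ := Ideal.mem_span_singleton'.1 hy_mem
  rw [← hy.eq, ← ha, mul_assoc, ha, hxy, mul_zero]

theorem mem_closure_isPrimitiveIdempotent [IsArtinianRing A] {f : A} (hf : IsIdempotentElem f) :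
    f ∈ AddSubmonoid.closure {g : A | IsPrimitiveIdempotent g} := by
  induction hI : Ideal.span {f} using WellFoundedLT.induction generalizing f with
  | ind I ih =>
    subst hI
    by_cases h0 : f = 0
    · exact h0 ▸ zero_mem _
    by_cases hprim : IsPrimitiveIdempotent f
    · exact AddSubmonoid.subset_closure hprim
    obtain ⟨x, y, hx, hy, hxy, hyx, rfl, hx0, hy0⟩ : ∃ x y : A, IsIdempotentElem x ∧
        IsIdempotentElem y ∧ x * y = 0 ∧ y * x = 0 ∧ f = x + y ∧ x ≠ 0 ∧ y ≠ 0 := by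
      by_contra! hcon
      exact hprim ⟨hf, h0, fun x y hx hy hxy hyx hfxy =>
        or_iff_not_imp_left.2 (hcon x y hx hy hxy hyx hfxy)⟩
    refine add_mem (ih _ (span_singleton_lt_of_orthogonal hx hy hxy hyx hy0) hx rfl)
      (ih _ ?_ hy rfl)
    exact add_comm x y ▸ span_singleton_lt_of_orthogonal hy hx hyx hxy hx0

theorem IsBasicFamily.isFull [IsArtinianRing A] {ι : Type*} [Fintype ι] {e : ι → A}
    (he : IsBasicFamily e) : IsFull (∑ i, e i) := by
  refine AddSubmonoid.closure_induction (motive := fun x _ => x ∈ TwoSidedIdeal.span {∑ i, e i})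
    (fun f hf => ?_) (zero_mem _) (fun _ _ _ _ hx hy => add_mem hx hy)
    (mem_closure_isPrimitiveIdempotent IsIdempotentElem.one)
  obtain ⟨i, ⟨ψ⟩⟩ := he.exists_iso f hf
  obtain ⟨b, c, rfl, -, hb, -⟩ := exists_mul_of_spanSingletonEquiv hf.1 (he.orthogonal.idem i) ψ
  have hbE : b * (∑ i, e i) = b := by
    rw [← hb, mul_assoc, he.orthogonal.mul_sum_of_mem (Finset.mem_univ i)]
  rw [← hbE]
  exact TwoSidedIdeal.mul_mem_right _ _ _
    (TwoSidedIdeal.mul_mem_left _ _ _ (TwoSidedIdeal.subset_span rfl))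

theorem IsPrimitiveIdempotent.mul_eq {f e p q : A} (hf : IsPrimitiveIdempotent f) (he : e ≠ 0)
    (hpq : p * q = e) (hpf : p * f = p) (hfq : f * q = q) (hqe : q * e = q) : q * p = f := by
  have hidem : q * p * (q * p) = q * p := by rw [mul_assoc, ← mul_assoc p, hpq, ← mul_assoc, hqe]
  have hleft : f * (q * p) = q * p := by rw [← mul_assoc, hfq]
  have hright : q * p * f = q * p := by rw [mul_assoc, hpf]
  have hcompl : IsIdempotentElem (f - q * p) := by
    rw [IsIdempotentElem, sub_mul, mul_sub, mul_sub, hf.1.eq, hleft, hright, hidem, sub_self,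
      sub_zero]
  rcases hf.2.2 (q * p) (f - q * p) hidem hcompl (by rw [mul_sub, hright, hidem, sub_self])
    (by rw [sub_mul, hleft, hidem, sub_self]) (add_sub_cancel _ _).symm with h | h
  · refine absurd ?_ he
    rw [← hpq, ← hqe, ← hpq, ← mul_assoc q, h, zero_mul, mul_zero]
  · exact (sub_eq_zero.1 h).symm

end Idempotents

section Realization

open PathAlgebra

/-- `kQ/(θ)` is realized by `φ` as the corner of the graded algebra `A = ⨁ 𝒜 d` at the full
idempotent `∑ i, e i`. This is what `IsBoundQuiverOfBasic` asserts, with fullness replacing the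
conditions on indecomposable projective modules. -/
structure IsRealization {k : Type*} [Field k] {Q : Type u} [Quiver.{v} Q] [Fintype Q]
    {A : Type*} [Ring A] [Algebra k A] (𝒜 : ℕ → Submodule k A) (θ : Set (PathAlgebra k Q))
    (e : Q → A) (φ : BoundAlgebra θ →ₙₐ[k] A) : Prop where
  quadratic : ∀ r ∈ θ, IsQuadraticRelation r
  orthogonal : OrthogonalIdempotents e
  ne_zero : ∀ i, e i ≠ 0
  degree_zero : ∀ i, e i ∈ 𝒜 0
  full : IsFull (∑ i, e i)
  injective : Function.Injective φ
  range_eq : Set.range φ = {x | ∃ a : A, x = (∑ i, e i) * a * (∑ i, e i)}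
  map_vertex : ∀ i, φ (toBound θ (vertex k i)) = e i
  map_arrow : ∀ (i j : Q) (a : i ⟶ j), φ (toBound θ (arrow k a)) ∈ 𝒜 1

theorem IsBoundQuiverOfBasic.exists_isRealization {k : Type*} [Field k] {Q : Type u}
    [Quiver.{v} Q] [Fintype Q] {A : Type*} [Ring A] [Algebra k A] [IsArtinianRing A]
    {𝒜 : ℕ → Submodule k A} {θ : Set (PathAlgebra k Q)} (h : IsBoundQuiverOfBasic 𝒜 θ) :
    ∃ e φ, IsRealization 𝒜 θ e φ := by
  obtain ⟨e, he, hdeg, φ, hinj, hrange, hvertex, harrow⟩ := h.exists_iso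
  exact ⟨e, φ, h.quadratic, he.orthogonal, fun i => (he.primitive i).2.1, hdeg, he.isFull, hinj,
    hrange, hvertex, harrow⟩

namespace IsRealization

variable {k : Type*} [Field k] {Q : Type u} [Quiver.{v} Q] [Fintype Q]
  {A : Type*} [Ring A] [Algebra k A] {𝒜 : ℕ → Submodule k A}
  {θ : Set (PathAlgebra k Q)} {e : Q → A} {φ : BoundAlgebra θ →ₙₐ[k] A}

theorem mul_sum (h : IsRealization 𝒜 θ e φ) (i : Q) : e i * ∑ j, e j = e i :=
  h.orthogonal.mul_sum_of_mem (Finset.mem_univ i)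

theorem sum_mul (h : IsRealization 𝒜 θ e φ) (i : Q) : (∑ j, e j) * e i = e i := by
  classical
  rw [Finset.sum_mul, Finset.sum_congr rfl fun j _ => h.orthogonal.mul_eq j i]
  simp

theorem vertex_mul_sum_smul (h : IsRealization 𝒜 θ e φ) (c : Q → k) (i : Q) :
    e i * ∑ j, c j • e j = c i • e i := by
  rw [Finset.mul_sum, Finset.sum_eq_single_of_mem i (Finset.mem_univ i) fun j _ hj => by
    rw [mul_smul_comm, h.orthogonal.ortho hj.symm, smul_zero], mul_smul_comm, h.orthogonal.idem i]

theorem map_one (h : IsRealization 𝒜 θ e φ) : φ 1 = ∑ j, e j := by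
  rw [← _root_.map_one (toBound θ), one_eq, map_sum, map_sum]
  exact Finset.sum_congr rfl fun i _ => h.map_vertex i

theorem sum_mul_map (h : IsRealization 𝒜 θ e φ) (b : BoundAlgebra θ) :
    (∑ j, e j) * φ b = φ b := by
  rw [← h.map_one, ← map_mul, one_mul]

theorem exists_eq (h : IsRealization 𝒜 θ e φ) (a : A) :
    ∃ b, φ b = (∑ i, e i) * a * (∑ i, e i) :=
  h.range_eq.symm.subset ⟨a, rfl⟩

theorem map_mem_of_mem_arrowSpan (h : IsRealization 𝒜 θ e φ) {x : PathAlgebra k Q}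
    (hx : x ∈ arrowSpan k Q) : φ (toBound θ x) ∈ 𝒜 1 := by
  induction hx using Submodule.span_induction with
  | mem x hx =>
    obtain ⟨i, j, a, rfl⟩ := hx
    exact h.map_arrow _ _ a
  | zero => simp only [map_zero, zero_mem]
  | add x y _ _ hx hy => simpa only [map_add] using add_mem hx hy
  | smul c x _ hx => simpa only [map_smul] using Submodule.smul_mem _ c hx

theorem vertex_mul_map_ofPath (h : IsRealization 𝒜 θ e φ) {i j : Q} (p : Quiver.Path i j) :
    e j * φ (toBound θ (ofPath k p)) = φ (toBound θ (ofPath k p)) := by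
  rw [← h.map_vertex, ← map_mul, ← map_mul, vertex_mul_ofPath]

theorem map_ofPath_mul_vertex (h : IsRealization 𝒜 θ e φ) {i j : Q} (p : Quiver.Path i j) :
    φ (toBound θ (ofPath k p)) * e i = φ (toBound θ (ofPath k p)) := by
  rw [← h.map_vertex, ← map_mul, ← map_mul, ofPath_mul_vertex]

theorem sum_mem_zero (h : IsRealization 𝒜 θ e φ) : ∑ j, e j ∈ 𝒜 0 :=
  Submodule.sum_mem _ fun i _ => h.degree_zero i

variable [GradedAlgebra 𝒜]

theorem map_ofPath_mem (h : IsRealization 𝒜 θ e φ) {i j : Q} (p : Quiver.Path i j) :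
    φ (toBound θ (ofPath k p)) ∈ 𝒜 p.length := by
  induction p with
  | nil => exact (h.map_vertex i).symm ▸ h.degree_zero i
  | cons p a ih =>
    rw [← arrow_mul_ofPath, map_mul, map_mul, Quiver.Path.length_cons, add_comm]
    exact SetLike.GradedMul.mul_mem (h.map_arrow _ _ a) ih

theorem gradedProj_map (h : IsRealization 𝒜 θ e φ) (d : ℕ) (x : PathAlgebra k Q) :
    GradedAlgebra.proj 𝒜 d (φ (toBound θ x)) = φ (toBound θ (lengthPart k Q d x)) := by
  induction x using induction_ofPath with
  | h0 => simp only [map_zero]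
  | hadd x y hx hy => simp only [map_add, hx, hy]
  | hsmul s i j p =>
    simp only [map_smul, lengthPart_ofPath]
    congr 1
    split_ifs with hp
    · exact gradedProj_of_mem (hp ▸ h.map_ofPath_mem p)
    · rw [map_zero, map_zero, gradedProj_of_mem_ne (h.map_ofPath_mem p) hp]

theorem exists_gradedProj_zero (h : IsRealization 𝒜 θ e φ) (b : BoundAlgebra θ) :
    ∃ c : Q → k, GradedAlgebra.proj 𝒜 0 (φ b) = ∑ i, c i • e i := by
  obtain ⟨x, rfl⟩ := BoundAlgebra.toBound_surjective b
  obtain ⟨c, hc⟩ := (Submodule.mem_span_range_iff_exists_fun k).1 (lengthPart_zero_mem x)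
  refine ⟨c, ?_⟩
  rw [h.gradedProj_map, ← hc, map_sum, map_sum]
  exact Finset.sum_congr rfl fun i _ => by rw [map_smul, map_smul, h.map_vertex]

theorem exists_mem_arrowSpan (h : IsRealization 𝒜 θ e φ) {b : BoundAlgebra θ}
    (hb : φ b ∈ 𝒜 1) : ∃ x ∈ arrowSpan k Q, b = toBound θ x := by
  obtain ⟨x, rfl⟩ := BoundAlgebra.toBound_surjective b
  refine ⟨lengthPart k Q 1 x, lengthPart_one_mem x, h.injective ?_⟩
  rw [← h.gradedProj_map, gradedProj_of_mem hb]

theorem exists_corner_eq (h : IsRealization 𝒜 θ e φ) (a : A) :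
    ∃ c : Q → k, (∑ i, e i) * GradedAlgebra.proj 𝒜 0 a * (∑ i, e i) = ∑ i, c i • e i := by
  obtain ⟨b, hb⟩ := h.exists_eq a
  obtain ⟨c, hc⟩ := h.exists_gradedProj_zero b
  refine ⟨c, ?_⟩
  rw [← hc, hb, gradedProj_zero_mul, gradedProj_zero_mul, gradedProj_of_mem h.sum_mem_zero]

theorem exists_vertex_corner_eq (h : IsRealization 𝒜 θ e φ) (a : A) :
    ∃ c : Q → k, ∀ i j, e i * GradedAlgebra.proj 𝒜 0 a * e j = c i • (e i * e j) := by
  classical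
  obtain ⟨c, hc⟩ := h.exists_corner_eq a
  refine ⟨c, fun i j => ?_⟩
  calc e i * GradedAlgebra.proj 𝒜 0 a * e j
      = e i * ((∑ l, e l) * GradedAlgebra.proj 𝒜 0 a * ∑ l, e l) * e j := by
        simp only [← mul_assoc, h.mul_sum]
        rw [mul_assoc _ (∑ l, e l), h.sum_mul]
    _ = c i • (e i * e j) := by
        rw [hc, h.vertex_mul_sum_smul, smul_mul_assoc]

theorem vertex_corner_of_ne (h : IsRealization 𝒜 θ e φ) (a : A) {i j : Q} (hij : i ≠ j) :
    e i * GradedAlgebra.proj 𝒜 0 a * e j = 0 := by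
  obtain ⟨c, hc⟩ := h.exists_vertex_corner_eq a
  rw [hc, h.orthogonal.ortho hij, smul_zero]

theorem exists_vertex_corner_self (h : IsRealization 𝒜 θ e φ) (a : A) (i : Q) :
    ∃ c : k, e i * GradedAlgebra.proj 𝒜 0 a * e i = c • e i := by
  obtain ⟨c, hc⟩ := h.exists_vertex_corner_eq a
  exact ⟨c i, by rw [hc, h.orthogonal.idem i]⟩

theorem primitive {n : ℕ} (hn : ∀ d, n < d → 𝒜 d = ⊥) (h : IsRealization 𝒜 θ e φ) (i : Q) :
    IsPrimitiveIdempotent (e i) := by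
  refine ⟨h.orthogonal.idem i, h.ne_zero i, fun x y hx hy hxy hyx hi => ?_⟩
  have hxi : e i * x * e i = x := by
    rw [hi, add_mul, hx.eq, hyx, add_zero, mul_add, hx.eq, hxy, add_zero]
  obtain ⟨c, hc⟩ := h.exists_vertex_corner_self x i
  have hx0 : GradedAlgebra.proj 𝒜 0 x = c • e i := by
    rw [← hc]
    nth_rw 1 [← hxi]
    rw [gradedProj_zero_mul, gradedProj_zero_mul, gradedProj_of_mem (h.degree_zero i)]
  have hcc : IsIdempotentElem c := by
    refine smul_left_injective k (h.ne_zero i) ?_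
    change (c * c) • e i = c • e i
    rw [← h.orthogonal.idem i, ← smul_mul_smul_comm, h.orthogonal.idem i, ← hx0,
      ← gradedProj_zero_mul, hx.eq]
  rcases IsIdempotentElem.iff_eq_zero_or_one.1 hcc with rfl | rfl
  · exact .inl (eq_zero_of_isIdempotentElem_of_gradedProj 𝒜 hn hx (by rw [hx0, zero_smul]))
  · refine .inr (eq_zero_of_isIdempotentElem_of_gradedProj 𝒜 hn hy ?_)
    rw [eq_sub_of_add_eq' hi.symm, map_sub, hx0, one_smul, gradedProj_of_mem (h.degree_zero i),
      sub_self]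

theorem gradedProj_zero_eq_zero (h : IsRealization 𝒜 θ e φ) {f : A}
    (hf : ∀ i p q, e i * GradedAlgebra.proj 𝒜 0 (p * f * q) * e i = 0) :
    GradedAlgebra.proj 𝒜 0 f = 0 := by
  have hcorner (p q : A) :
      (∑ i, e i) * GradedAlgebra.proj 𝒜 0 (p * f * q) * (∑ i, e i) = 0 := by
    rw [Finset.sum_mul, Finset.sum_mul]
    refine Finset.sum_eq_zero fun i _ => ?_
    rw [Finset.mul_sum]
    refine Finset.sum_eq_zero fun j _ => ?_
    rcases eq_or_ne i j with rfl | hij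
    · exact hf i p q
    · exact h.vertex_corner_of_ne _ hij
  refine h.full.eq_zero_of_map_mul (GradedRing.projZeroRingHom 𝒜) fun p =>
    h.full.eq_zero_of_mul_map (GradedRing.projZeroRingHom 𝒜) fun q => ?_
  change GradedAlgebra.proj 𝒜 0 (_ * p) * GradedAlgebra.proj 𝒜 0 f * GradedAlgebra.proj 𝒜 0 (q * _)
    = 0
  rw [gradedProj_zero_mul, gradedProj_zero_mul 𝒜 q, gradedProj_of_mem h.sum_mem_zero,
    ← hcorner p q, gradedProj_zero_mul, gradedProj_zero_mul]
  simp only [mul_assoc]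

theorem exists_mul_eq_vertex {n : ℕ} (hn : ∀ d, n < d → 𝒜 d = ⊥) (h : IsRealization 𝒜 θ e φ)
    {f : A} (hf : IsPrimitiveIdempotent f) :
    ∃ i p q, p * q = e i ∧ p * f = p ∧ f * q = q ∧ q * e i = q := by
  obtain ⟨i, p, q, hne⟩ : ∃ i p q, e i * GradedAlgebra.proj 𝒜 0 (p * f * q) * e i ≠ 0 := by
    by_contra! hcon
    exact hf.2.1 (eq_zero_of_isIdempotentElem_of_gradedProj 𝒜 hn hf.1
      (h.gradedProj_zero_eq_zero hcon))
  obtain ⟨c, hc⟩ := h.exists_vertex_corner_self (p * f * q) i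
  have hc0 : c ≠ 0 := by
    rintro rfl
    exact hne (hc.trans (zero_smul k _))
  set z := c⁻¹ • (e i * (p * f * q) * e i) with hz
  have hz0 : GradedAlgebra.proj 𝒜 0 z = e i := by
    rw [map_smul, gradedProj_zero_mul, gradedProj_zero_mul, gradedProj_of_mem (h.degree_zero i),
      hc, smul_smul, inv_mul_cancel₀ hc0, one_smul]
  obtain ⟨w, hw⟩ := exists_mul_eq_gradedProj_zero 𝒜 hn (z := z) (hz0 ▸ h.orthogonal.idem i)
    (by rw [hz0, hz, smul_mul_assoc, mul_assoc _ (e i), h.orthogonal.idem i])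
  refine ⟨i, c⁻¹ • (w * e i * p * f), f * q * e i, ?_, ?_, ?_, ?_⟩
  · calc c⁻¹ • (w * e i * p * f) * (f * q * e i) = w * z := by
          rw [hz, smul_mul_assoc, mul_smul_comm]
          simp only [← mul_assoc]
          rw [mul_assoc _ f f, hf.1.eq]
      _ = e i := hw.trans hz0
  · rw [smul_mul_assoc, mul_assoc _ f f, hf.1.eq]
  · rw [← mul_assoc, ← mul_assoc, hf.1.eq]
  · rw [mul_assoc, h.orthogonal.idem i]

theorem isBasicFamily {n : ℕ} (hn : ∀ d, n < d → 𝒜 d = ⊥) (h : IsRealization 𝒜 θ e φ) :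
    IsBasicFamily e where
  orthogonal := h.orthogonal
  primitive := h.primitive hn
  not_iso i j hij := by
    refine ⟨fun ψ => h.ne_zero i ?_⟩
    obtain ⟨b, c, hbc, hb, hb', -⟩ := exists_mul_of_spanSingletonEquiv
      (h.orthogonal.idem i) (h.orthogonal.idem j) ψ
    have hb0 : GradedAlgebra.proj 𝒜 0 b = 0 := by
      rw [← hb', ← hb, gradedProj_zero_mul, gradedProj_zero_mul,
        gradedProj_of_mem (h.degree_zero i), gradedProj_of_mem (h.degree_zero j)]
      exact h.vertex_corner_of_ne b hij
    rw [← gradedProj_of_mem (h.degree_zero i), ← hbc, gradedProj_zero_mul, hb0, zero_mul]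
  exists_iso f hf := by
    obtain ⟨i, p, q, hpq, hpf, hfq, hqe⟩ := h.exists_mul_eq_vertex hn hf
    exact ⟨i, ⟨spanSingletonEquiv (hf.mul_eq (h.ne_zero i) hpq hpf hfq hqe) hpq hpf hqe⟩⟩

theorem toBound_ofPath_eq_zero {n : ℕ} (hn : ∀ d, n < d → 𝒜 d = ⊥) (h : IsRealization 𝒜 θ e φ)
    {i j : Q} (p : Quiver.Path i j) (hp : n < p.length) : toBound θ (ofPath k p) = 0 := by
  refine h.injective (((Submodule.mem_bot k).1 ?_).trans (map_zero φ).symm)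
  exact hn _ hp ▸ h.map_ofPath_mem p

theorem isBoundQuiverOfBasic {n : ℕ} (hn : ∀ d, n < d → 𝒜 d = ⊥) (h : IsRealization 𝒜 θ e φ) :
    IsBoundQuiverOfBasic 𝒜 θ where
  quadratic := h.quadratic
  nilpotent := ⟨n + 1, fun _ _ p hp => h.toBound_ofPath_eq_zero hn p hp⟩
  exists_iso := ⟨e, h.isBasicFamily hn, h.degree_zero, φ, h.injective, h.range_eq, h.map_vertex,
    h.map_arrow⟩

end IsRealization

end Realization

section Frobenius

variable {k : Type*} [Field k] {A : Type*} [Ring A] [Algebra k A] {B : Type*} [Ring B] [Algebra k B]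

/-- A nondegenerate linear form `F` on an algebra, with Nakayama automorphism `ρ`. -/
structure IsFrobeniusForm (F : A →ₗ[k] k) (ρ : A ≃ₐ[k] A) : Prop where
  nondegenerate : ∀ a, (∀ b, F (b * a) = 0) → a = 0
  nakayama : ∀ a b, F (a * b) = F (b * ρ a)

namespace IsFrobeniusForm

variable {F : A →ₗ[k] k} {ρ : A ≃ₐ[k] A}

theorem nondegenerate_right (hF : IsFrobeniusForm F ρ) {a : A} (ha : ∀ b, F (a * b) = 0) :
    a = 0 :=
  (map_eq_zero_iff ρ ρ.injective).1 (hF.nondegenerate _ fun b => by rw [← hF.nakayama, ha])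

theorem ext (hF : IsFrobeniusForm F ρ) {y z : A} (h : ∀ x, F (x * y) = F (x * z)) : y = z :=
  sub_eq_zero.1 (hF.nondegenerate _ fun x => by rw [mul_sub, map_sub, h, sub_self])

theorem exists_apply_mul_eq [FiniteDimensional k A] (hF : IsFrobeniusForm F ρ)
    (f : Module.Dual k A) : ∃ u, ∀ x, F (x * u) = f x := by
  obtain ⟨u, hu⟩ : ∃ u, ((LinearMap.mul k A).compr₂ F).flip u = f := by
    refine (LinearMap.injective_iff_surjective_of_finrank_eq_finrank
      (Subspace.dual_finrank_eq).symm).1 ((injective_iff_map_eq_zero _).2 fun z hz => ?_) f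
    exact hF.nondegenerate z fun x => LinearMap.congr_fun hz x
  exact ⟨u, fun x => LinearMap.congr_fun hu x⟩

end IsFrobeniusForm

/-- A Frobenius form that vanishes outside degree `n`, with graded Nakayama automorphism. -/
structure IsGradedFrobenius (𝒜 : ℕ → Submodule k A) (n : ℕ) (F : A →ₗ[k] k) (ρ : A ≃ₐ[k] A) : Prop
    extends IsFrobeniusForm F ρ where
  eq_zero : ∀ d, d ≠ n → ∀ a ∈ 𝒜 d, F a = 0
  map_mem : ∀ d, ∀ a ∈ 𝒜 d, ρ a ∈ 𝒜 d

theorem IsGradedFrobenius.apply_gradedProj {𝒜 : ℕ → Submodule k A} [GradedAlgebra 𝒜] {n : ℕ}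
    {F : A →ₗ[k] k} {ρ : A ≃ₐ[k] A} (hF : IsGradedFrobenius 𝒜 n F ρ) (a : A) :
    F (GradedAlgebra.proj 𝒜 n a) = F a := by
  obtain ⟨s, hs⟩ := exists_sum_gradedProj 𝒜 a
  rw [hs, map_sum, map_sum, map_sum]
  refine Finset.sum_congr rfl fun d _ => ?_
  rcases eq_or_ne d n with rfl | hd
  · rw [gradedProj_of_mem (gradedProj_mem 𝒜 d a)]
  · rw [gradedProj_of_mem_ne (gradedProj_mem 𝒜 d a) hd, map_zero,
      hF.eq_zero d hd _ (gradedProj_mem 𝒜 d a)]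

/-- `φ` identifies the algebra `B` with the corner `E A E` of `A` at the idempotent `E = φ 1`. -/
structure IsCornerEmbedding (φ : B →ₙₐ[k] A) : Prop where
  injective : Function.Injective φ
  exists_eq : ∀ a, ∃ b, φ b = φ 1 * a * φ 1

theorem map_one_mul_map (φ : B →ₙₐ[k] A) (b : B) : φ 1 * φ b = φ b := by
  rw [← map_mul, one_mul]

theorem map_mul_map_one (φ : B →ₙₐ[k] A) (b : B) : φ b * φ 1 = φ b := by
  rw [← map_mul, mul_one]

/-- The element `u` freely generates the left module `E A ρ(E)` over `E A E ≅ B`, and turns the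
right action of `E A E` through `ρ` into the left action through `N`. -/
structure IsIntertwiner (φ : B →ₙₐ[k] A) (ρ : A ≃ₐ[k] A) (N : B ≃ₐ[k] B) (u : A) : Prop where
  map_one_mul : φ 1 * u = u
  comm : ∀ b, φ (N b) * u = u * ρ (φ b)
  eq_zero : ∀ b, φ b * u = 0 → b = 0
  exists_eq : ∀ z, ∃ b, φ 1 * z * ρ (φ 1) = φ b * u

namespace IsCornerEmbedding

variable {φ : B →ₙₐ[k] A}

/-- The element of `B` that corresponds to `E a E`, as a function of `a`. -/
def compress (h : IsCornerEmbedding φ) : A →ₗ[k] B where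
  toFun a := (h.exists_eq a).choose
  map_add' a b := h.injective <| by
    rw [map_add, (h.exists_eq _).choose_spec, (h.exists_eq _).choose_spec,
      (h.exists_eq _).choose_spec, mul_add, add_mul]
  map_smul' c a := h.injective <| by
    rw [RingHom.id_apply, map_smul, (h.exists_eq _).choose_spec, (h.exists_eq _).choose_spec,
      mul_smul_comm, smul_mul_assoc]

theorem map_compress (h : IsCornerEmbedding φ) (a : A) : φ (h.compress a) = φ 1 * a * φ 1 :=
  (h.exists_eq a).choose_spec

theorem compress_map (h : IsCornerEmbedding φ) (b : B) : h.compress (φ b) = b :=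
  h.injective (by rw [h.map_compress, map_one_mul_map, map_mul_map_one])

theorem compress_map_mul (h : IsCornerEmbedding φ) (b : B) (a : A) :
    h.compress (φ b * a) = b * h.compress a :=
  h.injective <| by
    rw [map_mul φ, h.map_compress, h.map_compress, ← mul_assoc, map_one_mul_map, ← mul_assoc,
      ← mul_assoc, map_mul_map_one]

theorem compress_mul_map (h : IsCornerEmbedding φ) (a : A) (b : B) :
    h.compress (a * φ b) = h.compress a * b :=
  h.injective <| by
    rw [map_mul φ, h.map_compress, h.map_compress, mul_assoc, mul_assoc a, map_mul_map_one,
      mul_assoc _ (φ 1), map_one_mul_map, mul_assoc]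

theorem map_compress_apply_map (h : IsCornerEmbedding φ) {ρ : A ≃ₐ[k] A} (hρ : ρ (φ 1) = φ 1)
    (b : B) : φ (h.compress (ρ (φ b))) = ρ (φ b) := by
  rw [h.map_compress]
  nth_rw 1 [← hρ]
  nth_rw 2 [← hρ]
  rw [← map_mul, ← map_mul, map_one_mul_map, map_mul_map_one]

/-- The automorphism of the corner induced by an automorphism of `A` fixing `E`. -/
def restrict (h : IsCornerEmbedding φ) (ρ : A ≃ₐ[k] A) (hρ : ρ (φ 1) = φ 1) : B ≃ₐ[k] B where
  toFun b := h.compress (ρ (φ b))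
  invFun b := h.compress (ρ.symm (φ b))
  left_inv b := h.injective <| by
    rw [h.map_compress_apply_map (ρ.symm_apply_eq.2 hρ.symm), h.map_compress_apply_map hρ,
      ρ.symm_apply_apply]
  right_inv b := h.injective <| by
    rw [h.map_compress_apply_map hρ, h.map_compress_apply_map (ρ.symm_apply_eq.2 hρ.symm),
      ρ.apply_symm_apply]
  map_mul' a b := h.injective <| by
    rw [h.map_compress_apply_map hρ (a * b), map_mul φ (h.compress _), map_mul φ, map_mul ρ,
      h.map_compress_apply_map hρ, h.map_compress_apply_map hρ]
  map_add' a b := by simp only [map_add]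
  commutes' c := h.injective <| by
    rw [h.map_compress_apply_map hρ, Algebra.algebraMap_eq_smul_one, map_smul, map_smul, hρ]

theorem map_restrict (h : IsCornerEmbedding φ) {ρ : A ≃ₐ[k] A} (hρ : ρ (φ 1) = φ 1) (b : B) :
    φ (h.restrict ρ hρ b) = ρ (φ b) :=
  h.map_compress_apply_map hρ b

theorem isFrobeniusForm (h : IsCornerEmbedding φ) {F : A →ₗ[k] k} {ρ : A ≃ₐ[k] A}
    (hF : IsFrobeniusForm F ρ) (hρ : ρ (φ 1) = φ 1) :
    IsFrobeniusForm (F ∘ₗ (φ : B →ₗ[k] A)) (h.restrict ρ hρ) where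
  nondegenerate b hb := h.injective <| (hF.nondegenerate _ fun x => by
    have hx : F (φ (h.compress x * b)) = 0 := hb _
    calc F (x * φ b) = F (φ 1 * (x * φ b)) := by
          rw [hF.nakayama (φ 1), hρ, mul_assoc, map_mul_map_one]
      _ = 0 := by
          rw [← hx, map_mul φ, h.map_compress, mul_assoc _ (φ 1), map_one_mul_map, mul_assoc]).trans
    (map_zero φ).symm
  nakayama a b := by
    change F (φ (a * b)) = F (φ (b * h.restrict ρ hρ a))
    rw [map_mul φ, map_mul φ, h.map_restrict, hF.nakayama]

/-- The intertwiner is the `u` with `F (x * u) = f (h.compress x)` for all `x`. -/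
theorem exists_isIntertwiner [FiniteDimensional k A] (h : IsCornerEmbedding φ) {F : A →ₗ[k] k}
    {ρ : A ≃ₐ[k] A} (hF : IsFrobeniusForm F ρ) {f : B →ₗ[k] k} {N : B ≃ₐ[k] B}
    (hf : IsFrobeniusForm f N) : ∃ u, IsIntertwiner φ ρ N u := by
  obtain ⟨u, hu⟩ := hF.exists_apply_mul_eq (f ∘ₗ h.compress)
  have hu (x : A) : F (x * u) = f (h.compress x) := hu x
  have : FiniteDimensional k B := .of_injective (φ : B →ₗ[k] A) h.injective
  refine ⟨u, hF.ext fun x => ?_, fun b => hF.ext fun x => ?_, fun b hb => ?_, fun z => ?_⟩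
  · rw [← mul_assoc, hu, hu, h.compress_mul_map, mul_one]
  · rw [← mul_assoc, ← mul_assoc, ← hF.nakayama, ← mul_assoc, hu, hu, h.compress_mul_map,
      h.compress_map_mul, ← hf.nakayama]
  · refine hf.nondegenerate b fun a => ?_
    rw [← h.compress_map (a * b), ← hu, map_mul φ, mul_assoc, hb, mul_zero, map_zero]
  · obtain ⟨y, hy⟩ : ∃ y, φ 1 * z * ρ (φ 1) = y := ⟨_, rfl⟩
    have hy1 : φ 1 * y = y := by rw [← hy, ← mul_assoc, ← mul_assoc, map_one_mul_map]
    have hyρ : y * ρ (φ 1) = y := by rw [← hy, mul_assoc, ← map_mul, map_one_mul_map]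
    obtain ⟨b, hb⟩ := hf.exists_apply_mul_eq (((LinearMap.mul k A).compr₂ F).flip y ∘ₗ
      (φ : B →ₗ[k] A))
    have hb (c : B) : f (c * b) = F (φ c * y) := hb c
    refine ⟨b, hF.ext fun x => ?_⟩
    rw [hy, ← mul_assoc, hu, h.compress_mul_map, hb, h.map_compress, mul_assoc _ (φ 1), hy1,
      mul_assoc, hF.nakayama (φ 1), mul_assoc, hyρ]

end IsCornerEmbedding

end Frobenius

section MaximalPaths

open PathAlgebra

variable {k : Type w} [Field k] {Q : Type u} [Quiver.{v} Q] [Fintype Q]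
  {θ : Set (PathAlgebra k Q)} {i j : Q} {p : Quiver.Path i j}

theorem IsMaximalBoundPath.toBound_ofPath_mul (hp : IsMaximalBoundPath θ p) {i' j' : Q}
    (q : Quiver.Path i' j') (hq : q.length ≠ 0) :
    toBound θ (ofPath k q) * toBound θ (ofPath k p) = 0 := by
  rw [← map_mul]
  rcases eq_or_ne j i' with rfl | hne
  · induction q with
    | nil => exact absurd rfl hq
    | cons q a ih =>
      rcases eq_or_ne q.length 0 with h0 | h0
      · obtain rfl := Quiver.Path.eq_of_length_zero q h0
        obtain rfl := Quiver.Path.eq_nil_of_length_zero q h0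
        rw [ofPath_mul_ofPath]
        exact hp.2.1 _ a
      · rw [← arrow_mul_ofPath, mul_assoc, map_mul, ih h0, mul_zero]
  · rw [ofPath_mul_of_ne _ _ hne, map_zero]

theorem IsMaximalBoundPath.toBound_mul (hp : IsMaximalBoundPath θ p) (x : PathAlgebra k Q) :
    toBound θ x * toBound θ (ofPath k p) =
      toBound θ (lengthPart k Q 0 x) * toBound θ (ofPath k p) := by
  induction x using induction_ofPath with
  | h0 => simp only [map_zero]
  | hadd x y hx hy => simp only [map_add, add_mul, hx, hy]
  | hsmul c i' j' q =>
    simp only [map_smul, smul_mul_assoc, lengthPart_ofPath]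
    congr 1
    split_ifs with hq
    · rfl
    · rw [hp.toBound_ofPath_mul q hq, map_zero, zero_mul]

end MaximalPaths

namespace IsRealization

open PathAlgebra BoundAlgebra

variable {k : Type*} [Field k] {Q : Type u} [Quiver.{v} Q] [Fintype Q]
  {A : Type*} [Ring A] [Algebra k A] {𝒜 : ℕ → Submodule k A}
  {θ : Set (PathAlgebra k Q)} {e : Q → A} {φ : BoundAlgebra θ →ₙₐ[k] A}
  {n : ℕ} {F : A →ₗ[k] k} {ρ : A ≃ₐ[k] A} {ν : Equiv.Perm Q} {i j : Q} {c : A}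

theorem isCornerEmbedding (h : IsRealization 𝒜 θ e φ) : IsCornerEmbedding φ :=
  ⟨h.injective, fun a => h.map_one ▸ h.exists_eq a⟩

theorem apply_map_one (h : IsRealization 𝒜 θ e φ) (hν : ∀ i, ρ (e i) = e (ν i)) :
    ρ (φ 1) = φ 1 := by
  rw [h.map_one, map_sum, ← Equiv.sum_comp ν e]
  exact Finset.sum_congr rfl fun i _ => hν i

theorem form_eq_zero (h : IsRealization 𝒜 θ e φ) (hF : IsFrobeniusForm F ρ)
    (hν : ∀ i, ρ (e i) = e (ν i)) (hj : e j * c = c) (hi : c * e i = c) (hij : ν j ≠ i) :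
    F c = 0 := by
  rw [← hj, hF.nakayama, hν, ← hi, mul_assoc, h.orthogonal.ortho hij.symm, mul_zero, map_zero]

theorem form_map_ofPath_eq_zero (h : IsRealization 𝒜 θ e φ) (hF : IsFrobeniusForm F ρ)
    (hν : ∀ i, ρ (e i) = e (ν i)) (p : Quiver.Path i j) (hij : ν j ≠ i) :
    F (φ (toBound θ (ofPath k p))) = 0 :=
  h.form_eq_zero hF hν (h.vertex_mul_map_ofPath p) (h.map_ofPath_mul_vertex p) hij

variable [GradedAlgebra 𝒜]

theorem eq_zero_of_form (h : IsRealization 𝒜 θ e φ) (hF : IsGradedFrobenius 𝒜 n F ρ)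
    (hν : ∀ i, ρ (e i) = e (ν i)) (hc : c ∈ 𝒜 n) (hj : e j * c = c) (hi : c * e i = c)
    (h0 : F c = 0) : c = 0 := by
  refine hF.nondegenerate c fun x => ?_
  set x₀ := GradedAlgebra.proj 𝒜 0 x
  have hdeg : F (x * c) = F (x₀ * c) := by
    rw [← hF.apply_gradedProj (x * c), ← gradedProj_mul_of_right_mem hc, zero_add]
  have hcorner : F (x₀ * c) = F (e (ν.symm i) * x₀ * e j * c) := by
    conv_rhs => rw [mul_assoc, mul_assoc, hF.nakayama, hν, Equiv.apply_symm_apply, hj, mul_assoc,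
      hi]
  rw [hdeg, hcorner]
  rcases eq_or_ne (ν.symm i) j with rfl | hij
  · obtain ⟨r, hr⟩ := h.exists_vertex_corner_self x (ν.symm i)
    rw [hr, smul_mul_assoc, hj, map_smul, h0, smul_zero]
  · rw [h.vertex_corner_of_ne x hij, zero_mul, map_zero]

theorem mul_map_of_isMaximalBoundPath (h : IsRealization 𝒜 θ e φ) {p : Quiver.Path i j}
    (hp : IsMaximalBoundPath θ p) (a : A) : a * φ (toBound θ (ofPath k p)) =
      GradedAlgebra.proj 𝒜 0 a * φ (toBound θ (ofPath k p)) := by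
  have hmap (b : BoundAlgebra θ) (hb : GradedAlgebra.proj 𝒜 0 (φ b) = 0) :
      φ b * φ (toBound θ (ofPath k p)) = 0 := by
    obtain ⟨x, rfl⟩ := toBound_surjective b
    rw [← map_mul, hp.toBound_mul, map_mul, ← h.gradedProj_map, hb, zero_mul]
  rw [← sub_eq_zero, ← sub_mul]
  have hproj : GradedAlgebra.proj 𝒜 0 (a - GradedAlgebra.proj 𝒜 0 a) = 0 := by
    rw [map_sub, gradedProj_of_mem (gradedProj_mem 𝒜 0 a), sub_self]
  refine h.full.eq_zero_of_map_mul (RingHom.id A) fun x => ?_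
  obtain ⟨b, hb⟩ := h.exists_eq (x * (a - GradedAlgebra.proj 𝒜 0 a))
  calc RingHom.id A ((∑ i, e i) * x) * ((a - GradedAlgebra.proj 𝒜 0 a) * φ (toBound θ (ofPath k p)))
      = φ b * φ (toBound θ (ofPath k p)) := by
        rw [hb, mul_assoc _ (∑ i, e i), h.sum_mul_map, RingHom.id_apply]
        simp only [mul_assoc]
    _ = 0 := hmap b <| by
        rw [hb, gradedProj_zero_mul, gradedProj_zero_mul, gradedProj_zero_mul, hproj, mul_zero,
          mul_zero, zero_mul]

theorem length_eq_of_isMaximalBoundPath (h : IsRealization 𝒜 θ e φ)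
    (hF : IsGradedFrobenius 𝒜 n F ρ) {p : Quiver.Path i j} (hp : IsMaximalBoundPath θ p) :
    p.length = n := by
  by_contra hne
  refine hp.1 (h.injective (.trans (hF.nondegenerate _ fun x => ?_) (map_zero φ).symm))
  rw [h.mul_map_of_isMaximalBoundPath hp]
  exact hF.eq_zero (0 + p.length) (by rwa [zero_add]) _
    (SetLike.GradedMul.mul_mem (gradedProj_mem 𝒜 0 x) (h.map_ofPath_mem p))

theorem isMaximalBoundPath_of_length (hn : ∀ d, n < d → 𝒜 d = ⊥)
    (h : IsRealization 𝒜 θ e φ) {p : Quiver.Path i j} (hp : p.length = n)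
    (h0 : toBound θ (ofPath k p) ≠ 0) : IsMaximalBoundPath θ p := by
  refine ⟨h0, fun l a => h.toBound_ofPath_eq_zero hn _ ?_,
    fun l a => h.toBound_ofPath_eq_zero hn _ ?_⟩
  · rw [Quiver.Path.length_cons]; omega
  · rw [Quiver.Path.length_comp, Quiver.Path.length_toPath]; omega

theorem exists_isMaximalBoundPath (hn : ∀ d, n < d → 𝒜 d = ⊥) (h : IsRealization 𝒜 θ e φ)
    (hF : IsGradedFrobenius 𝒜 n F ρ) (hν : ∀ i, ρ (e i) = e (ν i)) (i : Q) :
    ∃ p : Quiver.Path (ν i) i, IsMaximalBoundPath θ p := by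
  by_contra! hcon
  have hpath {i' j' : Q} (q : Quiver.Path i' j') : F (e i * φ (toBound θ (ofPath k q))) = 0 := by
    rcases eq_or_ne i j' with rfl | hj
    · rw [h.vertex_mul_map_ofPath]
      rcases eq_or_ne (ν i) i' with rfl | hi
      · by_cases hq : q.length = n
        · rw [of_not_not fun h0 => hcon q (h.isMaximalBoundPath_of_length hn hq h0), map_zero,
            map_zero]
        · exact hF.eq_zero _ hq _ (h.map_ofPath_mem q)
      · exact h.form_map_ofPath_eq_zero hF.toIsFrobeniusForm hν q hi
    · rw [← h.vertex_mul_map_ofPath, ← mul_assoc, h.orthogonal.ortho hj, zero_mul, map_zero]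
  have hbound (x : PathAlgebra k Q) : F (e i * φ (toBound θ x)) = 0 := by
    induction x using induction_ofPath with
    | h0 => simp only [map_zero, mul_zero]
    | hadd x y hx hy => simp only [map_add, mul_add, hx, hy, add_zero]
    | hsmul s i' j' q => simp only [map_smul, mul_smul_comm, hpath, smul_zero]
  refine h.ne_zero i (hF.nondegenerate_right fun a => ?_)
  obtain ⟨b, hb⟩ := h.exists_eq a
  obtain ⟨x, rfl⟩ := toBound_surjective b
  have hE : ρ (∑ j, e j) = ∑ j, e j := h.map_one ▸ h.apply_map_one hν
  calc F (e i * a) = F ((∑ j, e j) * (e i * a)) := by rw [← mul_assoc, h.sum_mul]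
    _ = F (e i * ((∑ j, e j) * a * ∑ j, e j)) := by
        rw [hF.nakayama, hE, ← mul_assoc, ← mul_assoc, h.mul_sum]
    _ = 0 := by rw [← hb, hbound]

theorem not_linearIndependent_of_isMaximalBoundPath (h : IsRealization 𝒜 θ e φ)
    (hF : IsGradedFrobenius 𝒜 n F ρ) (hν : ∀ i, ρ (e i) = e (ν i)) {i j j' : Q}
    {p : Quiver.Path i j} {q : Quiver.Path i j'} (hp : IsMaximalBoundPath θ p)
    (hq : IsMaximalBoundPath θ q) :
    ¬ LinearIndependent k ![toBound θ (ofPath k p), toBound θ (ofPath k q)] := by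
  have hmem {l : Q} {r : Quiver.Path i l} (hr : IsMaximalBoundPath θ r) :
      φ (toBound θ (ofPath k r)) ∈ 𝒜 n :=
    h.length_eq_of_isMaximalBoundPath hF hr ▸ h.map_ofPath_mem r
  have hform {l : Q} {r : Quiver.Path i l} (hr : IsMaximalBoundPath θ r) :
      F (φ (toBound θ (ofPath k r))) ≠ 0 := fun h0 =>
    hr.1 (h.injective ((h.eq_zero_of_form hF hν (hmem hr) (h.vertex_mul_map_ofPath r)
      (h.map_ofPath_mul_vertex r) h0).trans (map_zero φ).symm))
  have htgt {l : Q} {r : Quiver.Path i l} (hr : IsMaximalBoundPath θ r) : ν l = i :=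
    of_not_not fun hl => hform hr (h.form_map_ofPath_eq_zero hF.toIsFrobeniusForm hν r hl)
  obtain rfl : j = j' := ν.injective ((htgt hp).trans (htgt hq).symm)
  rw [LinearIndependent.pair_iff]
  intro hli
  refine hform hq (hli (F (φ (toBound θ (ofPath k q)))) (-F (φ (toBound θ (ofPath k p))))
    (h.injective (.trans ?_ (map_zero φ).symm))).1
  rw [map_add, map_smul, map_smul]
  refine h.eq_zero_of_form hF hν (i := i) (j := j)
    (add_mem (Submodule.smul_mem _ _ (hmem hp)) (Submodule.smul_mem _ _ (hmem hq))) ?_ ?_ ?_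
  · rw [mul_add, mul_smul_comm, mul_smul_comm, h.vertex_mul_map_ofPath, h.vertex_mul_map_ofPath]
  · rw [add_mul, smul_mul_assoc, smul_mul_assoc, h.map_ofPath_mul_vertex,
      h.map_ofPath_mul_vertex]
  · rw [map_add, map_smul, map_smul, smul_eq_mul, smul_eq_mul]
    ring

theorem isStableTranslationQuiver (hn : ∀ d, n < d → 𝒜 d = ⊥)
    (h : IsRealization 𝒜 θ e φ) (hF : IsGradedFrobenius 𝒜 n F ρ)
    (hν : ∀ i, ρ (e i) = e (ν i)) : IsStableTranslationQuiver θ ν n where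
  length_eq _ _ _ hp := h.length_eq_of_isMaximalBoundPath hF hp
  exists_path := h.exists_isMaximalBoundPath hn hF hν
  no_path _ _ hij p hp :=
    h.injective <| .trans (h.eq_zero_of_form hF hν (hp ▸ h.map_ofPath_mem p)
      (h.vertex_mul_map_ofPath p) (h.map_ofPath_mul_vertex p)
      (h.form_map_ofPath_eq_zero hF.toIsFrobeniusForm hν p (ν.injective.ne hij))) (map_zero φ).symm
  dependent _ _ _ _ _ hp hq := h.not_linearIndependent_of_isMaximalBoundPath hF hν hp hq

theorem exists_isNakayamaAutomorphism (h : IsRealization 𝒜 θ e φ)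
    (hF : IsGradedFrobenius 𝒜 n F ρ) (hν : ∀ i, ρ (e i) = e (ν i)) :
    ∃ N : BoundAlgebra θ ≃ₐ[k] BoundAlgebra θ, IsNakayamaAutomorphism θ ν N := by
  have hρ := h.apply_map_one hν
  have hform := h.isCornerEmbedding.isFrobeniusForm hF.toIsFrobeniusForm hρ
  refine ⟨h.isCornerEmbedding.restrict ρ hρ, ⟨_, fun _ => hform.nondegenerate_right,
    hform.nondegenerate, hform.nakayama⟩, fun i => h.injective ?_, fun _ _ a =>
    h.exists_mem_arrowSpan ?_⟩
  · rw [h.isCornerEmbedding.map_restrict, h.map_vertex, h.map_vertex, hν]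
  · rw [h.isCornerEmbedding.map_restrict]
    exact hF.map_mem _ _ (h.map_arrow _ _ a)

end IsRealization

namespace IsIntertwiner

open PathAlgebra BoundAlgebra

section Corner

variable {k : Type*} [Field k] {A : Type*} [Ring A] [Algebra k A] {B : Type*} [Ring B] [Algebra k B]
  {φ : B →ₙₐ[k] A} {ρ : A ≃ₐ[k] A} {N : B ≃ₐ[k] B} {u : A}

theorem mul_map_one (hu : IsIntertwiner φ ρ N u) : u * ρ (φ 1) = u := by
  rw [← hu.comm, map_one N, hu.map_one_mul]

end Corner

variable {k : Type*} [Field k] {Q : Type u} [Quiver.{v} Q] [Fintype Q]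
  {A : Type*} [Ring A] [Algebra k A] {𝒜 : ℕ → Submodule k A} [GradedAlgebra 𝒜]
  {θ : Set (PathAlgebra k Q)} {e : Q → A} {φ : BoundAlgebra θ →ₙₐ[k] A} {ρ : A ≃ₐ[k] A}
  {N : BoundAlgebra θ ≃ₐ[k] BoundAlgebra θ} {u : A}

theorem vertex_mul_gradedProj_ne_zero (hu : IsIntertwiner φ ρ N u) (h : IsRealization 𝒜 θ e φ)
    (hρ : ∀ d, ∀ a ∈ 𝒜 d, ρ a ∈ 𝒜 d) (i : Q) : e i * GradedAlgebra.proj 𝒜 0 u ≠ 0 := by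
  intro hi
  have hE : GradedAlgebra.proj 𝒜 0 (ρ (∑ j, e j)) = ρ (∑ j, e j) :=
    gradedProj_of_mem (hρ _ _ h.sum_mem_zero)
  have hzero (z : A) : e i * GradedAlgebra.proj 𝒜 0 z * ρ (∑ j, e j) = 0 := by
    obtain ⟨b, hb⟩ := hu.exists_eq (e i * z)
    obtain ⟨c, hc⟩ := h.exists_gradedProj_zero b
    calc e i * GradedAlgebra.proj 𝒜 0 z * ρ (∑ j, e j)
        = e i * GradedAlgebra.proj 𝒜 0 (φ 1 * (e i * z) * ρ (φ 1)) := by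
          rw [h.map_one, ← mul_assoc, h.sum_mul]
          simp only [gradedProj_zero_mul]
          rw [hE, gradedProj_of_mem (h.degree_zero i), ← mul_assoc, ← mul_assoc,
            h.orthogonal.idem i]
      _ = 0 := by
          rw [hb, gradedProj_zero_mul, hc, ← mul_assoc, h.vertex_mul_sum_smul, smul_mul_assoc, hi,
            smul_zero]
  refine h.ne_zero i (h.full.eq_zero_of_mul_map
    ((GradedRing.projZeroRingHom 𝒜).comp (ρ : A →+* A)) fun a => ?_)
  change e i * GradedAlgebra.proj 𝒜 0 (ρ (a * _)) = 0
  rw [map_mul, gradedProj_zero_mul, hE, ← mul_assoc, hzero]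

theorem map_one_mul_gradedProj (hu : IsIntertwiner φ ρ N u) (h : IsRealization 𝒜 θ e φ) :
    φ 1 * GradedAlgebra.proj 𝒜 0 u = GradedAlgebra.proj 𝒜 0 u := by
  rw [← gradedProj_of_mem (h.map_one.symm ▸ h.sum_mem_zero : φ 1 ∈ 𝒜 0), ← gradedProj_zero_mul,
    hu.map_one_mul]

theorem gradedProj_mul_map_one (hu : IsIntertwiner φ ρ N u) (h : IsRealization 𝒜 θ e φ)
    (hρ : ∀ d, ∀ a ∈ 𝒜 d, ρ a ∈ 𝒜 d) :
    GradedAlgebra.proj 𝒜 0 u * ρ (φ 1) = GradedAlgebra.proj 𝒜 0 u := by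
  rw [← gradedProj_of_mem (hρ _ _ (h.map_one.symm ▸ h.sum_mem_zero : φ 1 ∈ 𝒜 0)),
    ← gradedProj_zero_mul, hu.mul_map_one]

/-- The part `u₀` of degree zero satisfies `u - u₀ = s u` for some `s` in the radical. -/
theorem exists_units_mul_eq_gradedProj (hu : IsIntertwiner φ ρ N u) {n : ℕ}
    (hn : ∀ d, n < d → 𝒜 d = ⊥) (h : IsRealization 𝒜 θ e φ)
    (hρ : ∀ d, ∀ a ∈ 𝒜 d, ρ a ∈ 𝒜 d) :
    ∃ w : (BoundAlgebra θ)ˣ, φ w * u = GradedAlgebra.proj 𝒜 0 u := by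
  obtain ⟨s, hs⟩ := hu.exists_eq (u - GradedAlgebra.proj 𝒜 0 u)
  rw [mul_sub, hu.map_one_mul, hu.map_one_mul_gradedProj h, sub_mul, hu.mul_map_one,
    hu.gradedProj_mul_map_one h hρ] at hs
  obtain ⟨c, hc⟩ := h.exists_gradedProj_zero s
  have hsu : (∑ i, c i • e i) * GradedAlgebra.proj 𝒜 0 u = 0 := by
    rw [← hc, ← gradedProj_zero_mul, ← hs, map_sub, gradedProj_of_mem (gradedProj_mem 𝒜 0 u),
      sub_self]
  have hc0 (i : Q) : c i = 0 := by
    refine (smul_eq_zero.1 ?_).resolve_right (hu.vertex_mul_gradedProj_ne_zero h hρ i)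
    rw [← smul_mul_assoc, ← h.vertex_mul_sum_smul, mul_assoc, hsu, mul_zero]
  have hnil : IsNilpotent s := by
    obtain ⟨j, hj⟩ := isNilpotent_of_gradedProj_zero 𝒜 hn (a := φ s) <| by
      rw [hc]
      exact Finset.sum_eq_zero fun i _ => by rw [hc0, zero_smul]
    have hpow (l : ℕ) : φ (s ^ l) = φ 1 * φ s ^ l := by
      induction l with
      | zero => rw [pow_zero, pow_zero, mul_one]
      | succ l ih => rw [pow_succ, map_mul, ih, pow_succ, mul_assoc]
    exact ⟨j, h.injective (by rw [hpow, hj, mul_zero, map_zero])⟩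
  obtain ⟨w, hw⟩ := hnil.isUnit_one_sub
  exact ⟨w, by rw [hw, map_sub, sub_mul, ← hs, hu.map_one_mul, sub_sub_cancel]⟩

theorem gradedProj_comm (hu : IsIntertwiner φ ρ N u) (h : IsRealization 𝒜 θ e φ)
    (hρ : ∀ d, ∀ a ∈ 𝒜 d, ρ a ∈ 𝒜 d) {ν : Equiv.Perm Q} (hN : IsNakayamaAutomorphism θ ν N)
    (b : BoundAlgebra θ) :
    φ (N b) * GradedAlgebra.proj 𝒜 0 u = GradedAlgebra.proj 𝒜 0 u * ρ (φ b) := by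
  set u₀ := GradedAlgebra.proj 𝒜 0 u with hu₀
  have harrow {i j : Q} (a : i ⟶ j) : φ (N (toBound θ (arrow k a))) * u₀ =
      u₀ * ρ (φ (toBound θ (arrow k a))) := by
    obtain ⟨x, hx, hxa⟩ := hN.map_arrow i j a
    rw [hu₀, ← gradedProj_mul_of_left_mem (hxa ▸ h.map_mem_of_mem_arrowSpan hx), hu.comm, add_comm,
      gradedProj_mul_of_right_mem (hρ _ _ (h.map_arrow _ _ a))]
  let S : Submodule k (PathAlgebra k Q) :=
    { carrier := {x | φ (N (toBound θ x)) * u₀ = u₀ * ρ (φ (toBound θ x))}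
      zero_mem' := by simp only [Set.mem_ofPred_eq, map_zero, zero_mul, mul_zero]
      add_mem' := fun hx hy => by
        simp only [Set.mem_ofPred_eq, map_add, add_mul, mul_add] at hx hy ⊢
        rw [hx, hy]
      smul_mem' := fun c x hx => by
        simp only [Set.mem_ofPred_eq, map_smul, smul_mul_assoc, mul_smul_comm] at hx ⊢
        rw [hx] }
  obtain ⟨x, rfl⟩ := toBound_surjective b
  refine mem_of_arrow_mul_mem S (fun i => ?_) (fun a x hx => ?_) x
  · change φ (N (toBound θ (vertex k i))) * u₀ = u₀ * ρ (φ (toBound θ (vertex k i)))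
    have hi : φ (N (toBound θ (vertex k i))) ∈ 𝒜 0 := by
      rw [hN.map_vertex, h.map_vertex]
      exact h.degree_zero _
    have hcomm := congrArg (GradedAlgebra.proj 𝒜 0) (hu.comm (toBound θ (vertex k i)))
    rwa [gradedProj_zero_mul, gradedProj_zero_mul, gradedProj_of_mem hi, gradedProj_of_mem
      (hρ _ _ (h.map_vertex i ▸ h.degree_zero i : φ (toBound θ (vertex k i)) ∈ 𝒜 0))] at hcomm
  · change φ (N (toBound θ _)) * u₀ = u₀ * ρ (φ (toBound θ _))
    have hx : φ (N (toBound θ x)) * u₀ = u₀ * ρ (φ (toBound θ x)) := hx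
    rw [map_mul (toBound θ), map_mul N, map_mul φ, map_mul φ, map_mul ρ, mul_assoc, hx,
      ← mul_assoc, harrow, mul_assoc]

theorem gradedProj_zero (hu : IsIntertwiner φ ρ N u) {n : ℕ} (hn : ∀ d, n < d → 𝒜 d = ⊥)
    (h : IsRealization 𝒜 θ e φ) (hρ : ∀ d, ∀ a ∈ 𝒜 d, ρ a ∈ 𝒜 d) {ν : Equiv.Perm Q}
    (hN : IsNakayamaAutomorphism θ ν N) : IsIntertwiner φ ρ N (GradedAlgebra.proj 𝒜 0 u) := by
  obtain ⟨w, hw⟩ := hu.exists_units_mul_eq_gradedProj hn h hρ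
  refine ⟨hu.map_one_mul_gradedProj h, hu.gradedProj_comm h hρ hN, fun b hb => ?_, fun z => ?_⟩
  · rw [← hw, ← mul_assoc, ← map_mul] at hb
    exact (Units.mul_left_eq_zero w).1 (hu.eq_zero _ hb)
  · obtain ⟨b, hb⟩ := hu.exists_eq z
    exact ⟨b * (w⁻¹ : (BoundAlgebra θ)ˣ), by
      rw [hb, ← hw, ← mul_assoc, ← map_mul, mul_assoc, Units.inv_mul, mul_one]⟩

end IsIntertwiner

theorem IsRealization.exists_isIntertwiner {k : Type*} [Field k] {Q : Type u} [Quiver.{v} Q]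
    [Fintype Q] {A : Type*} [Ring A] [Algebra k A] [FiniteDimensional k A]
    {𝒜 : ℕ → Submodule k A} [GradedAlgebra 𝒜] {θ : Set (PathAlgebra k Q)} {e : Q → A}
    {φ : BoundAlgebra θ →ₙₐ[k] A} {n : ℕ} (hn : ∀ d, n < d → 𝒜 d = ⊥)
    (h : IsRealization 𝒜 θ e φ) {F : A →ₗ[k] k} {ρ : A ≃ₐ[k] A}
    (hF : IsGradedFrobenius 𝒜 n F ρ) {ν : Equiv.Perm Q} {N : BoundAlgebra θ ≃ₐ[k] BoundAlgebra θ}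
    (hN : IsNakayamaAutomorphism θ ν N) : ∃ u ∈ 𝒜 0, IsIntertwiner φ ρ N u := by
  obtain ⟨f, -, hf, hf'⟩ := hN.frobenius
  obtain ⟨u, hu⟩ := h.isCornerEmbedding.exists_isIntertwiner hF.toIsFrobeniusForm ⟨hf, hf'⟩
  exact ⟨_, gradedProj_mem 𝒜 0 u, hu.gradedProj_zero hn h hF.map_mem hN⟩

section CyclicQuiver

open PathAlgebra

variable {k : Type w} [Field k] {Q : Type u} [Quiver.{v} Q] {ν : Equiv.Perm Q} {m : ℕ}

theorem copyMap_ofPath (t : ZMod m) {i j : Q} (p : Quiver.Path i j) :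
    copyMap k ν m t (ofPath k p) = ofPath k ((copyPrefunctor ν m t).mapPath p) :=
  linearLift_ofPath _ p

theorem copyMap_vertex (t : ZMod m) (i : Q) :
    copyMap k ν m t (vertex k i) = vertex k (⟨i, t⟩ : CyclicVertex ν m) :=
  copyMap_ofPath t _

theorem copyMap_arrow (t : ZMod m) {i j : Q} (a : i ⟶ j) :
    copyMap k ν m t (arrow k a) = arrow (Q := CyclicVertex ν m) k (CyclicArrow.copy a t) :=
  copyMap_ofPath t _

theorem copyMap_mul_copyMap_of_ne {t t' : ZMod m} (h : t ≠ t') (x y : PathAlgebra k Q) :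
    copyMap k ν m t x * copyMap k ν m t' y = 0 := by
  have hbilin : (mulLin k (CyclicVertex ν m)).compl₁₂ (copyMap k ν m t) (copyMap k ν m t') = 0 :=
    linearMap_ext fun p => linearMap_ext fun q => by
      rw [LinearMap.compl₁₂_apply, copyMap_ofPath, copyMap_ofPath, ← mul_eq]
      exact ofPath_mul_of_ne _ _ fun hne => h (congrArg CyclicVertex.index hne).symm
  exact LinearMap.congr_fun₂ hbilin x y

end CyclicQuiver

section CopySum

open PathAlgebra

variable {k : Type w} [Field k] {Q : Type u} [Quiver.{v} Q] [Fintype Q]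
variable {θ : Set (PathAlgebra k Q)} {ν : Equiv.Perm Q} {N : BoundAlgebra θ ≃ₐ[k] BoundAlgebra θ}
variable {s m : ℕ} [NeZero m]

variable (θ ν N s) in
/-- The quotient map `b ↦ (b, t)` induced by `copyMap`, which identifies `kQ/(θ)` with a copy in the
bound algebra of the cyclic extension. -/
def copyHom (t : ZMod m) : BoundAlgebra θ →ₙₐ[k] BoundAlgebra (cyclicRelations θ ν N s m) :=
  BoundAlgebra.lift
    { (toBound (cyclicRelations θ ν N s m)).toLinearMap ∘ₗ copyMap k ν m t with
      map_zero' := map_zero ((toBound _).toLinearMap ∘ₗ copyMap k ν m t)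
      map_mul' := map_mul_of_ofPath ((toBound _).toLinearMap ∘ₗ copyMap k ν m t)
        fun {i j i' j'} p q => by
          simp only [LinearMap.comp_apply, AlgHom.toLinearMap_apply, ← map_mul]
          congr 1
          by_cases h : i = j'
          · subst h
            rw [ofPath_mul_ofPath, copyMap_ofPath, copyMap_ofPath, copyMap_ofPath,
              ofPath_mul_ofPath, Prefunctor.mapPath_comp]
          · rw [ofPath_mul_of_ne _ _ (Ne.symm h), map_zero, copyMap_ofPath, copyMap_ofPath]
            exact (ofPath_mul_of_ne _ _ fun h' => h (congrArg CyclicVertex.vert h').symm).symm }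
    fun r hr => BoundAlgebra.toBound_eq_zero (CyclicRelation.copy r hr t)

theorem copyHom_toBound (t : ZMod m) (x : PathAlgebra k Q) :
    copyHom θ ν N s t (toBound θ x) = toBound (cyclicRelations θ ν N s m) (copyMap k ν m t x) :=
  BoundAlgebra.lift_toBound _ x

theorem copyHom_mul_copyHom_of_ne {t t' : ZMod m} (h : t ≠ t') (b b' : BoundAlgebra θ) :
    copyHom θ ν N s t b * copyHom θ ν N s t' b' = 0 := by
  obtain ⟨x, rfl⟩ := BoundAlgebra.toBound_surjective b
  obtain ⟨y, rfl⟩ := BoundAlgebra.toBound_surjective b'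
  rw [copyHom_toBound, copyHom_toBound, ← map_mul, copyMap_mul_copyMap_of_ne h, map_zero]

variable (θ ν N s m) in
/-- The inclusion of the `m` copies of `kQ/(θ)`, as one homomorphism on their product. -/
def copySum : (ZMod m → BoundAlgebra θ) →ₙₐ[k] BoundAlgebra (cyclicRelations θ ν N s m) where
  toFun a := ∑ t, copyHom θ ν N s t (a t)
  map_smul' c a := by simp only [Pi.smul_apply, map_smul, Finset.smul_sum, MonoidHom.id_apply]
  map_zero' := by simp only [Pi.zero_apply, map_zero, Finset.sum_const_zero]
  map_add' a b := by simp only [Pi.add_apply, map_add, Finset.sum_add_distrib]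
  map_mul' a b := by
    simp only [Pi.mul_apply, Finset.sum_mul_sum]
    refine Finset.sum_congr rfl fun t _ => ?_
    rw [Finset.sum_eq_single_of_mem t (Finset.mem_univ t) fun t' _ h =>
      copyHom_mul_copyHom_of_ne h.symm _ _, map_mul]

theorem copySum_single (t : ZMod m) (b : BoundAlgebra θ) :
    copySum θ ν N s m (Pi.single t b) = copyHom θ ν N s t b := by
  refine (Finset.sum_eq_single_of_mem t (Finset.mem_univ t) fun t' _ h => ?_).trans ?_
  · rw [Pi.single_eq_of_ne h, map_zero]
  · rw [Pi.single_eq_same]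

variable (θ ν N s m) in
/-- The sum of all connecting arrows in the bound algebra of the cyclic extension. -/
def conn : BoundAlgebra (cyclicRelations θ ν N s m) :=
  ∑ x : CyclicVertex ν m, toBound (cyclicRelations θ ν N s m) (connArrow k ν m x.vert x.index)

theorem conn_mul_vertex (i : Q) (t : ZMod m) :
    conn θ ν N s m * copySum θ ν N s m (Pi.single t (toBound θ (vertex k i))) =
      toBound (cyclicRelations θ ν N s m) (connArrow k ν m i t) := by
  rw [copySum_single, copyHom_toBound, copyMap_vertex, conn, Finset.sum_mul,
    Finset.sum_eq_single_of_mem ⟨i, t⟩ (Finset.mem_univ _)]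
  · rw [← map_mul]
    exact congrArg _ (ofPath_mul_vertex _)
  · intro x _ hx
    rw [← map_mul, ← map_zero (toBound (cyclicRelations θ ν N s m))]
    exact congrArg _ (ofPath_mul_of_ne _ _ (Ne.symm hx))

theorem connArrow_mul_conn (i : Q) (t : ZMod m) :
    toBound (cyclicRelations θ ν N s m) (connArrow k ν m i t) * conn θ ν N s m = 0 := by
  rw [conn, Finset.mul_sum]
  refine Finset.sum_eq_zero fun x _ => ?_
  rw [← map_mul]
  by_cases h : (⟨ν x.vert, x.index + 1⟩ : CyclicVertex ν m) = ⟨i, t⟩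
  · obtain ⟨rfl, rfl⟩ := CyclicVertex.mk.inj h
    exact BoundAlgebra.toBound_eq_zero (CyclicRelation.square x.vert x.index)
  · rw [← map_zero (toBound (cyclicRelations θ ν N s m))]
    exact congrArg _ (ofPath_mul_of_ne _ _ h)

theorem copyArrow_mul_conn {i j : Q} (a : i ⟶ j) (t : ZMod m) :
    toBound (cyclicRelations θ ν N s m) (copyMap k ν m t (arrow k a)) * conn θ ν N s m =
      toBound (cyclicRelations θ ν N s m)
        (copyMap k ν m t (arrow k a) * connArrow k ν m (ν.symm i) (t - 1)) := by
  rw [conn, Finset.mul_sum,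
    Finset.sum_eq_single_of_mem ⟨ν.symm i, t - 1⟩ (Finset.mem_univ _), map_mul]
  intro x _ hx
  rw [← map_mul, copyMap_arrow, ← map_zero (toBound (cyclicRelations θ ν N s m))]
  refine congrArg _ (ofPath_mul_of_ne _ _ fun h => hx ?_)
  obtain ⟨rfl, rfl⟩ := CyclicVertex.mk.inj h
  simp

end CopySum

section Nakayama

open PathAlgebra

variable {k : Type w} [Field k] {Q : Type u} [Quiver.{v} Q] [Fintype Q]
variable {θ : Set (PathAlgebra k Q)} {ν : Equiv.Perm Q} {N : BoundAlgebra θ ≃ₐ[k] BoundAlgebra θ}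

namespace IsNakayamaAutomorphism

theorem symm_vertex (hN : IsNakayamaAutomorphism θ ν N) (i : Q) :
    N.symm (toBound θ (vertex k i)) = toBound θ (vertex k (ν.symm i)) := by
  rw [AlgEquiv.symm_apply_eq, hN.map_vertex, Equiv.apply_symm_apply]

theorem exists_symm_arrow [FiniteDimensional k (BoundAlgebra θ)]
    (hN : IsNakayamaAutomorphism θ ν N) {i j : Q} (a : i ⟶ j) (c : k) :
    ∃ x ∈ arrowSpan k Q, toBound θ x = N.symm (toBound θ (c • arrow k a)) := by
  set S := (arrowSpan k Q).map (toBound θ).toLinearMap with hS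
  have hle : S.map N.toLinearMap ≤ S := by
    rw [hS, arrowSpan, Submodule.map_span, Submodule.map_span, Submodule.span_le]
    rintro _ ⟨_, ⟨_, ⟨i, j, a, rfl⟩, rfl⟩, rfl⟩
    obtain ⟨x, hx, hxa⟩ := hN.map_arrow i j a
    rw [← Submodule.map_span]
    exact ⟨x, hx, hxa.symm⟩
  have hmem : toBound θ (c • arrow k a) ∈ S :=
    ⟨c • arrow k a, Submodule.smul_mem _ _ (Submodule.subset_span ⟨i, j, a, rfl⟩), rfl⟩
  rw [← Submodule.eq_of_le_of_finrank_eq hle (LinearEquiv.finrank_map_eq N.toLinearEquiv S)] at hmem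
  obtain ⟨_, ⟨x, hx, rfl⟩, hxa⟩ := hmem
  exact ⟨x, hx, N.eq_symm_apply.2 hxa⟩

theorem vertex_mul_toBound (hN : IsNakayamaAutomorphism θ ν N) {i j : Q} {a : i ⟶ j} {c : k}
    {x : PathAlgebra k Q} (hx : toBound θ x = N.symm (toBound θ (c • arrow k a))) :
    toBound θ (vertex k (ν.symm j)) * toBound θ x = toBound θ x := by
  rw [hx, ← hN.symm_vertex, ← map_mul, ← map_mul, PathAlgebra.mul_smul', arrow, vertex_mul_ofPath]

theorem toBound_mul_vertex (hN : IsNakayamaAutomorphism θ ν N) {i j : Q} {a : i ⟶ j} {c : k}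
    {x : PathAlgebra k Q} (hx : toBound θ x = N.symm (toBound θ (c • arrow k a))) :
    toBound θ x * toBound θ (vertex k (ν.symm i)) = toBound θ x := by
  rw [hx, ← hN.symm_vertex, ← map_mul, ← map_mul, PathAlgebra.smul_mul', arrow, ofPath_mul_vertex]

end IsNakayamaAutomorphism

end Nakayama

section NormalForm

open PathAlgebra

variable {k : Type w} [Field k] {Q : Type u} [Quiver.{v} Q] [Fintype Q]
variable {θ : Set (PathAlgebra k Q)} {ν : Equiv.Perm Q} {N : BoundAlgebra θ ≃ₐ[k] BoundAlgebra θ}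
variable {s m : ℕ} [NeZero m]

theorem copySum_arrow_mul_conn (hN : IsNakayamaAutomorphism θ ν N) {i j : Q} (a : i ⟶ j)
    (t : ZMod m) {x : PathAlgebra k Q} (hx : x ∈ arrowSpan k Q)
    (hxa : toBound θ x = N.symm (toBound θ ((-1 : k) ^ s • arrow k a))) :
    copySum θ ν N s m (Pi.single t (toBound θ (arrow k a))) * conn θ ν N s m =
      conn θ ν N s m * copySum θ ν N s m (Pi.single (t - 1) (toBound θ x)) := by
  calc copySum θ ν N s m (Pi.single t (toBound θ (arrow k a))) * conn θ ν N s m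
      = toBound _ (copyMap k ν m t (arrow k a) * connArrow k ν m (ν.symm i) (t - 1)) := by
        rw [copySum_single, copyHom_toBound, copyArrow_mul_conn]
    _ = toBound _ (connArrow k ν m (ν.symm j) (t - 1) * copyMap k ν m (t - 1) x) := by
        rw [← sub_eq_zero, ← map_sub]
        exact BoundAlgebra.toBound_eq_zero (CyclicRelation.commute a t x hx hxa)
    _ = conn θ ν N s m * copySum θ ν N s m (Pi.single (t - 1) (toBound θ x)) := by
        rw [map_mul, ← conn_mul_vertex, ← copyHom_toBound, ← copySum_single, mul_assoc, ← map_mul,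
          ← Pi.single_mul, hN.vertex_mul_toBound hxa]

theorem exists_eq_copySum_add_conn_mul [FiniteDimensional k (BoundAlgebra θ)]
    (hN : IsNakayamaAutomorphism θ ν N) (z : BoundAlgebra (cyclicRelations θ ν N s m)) :
    ∃ a b, z = copySum θ ν N s m a + conn θ ν N s m * copySum θ ν N s m b := by
  let f : (ZMod m → BoundAlgebra θ) →ₗ[k] BoundAlgebra (cyclicRelations θ ν N s m) :=
    copySum θ ν N s m
  let S := LinearMap.range (f.coprod (LinearMap.mulLeft k (conn θ ν N s m) ∘ₗ f))
  have hmem {z} : z ∈ S ↔ ∃ a b, copySum θ ν N s m a + conn θ ν N s m * copySum θ ν N s m b = z :=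
    Prod.exists
  obtain ⟨w, rfl⟩ := BoundAlgebra.toBound_surjective z
  suffices w ∈ S.comap (toBound (cyclicRelations θ ν N s m)).toLinearMap by
    obtain ⟨a, b, h⟩ := hmem.1 this
    exact ⟨a, b, h.symm⟩
  refine mem_of_arrow_mul_mem _ ?_ ?_ w
  · rintro ⟨i, t⟩
    refine hmem.2 ⟨Pi.single t (toBound θ (vertex k i)), 0, ?_⟩
    rw [map_zero, mul_zero, add_zero, copySum_single, copyHom_toBound, copyMap_vertex]
    rfl
  · intro _ _ (a : CyclicArrow ν m _ _) w hw
    obtain ⟨b, c, hbc⟩ := hmem.1 hw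
    refine hmem.2 ?_
    rw [AlgHom.toLinearMap_apply] at hbc
    simp only [AlgHom.toLinearMap_apply, map_mul, ← hbc, mul_add]
    cases a with
    | @copy i j a t =>
      obtain ⟨x, hx, hxa⟩ := hN.exists_symm_arrow a ((-1 : k) ^ s)
      refine ⟨Pi.single t (toBound θ (arrow k a)) * b, Pi.single (t - 1) (toBound θ x) * c, ?_⟩
      rw [map_mul, map_mul, ← mul_assoc (conn θ ν N s m), ← copySum_arrow_mul_conn hN a t hx hxa,
        copySum_single, copyHom_toBound, copyMap_arrow, mul_assoc]
    | conn i t =>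
      refine ⟨0, Pi.single t (toBound θ (vertex k i)) * b, ?_⟩
      change _ = toBound _ (connArrow k ν m i t) * _ + toBound _ (connArrow k ν m i t) * _
      rw [← mul_assoc _ (conn θ ν N s m), connArrow_mul_conn, zero_mul, add_zero, map_zero,
        zero_add, map_mul, ← mul_assoc, conn_mul_vertex]

end NormalForm

section QuadraticRelations

open PathAlgebra

variable {k : Type w} [Field k] {Q : Type u} [Quiver.{v} Q]

theorem arrow_mul_arrow_mem_span {i i' j j' l : Q} (b : i' ⟶ j) (a : l ⟶ i) (hj : j = j') :
    arrow k b * arrow k a ∈ Submodule.span k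
      {r : PathAlgebra k Q | ∃ p : Quiver.Path l j', p.length = 2 ∧ r = ofPath k p} := by
  subst hj
  by_cases h : i = i'
  · subst h
    exact Submodule.subset_span ⟨a.toPath.cons b, rfl, arrow_mul_ofPath b a.toPath⟩
  · rw [arrow, arrow, ofPath_mul_of_ne _ _ h]
    exact zero_mem _

theorem vertex_mul_mul_vertex_mem_span {x : PathAlgebra k Q} (hx : x ∈ arrowSpan k Q)
    (i j : Q) : vertex k j * x * vertex k i ∈
      Submodule.span k {y : PathAlgebra k Q | ∃ a : i ⟶ j, y = arrow k a} := by
  let f := (mulLin k Q).flip (vertex k i) ∘ₗ mulLin k Q (vertex k j)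
  suffices arrowSpan k Q ≤ (Submodule.span k {y | ∃ a : i ⟶ j, y = arrow k a}).comap f from this hx
  refine Submodule.span_le.2 ?_
  rintro _ ⟨i', j', a, rfl⟩
  rw [SetLike.mem_coe, Submodule.mem_comap]
  change vertex k j * arrow k a * vertex k i ∈ Submodule.span k _
  by_cases hj : j' = j
  · subst hj
    rw [arrow, vertex_mul_ofPath]
    by_cases hi : i = i'
    · subst hi
      exact Submodule.subset_span ⟨a, ofPath_mul_vertex _⟩
    · rw [vertex, ofPath_mul_of_ne _ _ hi]
      exact zero_mem _
  · rw [vertex, arrow, ofPath_mul_of_ne _ _ hj, zero_mul]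
    exact zero_mem _

variable {ν : Equiv.Perm Q} {m : ℕ}

theorem length_mapPath_copyPrefunctor (t : ZMod m) {i j : Q} (p : Quiver.Path i j) :
    ((copyPrefunctor ν m t).mapPath p).length = p.length := by
  induction p with
  | nil => rfl
  | cons p _ ih => exact congrArg (· + 1) ih

theorem isQuadraticRelation_copyMap {r : PathAlgebra k Q} (hr : IsQuadraticRelation r)
    (t : ZMod m) : IsQuadraticRelation (copyMap k ν m t r) := by
  obtain ⟨i, j, h⟩ := hr
  refine ⟨⟨i, t⟩, ⟨j, t⟩, Submodule.mem_comap.1 (Submodule.span_le.2 ?_ h)⟩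
  rintro _ ⟨p, hp, rfl⟩
  refine Submodule.subset_span ⟨_, ?_, copyMap_ofPath t p⟩
  exact (length_mapPath_copyPrefunctor t p).trans hp

theorem connArrow_mul_copyMap_mem_span {i j : Q} {y : PathAlgebra k Q}
    (hy : y ∈ Submodule.span k {y : PathAlgebra k Q | ∃ a : i ⟶ j, y = arrow k a})
    {t t' : ZMod m} {l : Q} (hl : ν j = l) (ht : t + 1 = t') :
    connArrow k ν m j t * copyMap k ν m t y ∈ Submodule.span k
      {r | ∃ p : Quiver.Path (⟨i, t⟩ : CyclicVertex ν m) ⟨l, t'⟩,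
        p.length = 2 ∧ r = ofPath k p} := by
  subst hl ht
  refine Submodule.mem_comap.1 (Submodule.span_le.2 ?_ hy :
    y ∈ Submodule.comap (mulLin k _ (connArrow k ν m j t) ∘ₗ copyMap k ν m t) _)
  rintro _ ⟨a, rfl⟩
  rw [SetLike.mem_coe, Submodule.mem_comap, LinearMap.comp_apply, ← mul_eq, copyMap_arrow]
  exact arrow_mul_arrow_mem_span _ _ rfl

variable [Fintype Q] {θ : Set (PathAlgebra k Q)} {N : BoundAlgebra θ ≃ₐ[k] BoundAlgebra θ}

theorem IsNakayamaAutomorphism.mem_span_arrow (hN : IsNakayamaAutomorphism θ ν N)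
    (hθ : ∀ r ∈ θ, IsQuadraticRelation r) {i j : Q} {a : i ⟶ j} {c : k} {x : PathAlgebra k Q}
    (hx : x ∈ arrowSpan k Q) (hxa : toBound θ x = N.symm (toBound θ (c • arrow k a))) :
    x ∈ Submodule.span k {y : PathAlgebra k Q | ∃ b : ν.symm i ⟶ ν.symm j, y = arrow k b} := by
  have hmem := vertex_mul_mul_vertex_mem_span hx (ν.symm i) (ν.symm j)
  convert hmem using 1
  refine (BoundAlgebra.injOn_toBound_arrowSpan hθ (Submodule.span_mono ?_ hmem) hx ?_).symm
  · rintro _ ⟨b, rfl⟩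
    exact ⟨_, _, b, rfl⟩
  · rw [map_mul, map_mul, hN.vertex_mul_toBound hxa, hN.toBound_mul_vertex hxa]

theorem isQuadraticRelation_of_cyclicRelation [NeZero m] (hN : IsNakayamaAutomorphism θ ν N)
    (hθ : ∀ r ∈ θ, IsQuadraticRelation r) {s : ℕ} {r : PathAlgebra k (CyclicVertex ν m)}
    (hr : CyclicRelation θ ν N s m r) : IsQuadraticRelation r := by
  cases hr with
  | copy r hr t => exact isQuadraticRelation_copyMap (hθ r hr) t
  | square i t => exact ⟨_, _, arrow_mul_arrow_mem_span _ _ rfl⟩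
  | @commute i j a t x hx hxa =>
    refine ⟨⟨ν.symm i, t - 1⟩, ⟨j, t⟩, sub_mem ?_ ?_⟩
    · rw [copyMap_arrow]
      exact arrow_mul_arrow_mem_span _ _ rfl
    · exact connArrow_mul_copyMap_mem_span (hN.mem_span_arrow hθ hx hxa)
        (ν.apply_symm_apply j) (sub_add_cancel t 1)

end QuadraticRelations

section Twist

variable {k : Type*} [Field k] {A : Type*} [Ring A] [Algebra k A] {B : Type*} [Ring B] [Algebra k B]
  {φ : B →ₙₐ[k] A} {ρ σ : A ≃ₐ[k] A} {N σ' : B ≃ₐ[k] B} {u : A}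

theorem IsIntertwiner.trans (hu : IsIntertwiner φ ρ N u) (hσ : ∀ b, φ (σ' b) = σ (φ b)) :
    IsIntertwiner φ (σ.trans ρ) (σ'.trans N) u where
  map_one_mul := hu.map_one_mul
  comm b := by rw [AlgEquiv.trans_apply, AlgEquiv.trans_apply, hu.comm, hσ]
  eq_zero := hu.eq_zero
  exists_eq z := by
    rw [AlgEquiv.trans_apply, ← hσ, map_one σ']
    exact hu.exists_eq z

end Twist

section CyclicExtension

variable {k : Type*} [Field k] {A : Type*} [Ring A] [Algebra k A] {B : Type*} [Ring B] [Algebra k B]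
  {R : Type*} [Ring R] [Algebra k R] {m : ℕ} [NeZero m]

/-- The algebra `R` is obtained from `A` by adjoining the idempotents `ε t`, which commute with `A`,
and an element `y` of degree one and square zero that moves past `A` through the automorphism `τ`
and past the `ε t` through the shift of the index. -/
structure IsCyclicExtension (𝒜 : ℕ → Submodule k A) (ℛ : ℕ → Submodule k R) (ι : A →ₐ[k] R)
    (τ : A ≃ₐ[k] A) (ε : ZMod m → R) (y : R) : Prop where
  complete : CompleteOrthogonalIdempotents ε
  commute : ∀ t a, ε t * ι a = ι a * ε t
  mul_map : ∀ a, y * ι a = ι (τ a) * y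
  mul_self : y * y = 0
  shift : ∀ t, y * ε t = ε (t + 1) * y
  map_mem : ∀ d, ∀ a ∈ 𝒜 d, ι a ∈ ℛ d
  idem_mem : ∀ t, ε t ∈ ℛ 0
  mem : y ∈ ℛ 1
  exists_eq : ∀ r, ∃ a b : ZMod m → A, r = ∑ t, (ι (a t) + ι (b t) * y) * ε t
  eq_zero : ∀ a b : ZMod m → A, ∑ t, (ι (a t) + ι (b t) * y) * ε t = 0 → a = 0 ∧ b = 0

/-- The counterpart of `IsCyclicExtension` for corners: the corner of `R` at `ψ 1` consists of the
elements `∑ t, (ψ (a t) + η * ψ (b t)) * ε t`, with uniquely determined coefficients, and `M` is the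
automorphism through which `η` moves past `B`. -/
structure IsCyclicCorner (ψ : B →ₙₐ[k] R) (M : B ≃ₐ[k] B) (ε : ZMod m → R) (η : R) : Prop where
  complete : CompleteOrthogonalIdempotents ε
  commute : ∀ t b, ε t * ψ b = ψ b * ε t
  mul_map : ∀ b, η * ψ b = ψ (M b) * η
  mul_self : η * η = 0
  shift : ∀ t, η * ε t = ε (t + 1) * η
  exists_eq : ∀ r, ∃ a b : ZMod m → B, ψ 1 * r * ψ 1 = ∑ t, (ψ (a t) + η * ψ (b t)) * ε t
  eq_zero : ∀ a b : ZMod m → B, ∑ t, (ψ (a t) + η * ψ (b t)) * ε t = 0 → a = 0 ∧ b = 0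

theorem IsCyclicExtension.isCyclicCorner {𝒜 : ℕ → Submodule k A} {ℛ : ℕ → Submodule k R}
    {ι : A →ₐ[k] R} {τ : A ≃ₐ[k] A} {ε : ZMod m → R} {y : R} {φ : B →ₙₐ[k] A} {M : B ≃ₐ[k] B}
    {u : A} (hR : IsCyclicExtension 𝒜 ℛ ι τ ε y) (hφ : IsCornerEmbedding φ)
    (hu : IsIntertwiner φ τ M u) :
    IsCyclicCorner ((ι : A →ₙₐ[k] R).comp φ) M ε (ι u * y) := by
  have hmul (b : B) : ι u * y * ι (φ b) = ι (φ (M b) * u) * y := by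
    rw [mul_assoc, hR.mul_map, ← mul_assoc, ← map_mul, hu.comm]
  refine ⟨hR.complete, fun t b => hR.commute t _, fun b => ?_, ?_, fun t => ?_, fun r => ?_,
    fun a b hab => ?_⟩
  · exact (hmul b).trans (by rw [map_mul, mul_assoc]; rfl)
  · rw [mul_assoc, ← mul_assoc y, hR.mul_map, mul_assoc, hR.mul_self, mul_zero, mul_zero]
  · rw [mul_assoc, hR.shift, ← mul_assoc, ← hR.commute, mul_assoc]
  · obtain ⟨a, b, rfl⟩ := hR.exists_eq r
    choose a' ha using fun t => hφ.exists_eq (a t)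
    choose b' hb using fun t => hu.exists_eq (b t)
    refine ⟨a', fun t => M.symm (b' t), ?_⟩
    change ι (φ 1) * _ * ι (φ 1) = ∑ t, (ι (φ (a' t)) + ι u * y * ι (φ (M.symm (b' t)))) * ε t
    rw [Finset.mul_sum, Finset.sum_mul]
    refine Finset.sum_congr rfl fun t _ => ?_
    calc ι (φ 1) * ((ι (a t) + ι (b t) * y) * ε t) * ι (φ 1)
        = (ι (φ 1) * ι (a t) * ι (φ 1) + ι (φ 1) * ι (b t) * (y * ι (φ 1))) * ε t := by
          simp only [mul_assoc, mul_add, add_mul, hR.commute]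
      _ = (ι (φ (a' t)) + ι (φ (b' t) * u) * y) * ε t := by
          rw [hR.mul_map, ha, ← hb]
          simp only [map_mul, mul_assoc]
      _ = _ := by rw [hmul, M.apply_symm_apply]
  · obtain ⟨ha, hb⟩ := hR.eq_zero (fun t => φ (a t)) (fun t => φ (M (b t)) * u)
      (hab ▸ Finset.sum_congr rfl fun t _ => by rw [← hmul]; rfl)
    refine ⟨funext fun t => hφ.injective ((congrFun ha t).trans (map_zero φ).symm),
      funext fun t => ?_⟩
    exact (map_eq_zero_iff M M.injective).1 (hu.eq_zero _ (congrFun hb t))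

namespace IsCyclicCorner

variable {ψ : B →ₙₐ[k] R} {M : B ≃ₐ[k] B} {ε : ZMod m → R} {η : R}

theorem map_mul_idem_mul (hψ : IsCyclicCorner ψ M ε η) (a b : B) (t : ZMod m) :
    ψ a * ε t * (ψ b * ε t) = ψ (a * b) * ε t := by
  rw [mul_assoc, ← mul_assoc (ε t), hψ.commute, mul_assoc, hψ.complete.idem t, ← mul_assoc,
    ← map_mul]

theorem map_mul_idem_mul_of_ne (hψ : IsCyclicCorner ψ M ε η) (a b : B) {t t' : ZMod m}
    (h : t ≠ t') : ψ a * ε t * (ψ b * ε t') = 0 := by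
  rw [mul_assoc, ← mul_assoc (ε t), hψ.commute, mul_assoc, hψ.complete.ortho h, mul_zero, mul_zero]

theorem mul_map_mul_idem_mul (hψ : IsCyclicCorner ψ M ε η) (a b : B) (t : ZMod m) :
    η * ψ a * ε t * (ψ b * ε t) = η * ψ (a * b) * ε t := by
  simp only [mul_assoc η, hψ.map_mul_idem_mul]

theorem map_mul_idem_mul_mul_map (hψ : IsCyclicCorner ψ M ε η) (a b : B) (t : ZMod m) :
    ψ a * ε (t + 1) * (η * ψ b * ε t) = η * ψ (M.symm a * b) * ε t := by
  calc ψ a * ε (t + 1) * (η * ψ b * ε t)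
      = ψ a * (ε (t + 1) * η) * (ψ b * ε t) := by simp only [mul_assoc]
    _ = η * (ψ (M.symm a) * ε t * (ψ b * ε t)) := by
      rw [← hψ.shift, ← mul_assoc (ψ a), ← M.apply_symm_apply a, ← hψ.mul_map,
        M.symm_apply_apply]
      simp only [mul_assoc]
    _ = η * ψ (M.symm a * b) * ε t := by rw [hψ.map_mul_idem_mul, mul_assoc]

theorem conn_mul_conn (hψ : IsCyclicCorner ψ M ε η) (a b : B) (t : ZMod m) :
    η * ψ a * ε (t + 1) * (η * ψ b * ε t) = 0 := by
  rw [mul_assoc η, mul_assoc η, hψ.map_mul_idem_mul_mul_map, mul_assoc η, ← mul_assoc η η,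
    hψ.mul_self, zero_mul]

end IsCyclicCorner

end CyclicExtension

section CyclicIdempotent

variable {k : Type w} [Field k] {Q : Type u} [Quiver.{v} Q] [Fintype Q]
  {θ : Set (PathAlgebra k Q)} {ν : Equiv.Perm Q} {N M : BoundAlgebra θ ≃ₐ[k] BoundAlgebra θ}
  {R : Type*} [Ring R] [Algebra k R] {s m : ℕ} [NeZero m]
  {ψ : BoundAlgebra θ →ₙₐ[k] R} {ε : ZMod m → R} {η : R}

open PathAlgebra

namespace IsCyclicCorner

/-- The images of the trivial paths and of the arrows of the quiver of the cyclic extension. -/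
def quiverRepresentation (hψ : IsCyclicCorner ψ M ε η)
    (hM : ∀ i, M (toBound θ (vertex k i)) = toBound θ (vertex k (ν i))) :
    QuiverRepresentation (CyclicVertex ν m) R where
  vertex x := ψ (toBound θ (vertex k x.vert)) * ε x.index
  arrow := fun
    | .copy a t => ψ (toBound θ (PathAlgebra.arrow k a)) * ε t
    | .conn i t => η * ψ (toBound θ (vertex k i)) * ε t
  orthogonal :=
    { idem x := by
        change _ = _
        rw [hψ.map_mul_idem_mul, ← map_mul, (orthogonalIdempotents_vertex (k := k)).idem]
      ortho x x' hx := by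
        change ψ _ * ε x.index * (ψ _ * ε x'.index) = 0
        rcases eq_or_ne x.index x'.index with ht | ht
        · have hi : x.vert ≠ x'.vert := fun hi => hx (CyclicVertex.ext hi ht)
          rw [ht, hψ.map_mul_idem_mul, ← map_mul, (orthogonalIdempotents_vertex (k := k)).ortho hi,
            map_zero, map_zero, zero_mul]
        · exact hψ.map_mul_idem_mul_of_ne _ _ ht }
  vertex_mul_arrow {x x'} (a : CyclicArrow ν m x x') := by
    cases a with
    | copy a t =>
      refine (hψ.map_mul_idem_mul _ _ t).trans (congrArg (ψ · * ε t) ?_)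
      rw [← map_mul, PathAlgebra.arrow, vertex_mul_ofPath]
    | conn i t =>
      refine (hψ.map_mul_idem_mul_mul_map _ _ t).trans (congrArg (η * ψ · * ε t) ?_)
      rw [← hM, M.symm_apply_apply]
      exact (orthogonalIdempotents_vertex.idem i).map (toBound θ)
  arrow_mul_vertex {x x'} (a : CyclicArrow ν m x x') := by
    cases a with
    | copy a t =>
      refine (hψ.map_mul_idem_mul _ _ t).trans (congrArg (ψ · * ε t) ?_)
      rw [← map_mul, PathAlgebra.arrow, ofPath_mul_vertex]
    | conn i t =>
      refine (hψ.mul_map_mul_idem_mul _ _ t).trans (congrArg (η * ψ · * ε t) ?_)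
      exact (orthogonalIdempotents_vertex.idem i).map (toBound θ)

variable (hψ : IsCyclicCorner ψ M ε η)
  (hM : ∀ i, M (toBound θ (vertex k i)) = toBound θ (vertex k (ν i)))

theorem lift_copyMap (t : ZMod m) (x : PathAlgebra k Q) :
    (hψ.quiverRepresentation hM).lift k (copyMap k ν m t x) = ψ (toBound θ x) * ε t := by
  let E := hψ.quiverRepresentation hM
  have : ((E.lift k : _ →ₙₐ[k] R) : _ →ₗ[k] R) ∘ₗ copyMap k ν m t =
      LinearMap.mulRight k (ε t) ∘ₗ (ψ : _ →ₗ[k] R) ∘ₗ (toBound θ).toLinearMap := by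
    refine linearMap_ext fun {i j} p => ?_
    change E.lift k (copyMap k ν m t (ofPath k p)) = ψ (toBound θ (ofPath k p)) * ε t
    rw [copyMap_ofPath, E.lift_ofPath]
    induction p with
    | nil => rfl
    | cons p a ih =>
      change E.arrow _ * _ = _
      rw [ih, ← arrow_mul_ofPath, map_mul, ← hψ.map_mul_idem_mul]
      rfl
  exact LinearMap.congr_fun this x

theorem lift_connArrow (i : Q) (t : ZMod m) :
    (hψ.quiverRepresentation hM).lift k (connArrow k ν m i t) =
      η * ψ (toBound θ (vertex k i)) * ε t :=
  (hψ.quiverRepresentation hM).lift_arrow (CyclicArrow.conn i t)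

theorem lift_cyclicRelation (hN : ∀ {i j : Q} (a : i ⟶ j),
      M (N.symm (toBound θ ((-1 : k) ^ s • arrow k a))) = toBound θ (arrow k a))
    {r : PathAlgebra k (CyclicVertex ν m)} (hr : CyclicRelation θ ν N s m r) :
    (hψ.quiverRepresentation hM).lift k r = 0 := by
  cases hr with
  | copy r hr t =>
    rw [hψ.lift_copyMap hM, BoundAlgebra.toBound_eq_zero hr, map_zero, zero_mul]
  | square i t =>
    rw [map_mul, hψ.lift_connArrow hM, hψ.lift_connArrow hM, hψ.conn_mul_conn]
  | @commute i j a t x hx hxa =>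
    have hx : toBound θ x = M.symm (toBound θ (arrow k a)) := by
      rw [hxa, AlgEquiv.eq_symm_apply, hN]
    have hM' (i : Q) : toBound θ (vertex k (ν.symm i)) = M.symm (toBound θ (vertex k i)) := by
      rw [AlgEquiv.eq_symm_apply, hM, Equiv.apply_symm_apply]
    obtain ⟨t, rfl⟩ : ∃ t', t = t' + 1 := ⟨t - 1, (sub_add_cancel t 1).symm⟩
    rw [map_sub, map_mul, map_mul, add_sub_cancel_right, hψ.lift_copyMap hM,
      hψ.lift_copyMap hM, hψ.lift_connArrow hM, hψ.lift_connArrow hM,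
      hψ.map_mul_idem_mul_mul_map, hψ.mul_map_mul_idem_mul, hx, hM', hM', ← map_mul M.symm,
      ← map_mul M.symm, ← map_mul (toBound θ), ← map_mul (toBound θ), arrow, ofPath_mul_vertex,
      vertex_mul_ofPath, sub_self]

end IsCyclicCorner

end CyclicIdempotent

theorem sum_cyclicVertex_mul {Q : Type u} [Fintype Q] (ν : Equiv.Perm Q) {m : ℕ} [NeZero m]
    {R : Type*} [Ring R] {ε : ZMod m → R} (hε : CompleteOrthogonalIdempotents ε) (f : Q → R) :
    ∑ x : CyclicVertex ν m, f x.vert * ε x.index = ∑ i, f i := by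
  calc ∑ x : CyclicVertex ν m, f x.vert * ε x.index
      = ∑ x : Q × ZMod m, f x.1 * ε x.2 :=
        Fintype.sum_equiv (cyclicVertexEquiv ν m) _ _ fun _ => rfl
    _ = ∑ i, f i := by
        simp only [Fintype.sum_prod_type, ← Finset.mul_sum, hε.complete, mul_one]

section CyclicHom

variable {k : Type w} [Field k] {Q : Type u} [Quiver.{v} Q] [Fintype Q]
  {θ : Set (PathAlgebra k Q)} {ν : Equiv.Perm Q} {N M : BoundAlgebra θ ≃ₐ[k] BoundAlgebra θ}
  {R : Type*} [Ring R] [Algebra k R] {s m : ℕ} [NeZero m]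
  {ψ : BoundAlgebra θ →ₙₐ[k] R} {ε : ZMod m → R} {η : R}

open PathAlgebra

namespace IsCyclicCorner

variable (hψ : IsCyclicCorner ψ M ε η)
  (hM : ∀ i, M (toBound θ (vertex k i)) = toBound θ (vertex k (ν i)))
  (hMN : ∀ {i j : Q} (a : i ⟶ j),
    M (N.symm (toBound θ ((-1 : k) ^ s • arrow k a))) = toBound θ (arrow k a))

/-- The homomorphism that identifies the bound algebra of the cyclic extension with the corner
of `R` at `ψ 1`. -/
def cyclicHom : BoundAlgebra (cyclicRelations θ ν N s m) →ₙₐ[k] R :=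
  BoundAlgebra.lift ((hψ.quiverRepresentation hM).lift k)
    fun _ hr => hψ.lift_cyclicRelation hM hMN hr

theorem cyclicHom_toBound (x : PathAlgebra k (CyclicVertex ν m)) :
    hψ.cyclicHom hM hMN (toBound _ x) = (hψ.quiverRepresentation hM).lift k x :=
  BoundAlgebra.lift_toBound _ x

theorem cyclicHom_vertex (x : CyclicVertex ν m) :
    hψ.cyclicHom hM hMN (toBound _ (vertex k x)) = ψ (toBound θ (vertex k x.vert)) * ε x.index :=
  (hψ.cyclicHom_toBound hM hMN _).trans (QuiverRepresentation.lift_vertex _ x)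

theorem cyclicHom_arrow {x y : CyclicVertex ν m} (a : x ⟶ y) :
    hψ.cyclicHom hM hMN (toBound _ (arrow k a)) = (hψ.quiverRepresentation hM).arrow a :=
  (hψ.cyclicHom_toBound hM hMN _).trans (QuiverRepresentation.lift_arrow _ a)

theorem cyclicHom_copySum (a : ZMod m → BoundAlgebra θ) :
    hψ.cyclicHom hM hMN (copySum θ ν N s m a) = ∑ t, ψ (a t) * ε t := by
  refine (map_sum (hψ.cyclicHom hM hMN) _ _).trans (Finset.sum_congr rfl fun t _ => ?_)
  obtain ⟨x, hx⟩ := BoundAlgebra.toBound_surjective (a t)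
  rw [← hx, copyHom_toBound, hψ.cyclicHom_toBound hM hMN, hψ.lift_copyMap hM]

theorem cyclicHom_conn : hψ.cyclicHom hM hMN (conn θ ν N s m) = η * ψ 1 := by
  rw [conn, map_sum, ← map_one (toBound θ), one_eq, map_sum, map_sum, Finset.mul_sum,
    ← sum_cyclicVertex_mul ν hψ.complete fun i => η * ψ (toBound θ (vertex k i))]
  exact Finset.sum_congr rfl fun x _ =>
    (hψ.cyclicHom_toBound hM hMN _).trans (hψ.lift_connArrow hM _ _)

theorem cyclicHom_copySum_add_conn_mul (a b : ZMod m → BoundAlgebra θ) :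
    hψ.cyclicHom hM hMN (copySum θ ν N s m a + conn θ ν N s m * copySum θ ν N s m b) =
      ∑ t, (ψ (a t) + η * ψ (b t)) * ε t := by
  rw [map_add, map_mul, cyclicHom_copySum, cyclicHom_copySum, cyclicHom_conn, Finset.mul_sum,
    ← Finset.sum_add_distrib]
  refine Finset.sum_congr rfl fun t _ => ?_
  rw [mul_assoc, ← mul_assoc (ψ 1), ← map_mul, one_mul, add_mul, mul_assoc]

theorem cyclicHom_injective [FiniteDimensional k (BoundAlgebra θ)]
    (hN : IsNakayamaAutomorphism θ ν N) : Function.Injective (hψ.cyclicHom hM hMN) := by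
  refine (injective_iff_map_eq_zero _).2 fun z hz => ?_
  obtain ⟨a, b, rfl⟩ := exists_eq_copySum_add_conn_mul hN z
  rw [cyclicHom_copySum_add_conn_mul] at hz
  obtain ⟨rfl, rfl⟩ := hψ.eq_zero a b hz
  rw [map_zero, mul_zero, add_zero]

theorem cyclicHom_one : hψ.cyclicHom hM hMN 1 = ψ 1 := by
  rw [← map_one (toBound (cyclicRelations θ ν N s m)), one_eq, map_sum, map_sum,
    ← map_one (toBound θ), one_eq, map_sum, map_sum,
    ← sum_cyclicVertex_mul ν hψ.complete fun i => ψ (toBound θ (vertex k i))]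
  exact Finset.sum_congr rfl fun x _ => hψ.cyclicHom_vertex hM hMN x

theorem range_cyclicHom :
    Set.range (hψ.cyclicHom hM hMN) = {r | ∃ x, r = ψ 1 * x * ψ 1} := by
  refine Set.Subset.antisymm ?_ ?_
  · rintro _ ⟨z, rfl⟩
    exact ⟨hψ.cyclicHom hM hMN z, by rw [← hψ.cyclicHom_one hM hMN, map_one_mul_map,
      map_mul_map_one]⟩
  · rintro _ ⟨x, rfl⟩
    obtain ⟨a, b, hab⟩ := hψ.exists_eq x
    exact ⟨_, (hψ.cyclicHom_copySum_add_conn_mul hM hMN a b).trans hab.symm⟩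

end IsCyclicCorner

end CyclicHom

section CyclicRealization

variable {k : Type w} [Field k] {Q : Type u} [Quiver.{v} Q] [Fintype Q]
  {θ : Set (PathAlgebra k Q)} {ν : Equiv.Perm Q} {N M : BoundAlgebra θ ≃ₐ[k] BoundAlgebra θ}
  {A : Type*} [Ring A] [Algebra k A] {R : Type*} [Ring R] [Algebra k R]
  {𝒜 : ℕ → Submodule k A} {ℛ : ℕ → Submodule k R} {s m : ℕ} [NeZero m]
  {e : Q → A} {φ : BoundAlgebra θ →ₙₐ[k] A} {ι : A →ₐ[k] R} {τ : A ≃ₐ[k] A} {ε : ZMod m → R}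
  {y : R} {u : A}

open PathAlgebra

variable (ν) in
/-- The idempotents `e_(i, t) = e_i ε_t` of the cyclic extension. -/
def cyclicIdempotent (e : Q → A) (ι : A →ₐ[k] R) (ε : ZMod m → R) (x : CyclicVertex ν m) : R :=
  ι (e x.vert) * ε x.index

theorem IsCyclicExtension.eq_zero_of_map_mul_idem (hR : IsCyclicExtension 𝒜 ℛ ι τ ε y) {a : A}
    {t : ZMod m} (ha : ι a * ε t = 0) : a = 0 := by
  have hsum : ∑ t', (ι ((Pi.single t a : ZMod m → A) t') +
      ι ((0 : ZMod m → A) t') * y) * ε t' = 0 := by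
    rw [Finset.sum_eq_single_of_mem t (Finset.mem_univ t) fun t' _ h => by
      rw [Pi.single_eq_of_ne h, Pi.zero_apply, map_zero, zero_mul, add_zero, zero_mul],
      Pi.single_eq_same, Pi.zero_apply, map_zero, zero_mul, add_zero, ha]
  rw [← Pi.single_eq_same (M := fun _ => A) t a, (hR.eq_zero _ _ hsum).1, Pi.zero_apply]

theorem IsRealization.exists_cyclic [FiniteDimensional k (BoundAlgebra θ)] [GradedAlgebra ℛ]
    (h : IsRealization 𝒜 θ e φ) (hN : IsNakayamaAutomorphism θ ν N)
    (hR : IsCyclicExtension 𝒜 ℛ ι τ ε y) (hu : IsIntertwiner φ τ M u) (hu₀ : u ∈ 𝒜 0)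
    (hM : ∀ i, M (toBound θ (vertex k i)) = toBound θ (vertex k (ν i)))
    (hMN : ∀ {i j : Q} (a : i ⟶ j),
      M (N.symm (toBound θ ((-1 : k) ^ s • arrow k a))) = toBound θ (arrow k a)) :
    ∃ Φ, IsRealization ℛ (cyclicRelations θ ν N s m) (cyclicIdempotent ν e ι ε) Φ := by
  have hψ := hR.isCyclicCorner h.isCornerEmbedding hu
  have hsum : ∑ x : CyclicVertex ν m, cyclicIdempotent ν e ι ε x = ι (∑ i, e i) := by
    rw [map_sum]
    exact sum_cyclicVertex_mul ν hR.complete fun i => ι (e i)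
  have hvertex (x : CyclicVertex ν m) :
      hψ.cyclicHom hM hMN (toBound _ (vertex k x)) = cyclicIdempotent ν e ι ε x := by
    rw [hψ.cyclicHom_vertex hM hMN, cyclicIdempotent, ← h.map_vertex]
    rfl
  refine ⟨hψ.cyclicHom hM hMN, fun r hr => isQuadraticRelation_of_cyclicRelation hN h.quadratic hr,
    ?_, fun x hx => h.ne_zero x.vert (hR.eq_zero_of_map_mul_idem hx),
    fun x => ?_, ?_, hψ.cyclicHom_injective hM hMN hN, ?_, hvertex,
    fun x x' (a : CyclicArrow ν m x x') => ?_⟩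
  · rw [← funext hvertex, funext (hψ.cyclicHom_vertex hM hMN)]
    exact (hψ.quiverRepresentation hM).orthogonal
  · exact SetLike.GradedMul.mul_mem (hR.map_mem 0 _ (h.degree_zero x.vert)) (hR.idem_mem x.index)
  · exact hsum ▸ h.full.map (ι : A →+* R)
  · rw [hψ.range_cyclicHom hM hMN, hsum, ← h.map_one]
    rfl
  · rw [hψ.cyclicHom_arrow hM hMN a]
    cases a with
    | copy a t =>
      exact SetLike.GradedMul.mul_mem (hR.map_mem 1 _ (h.map_arrow _ _ a)) (hR.idem_mem t)
    | conn i t =>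
      exact SetLike.GradedMul.mul_mem (SetLike.GradedMul.mul_mem
        (SetLike.GradedMul.mul_mem (hR.map_mem 0 _ hu₀) hR.mem)
        (hR.map_mem 0 _ (h.map_vertex i ▸ h.degree_zero i))) (hR.idem_mem t)

end CyclicRealization

section SignTwist

variable {k : Type*} [Field k] {Q : Type u} [Quiver.{v} Q] [Fintype Q]
  {A : Type*} [Ring A] [Algebra k A] {𝒜 : ℕ → Submodule k A} {θ : Set (PathAlgebra k Q)}
  {e : Q → A} {φ : BoundAlgebra θ →ₙₐ[k] A} {σ : A ≃ₐ[k] A} {c : k}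

open PathAlgebra

namespace IsRealization

theorem exists_scalingAut (h : IsRealization 𝒜 θ e φ) (hσ₀ : ∀ a ∈ 𝒜 0, σ a = a)
    (hσ₁ : ∀ a ∈ 𝒜 1, σ a = c • a) :
    ∃ σ' : BoundAlgebra θ ≃ₐ[k] BoundAlgebra θ, (∀ b, φ (σ' b) = σ (φ b)) ∧
      (∀ i, σ' (toBound θ (vertex k i)) = toBound θ (vertex k i)) ∧
      ∀ x ∈ arrowSpan k Q, σ' (toBound θ x) = c • toBound θ x := by
  have hmap := h.isCornerEmbedding.map_restrict
    (h.apply_map_one (ν := Equiv.refl Q) fun i => hσ₀ _ (h.degree_zero i))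
  refine ⟨_, hmap, fun i => h.injective ?_, fun x hx => h.injective ?_⟩
  · rw [hmap, h.map_vertex, hσ₀ _ (h.degree_zero i)]
  · rw [hmap, hσ₁ _ (h.map_mem_of_mem_arrowSpan hx), map_smul]

theorem exists_isIntertwiner_trans [FiniteDimensional k (BoundAlgebra θ)] {ν : Equiv.Perm Q}
    {N : BoundAlgebra θ ≃ₐ[k] BoundAlgebra θ} {ρ : A ≃ₐ[k] A} {u : A}
    (h : IsRealization 𝒜 θ e φ) (hN : IsNakayamaAutomorphism θ ν N)
    (hu : IsIntertwiner φ ρ N u) (hσ₀ : ∀ a ∈ 𝒜 0, σ a = a) (hσ₁ : ∀ a ∈ 𝒜 1, σ a = c • a)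
    (hc : c * c = 1) :
    ∃ M : BoundAlgebra θ ≃ₐ[k] BoundAlgebra θ, IsIntertwiner φ (σ.trans ρ) M u ∧
      (∀ i, M (toBound θ (vertex k i)) = toBound θ (vertex k (ν i))) ∧
      ∀ {i j : Q} (a : i ⟶ j),
        M (N.symm (toBound θ (c • arrow k a))) = toBound θ (arrow k a) := by
  obtain ⟨σ', hσ, hvertex, harrow⟩ := h.exists_scalingAut hσ₀ hσ₁
  refine ⟨σ'.trans N, hu.trans hσ, fun i => ?_, fun a => ?_⟩
  · rw [AlgEquiv.trans_apply, hvertex, hN.map_vertex]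
  · obtain ⟨x, hx, hxa⟩ := hN.exists_symm_arrow a c
    rw [← hxa, AlgEquiv.trans_apply, harrow x hx, hxa, ← map_smul, AlgEquiv.apply_symm_apply,
      ← map_smul, smul_smul, hc, one_smul]

end IsRealization

end SignTwist

section ExteriorScaling

variable {R : Type*} [CommRing R] {M M' : Type*} [AddCommGroup M] [Module R M] [AddCommGroup M']
  [Module R M']

/-- The endomorphism of the exterior algebra induced by the scalar `c`, which multiplies `⋀ᵈ M`
by `c ^ d`. -/
def exteriorScaling (M : Type*) [AddCommGroup M] [Module R M] (c : R) :
    ExteriorAlgebra R M →ₐ[R] ExteriorAlgebra R M :=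
  ExteriorAlgebra.map (c • LinearMap.id)

theorem exteriorScaling_ι (c : R) (v : M) :
    exteriorScaling M c (ExteriorAlgebra.ι R v) = c • ExteriorAlgebra.ι R v :=
  (ExteriorAlgebra.map_apply_ι _ _).trans (map_smul _ _ _)

theorem exteriorScaling_one : exteriorScaling M (1 : R) = AlgHom.id R _ := by
  rw [exteriorScaling, one_smul, ExteriorAlgebra.map_id]

theorem exteriorScaling_exteriorScaling (c d : R) (x : ExteriorAlgebra R M) :
    exteriorScaling M c (exteriorScaling M d x) = exteriorScaling M (c * d) x := by
  rw [exteriorScaling, exteriorScaling, ← AlgHom.comp_apply, ExteriorAlgebra.map_comp_map,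
    LinearMap.smul_comp, LinearMap.id_comp, smul_smul, exteriorScaling]

theorem map_exteriorScaling (f : M →ₗ[R] M') (c : R) (x : ExteriorAlgebra R M) :
    ExteriorAlgebra.map f (exteriorScaling M c x) =
      exteriorScaling M' c (ExteriorAlgebra.map f x) := by
  rw [exteriorScaling, exteriorScaling, ← AlgHom.comp_apply, ← AlgHom.comp_apply,
    ExteriorAlgebra.map_comp_map, ExteriorAlgebra.map_comp_map, LinearMap.smul_comp,
    LinearMap.comp_smul, LinearMap.id_comp, LinearMap.comp_id]

theorem exteriorScaling_of_mem {d : ℕ} {x : ExteriorAlgebra R M} (hx : x ∈ ⋀[R]^d M) (c : R) :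
    exteriorScaling M c x = c ^ d • x := by
  rw [← ExteriorAlgebra.ιMulti_span_fixedDegree] at hx
  induction hx using Submodule.span_induction with
  | mem x hx =>
    obtain ⟨v, rfl⟩ := hx
    rw [exteriorScaling, ExteriorAlgebra.map_apply_ιMulti]
    refine ((ExteriorAlgebra.ιMulti R d).toMultilinearMap.map_smul_univ (fun _ => c) v).trans ?_
    rw [Finset.prod_const, Finset.card_univ, Fintype.card_fin]
    rfl
  | zero => rw [map_zero, smul_zero]
  | add x y _ _ hx hy => rw [map_add, hx, hy, smul_add]
  | smul r x _ hx => rw [map_smul, hx, smul_comm]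

theorem ι_mul_eq_exteriorScaling_mul_ι (v : M) (x : ExteriorAlgebra R M) :
    ExteriorAlgebra.ι R v * x = exteriorScaling M (-1 : R) x * ExteriorAlgebra.ι R v := by
  induction x using ExteriorAlgebra.induction with
  | algebraMap r => rw [AlgHom.commutes, Algebra.commutes]
  | ι w =>
    rw [exteriorScaling_ι, neg_one_smul, neg_mul, eq_neg_iff_add_eq_zero,
      ExteriorAlgebra.ι_add_mul_swap]
  | mul x y hx hy => rw [← mul_assoc, hx, mul_assoc, hy, map_mul, mul_assoc]
  | add x y hx hy => rw [mul_add, hx, hy, map_add, add_mul]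

theorem map_mem_exteriorPower (f : M →ₗ[R] M') {d : ℕ} {x : ExteriorAlgebra R M}
    (hx : x ∈ ⋀[R]^d M) : ExteriorAlgebra.map f x ∈ ⋀[R]^d M' := by
  have hrange : (LinearMap.range (ExteriorAlgebra.ι R (M := M))).map
      (ExteriorAlgebra.map f).toLinearMap ≤ LinearMap.range (ExteriorAlgebra.ι R (M := M')) := by
    rintro _ ⟨_, ⟨v, rfl⟩, rfl⟩
    exact ⟨f v, (ExteriorAlgebra.map_apply_ι f v).symm⟩
  have hmap := Submodule.mem_map_of_mem (f := (ExteriorAlgebra.map f).toLinearMap) hx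
  rw [Submodule.map_pow] at hmap
  exact pow_le_pow_left' hrange d hmap

end ExteriorScaling

section TopForm

variable {k : Type*} [Field k] {W : Type*} [AddCommGroup W] [Module k W] [FiniteDimensional k W]

variable (k W) in
/-- A nonzero linear form on the exterior algebra that is concentrated in the top degree, where it
is the determinant with respect to a basis. -/
def topForm : ExteriorAlgebra k W →ₗ[k] k :=
  ExteriorAlgebra.liftAlternating (Pi.single (Module.finrank k W) (Module.finBasis k W).det)

theorem topForm_ιMulti (v : Fin (Module.finrank k W) → W) :
    topForm k W (ExteriorAlgebra.ιMulti k _ v) = (Module.finBasis k W).det v := by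
  rw [topForm, ExteriorAlgebra.liftAlternating_apply_ιMulti, Pi.single_eq_same]

theorem topForm_ιMulti_of_ne {d : ℕ} (hd : d ≠ Module.finrank k W) (v : Fin d → W) :
    topForm k W (ExteriorAlgebra.ιMulti k d v) = 0 := by
  rw [topForm, ExteriorAlgebra.liftAlternating_apply_ιMulti, Pi.single_eq_of_ne hd,
    AlternatingMap.zero_apply]

theorem topForm_of_mem {d : ℕ} (hd : d ≠ Module.finrank k W) {x : ExteriorAlgebra k W}
    (hx : x ∈ ⋀[k]^d W) : topForm k W x = 0 := by
  rw [← ExteriorAlgebra.ιMulti_span_fixedDegree] at hx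
  have hle : Submodule.span k (Set.range (ExteriorAlgebra.ιMulti k d)) ≤
      LinearMap.ker (topForm k W) :=
    Submodule.span_le.2 (Set.range_subset_iff.2 (topForm_ιMulti_of_ne hd))
  exact hle hx

theorem topForm_map (g : W →ₗ[k] W) (x : ExteriorAlgebra k W) :
    topForm k W (ExteriorAlgebra.map g x) = LinearMap.det g * topForm k W x := by
  have h : topForm k W ∘ₗ (ExteriorAlgebra.map g).toLinearMap =
      LinearMap.det g • topForm k W := by
    refine ExteriorAlgebra.lhom_ext fun d => AlternatingMap.ext fun v => ?_
    change topForm k W (ExteriorAlgebra.map g (ExteriorAlgebra.ιMulti k d v)) =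
      LinearMap.det g * topForm k W (ExteriorAlgebra.ιMulti k d v)
    rw [ExteriorAlgebra.map_apply_ιMulti]
    by_cases hd : d = Module.finrank k W
    · subst hd
      rw [topForm_ιMulti, topForm_ιMulti, Module.Basis.det_comp]
    · rw [topForm_ιMulti_of_ne hd, topForm_ιMulti_of_ne hd, mul_zero]
  exact LinearMap.congr_fun h x

theorem topForm_exteriorScaling (c : k) (x : ExteriorAlgebra k W) :
    topForm k W (exteriorScaling W c x) = c ^ Module.finrank k W * topForm k W x := by
  rw [exteriorScaling, topForm_map, LinearMap.det_smul, LinearMap.det_id, mul_one]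

variable (k W) in
/-- The sign `(-1) ^ (n - 1)`, where `n` is the dimension of `W`, written without subtraction. -/
def topSign : kˣ := (-1) ^ (Module.finrank k W + 1)

theorem topForm_ι_mul (v : W) (x : ExteriorAlgebra k W) :
    topForm k W (ExteriorAlgebra.ι k v * x) =
      topSign k W * topForm k W (x * ExteriorAlgebra.ι k v) := by
  have hscale : exteriorScaling W (-1 : k) x * ExteriorAlgebra.ι k v =
      -exteriorScaling W (-1 : k) (x * ExteriorAlgebra.ι k v) := by
    rw [map_mul, exteriorScaling_ι, neg_one_smul, mul_neg, neg_neg]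
  rw [ι_mul_eq_exteriorScaling_mul_ι, hscale, map_neg, topForm_exteriorScaling, topSign]
  push_cast
  ring

theorem topForm_mul_comm (x y : ExteriorAlgebra k W) :
    topForm k W (x * y) = topForm k W (y * exteriorScaling W (topSign k W : k) x) := by
  induction x using ExteriorAlgebra.induction generalizing y with
  | algebraMap r => rw [AlgHom.commutes, Algebra.commutes]
  | ι w => rw [exteriorScaling_ι, mul_smul_comm, map_smul, topForm_ι_mul, smul_eq_mul]
  | mul x z hx hz => rw [mul_assoc, hx, mul_assoc, hz, map_mul (exteriorScaling W _), mul_assoc]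
  | add x z hx hz => rw [add_mul, map_add, hx, hz, map_add, mul_add, map_add]

theorem topForm_basis_of_ne {T : Finset (Fin (Module.finrank k W))} (hT : T ≠ Finset.univ) :
    topForm k W ((Module.finBasis k W).ExteriorAlgebra T) = 0 := by
  rw [ExteriorAlgebra.basis_apply_ofCard _ rfl, topForm_ιMulti_of_ne]
  exact fun h => hT ((Finset.card_eq_iff_eq_univ T).1 (h.trans (Fintype.card_fin _).symm))

theorem topForm_basis_univ_ne_zero :
    topForm k W ((Module.finBasis k W).ExteriorAlgebra Finset.univ) ≠ 0 := by
  intro huniv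
  have hzero : topForm k W = 0 := by
    refine (Module.finBasis k W).ExteriorAlgebra.ext fun T => ?_
    by_cases hT : T = Finset.univ
    · rw [hT, huniv, LinearMap.zero_apply]
    · rw [topForm_basis_of_ne hT, LinearMap.zero_apply]
  have hdet := topForm_ιMulti (Module.finBasis k W)
  rw [hzero, LinearMap.zero_apply, Module.Basis.det_self] at hdet
  exact zero_ne_one hdet

theorem topForm_basis_mul_eq_zero_iff (S T : Finset (Fin (Module.finrank k W))) :
    topForm k W ((Module.finBasis k W).ExteriorAlgebra Sᶜ *
      (Module.finBasis k W).ExteriorAlgebra T) = 0 ↔ T ≠ S := by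
  let b := Module.finBasis k W
  let s : Set.powersetCard (Fin (Module.finrank k W)) (Sᶜ).card := Set.powersetCard.ofCard rfl
  let t : Set.powersetCard (Fin (Module.finrank k W)) T.card := Set.powersetCard.ofCard rfl
  change topForm k W (b.ExteriorAlgebra (s : Finset _) * b.ExteriorAlgebra (t : Finset _)) = 0 ↔ _
  by_cases hd : Disjoint s.val t.val
  · rw [ExteriorAlgebra.basis_mul_of_disjoint b s t hd, Units.smul_def, map_zsmul, ← Units.smul_def,
      smul_eq_zero_iff_eq, Set.powersetCard.coe_disjUnion, Finset.disjUnion_eq_union]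
    change topForm k W (b.ExteriorAlgebra (Sᶜ ∪ T)) = 0 ↔ _
    have hTS : T ⊆ S := disjoint_compl_left_iff.1 hd
    have hunion : Sᶜ ∪ T = Finset.univ ↔ T = S := by
      rw [← Finset.compl_eq_empty_iff, Finset.compl_union, compl_compl,
        ← Finset.sdiff_eq_inter_compl, Finset.sdiff_eq_empty_iff_subset]
      exact ⟨hTS.antisymm, fun h => h.ge⟩
    refine ⟨fun h hT => ?_, fun hT => topForm_basis_of_ne (mt hunion.1 hT)⟩
    rw [hunion.2 hT] at h
    exact topForm_basis_univ_ne_zero h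
  · rw [ExteriorAlgebra.basis_mul_of_not_disjoint b s t hd, map_zero, eq_self, true_iff]
    rintro rfl
    exact hd disjoint_compl_left

theorem eq_zero_of_topForm_mul_eq_zero {x : ExteriorAlgebra k W}
    (hx : ∀ y, topForm k W (y * x) = 0) : x = 0 := by
  let b := (Module.finBasis k W).ExteriorAlgebra
  refine b.ext_elem fun S => ?_
  have hS := hx (b Sᶜ)
  rw [← b.sum_repr x, Finset.mul_sum, map_sum, Finset.sum_eq_single S] at hS
  · rw [mul_smul_comm, map_smul] at hS
    rw [map_zero, Finsupp.zero_apply]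
    exact (smul_eq_zero.1 hS).resolve_right fun h => (topForm_basis_mul_eq_zero_iff S S).1 h rfl
  · intro T _ hT
    rw [mul_smul_comm, map_smul, (topForm_basis_mul_eq_zero_iff S T).2 hT, smul_zero]
  · exact fun h => absurd (Finset.mem_univ S) h

instance : FiniteDimensional k (ExteriorAlgebra k W) :=
  Module.Finite.of_basis (Module.finBasis k W).ExteriorAlgebra

theorem finrank_exteriorAlgebra :
    Module.finrank k (ExteriorAlgebra k W) = 2 ^ Module.finrank k W := by
  rw [Module.finrank_eq_card_basis (Module.finBasis k W).ExteriorAlgebra, Fintype.card_finset,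
    Fintype.card_fin]

theorem exteriorPower_eq_bot {d : ℕ} (hd : Module.finrank k W < d) : ⋀[k]^d W = ⊥ := by
  rw [← Submodule.finrank_eq_zero (R := k), exteriorPower.finrank_eq, Nat.choose_eq_zero_of_lt hd]

end TopForm

section SkewHom

variable {k : Type*} [Field k] {W W' : Type*} [AddCommGroup W] [Module k W] [AddCommGroup W']
  [Module k W'] {H : Subgroup (W ≃ₗ[k] W)} {H' : Subgroup (W' ≃ₗ[k] W')}

theorem subgroup_smul_eq_map (h : H) (x : ExteriorAlgebra k W) :
    h • x = ExteriorAlgebra.map ((h : W ≃ₗ[k] W) : W →ₗ[k] W) x := rfl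

theorem map_smul_of_comp_eq {f : W →ₗ[k] W'} {h : H} {h' : H'}
    (hf : f ∘ₗ ((h : W ≃ₗ[k] W) : W →ₗ[k] W) = ((h' : W' ≃ₗ[k] W') : W' →ₗ[k] W') ∘ₗ f)
    (x : ExteriorAlgebra k W) :
    ExteriorAlgebra.map f (h • x) = h' • ExteriorAlgebra.map f x := by
  rw [subgroup_smul_eq_map, subgroup_smul_eq_map, ← AlgHom.comp_apply, ← AlgHom.comp_apply,
    ExteriorAlgebra.map_comp_map, ExteriorAlgebra.map_comp_map, hf]

/-- The embedding `x ↦ x · 1` of the exterior algebra into the skew group algebra. -/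
def exteriorToSkew (H : Subgroup (W ≃ₗ[k] W)) : ExteriorAlgebra k W →ₐ[k] ExteriorSkew H where
  __ := SkewMonoidAlgebra.singleOneRingHom
  commutes' _ := rfl

theorem exteriorToSkew_apply (x : ExteriorAlgebra k W) :
    exteriorToSkew H x = SkewMonoidAlgebra.single 1 x := rfl

/-- The homomorphism of skew group algebras `x h ↦ χ(h) f(x) g(h)`, where `f` is a linear map that
is equivariant along the homomorphism `g`, and `χ` is a linear character. -/
def skewHom (f : W →ₗ[k] W') (g : H →* H') (χ : H →* kˣ)
    (hfg : ∀ h : H, f ∘ₗ ((h : W ≃ₗ[k] W) : W →ₗ[k] W) =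
      ((g h : W' ≃ₗ[k] W') : W' →ₗ[k] W') ∘ₗ f) : ExteriorSkew H →ₐ[k] ExteriorSkew H' :=
  SkewMonoidAlgebra.liftNCAlgHom ((exteriorToSkew H').comp (ExteriorAlgebra.map f))
    { toFun := fun h => (χ h : k) • SkewMonoidAlgebra.single (g h) 1
      map_one' := by
        rw [map_one, map_one, Units.val_one, one_smul, SkewMonoidAlgebra.one_def]
      map_mul' := fun a b => by
        rw [smul_mul_smul_comm, SkewMonoidAlgebra.single_mul_single, smul_one, mul_one, map_mul,
          map_mul, Units.val_mul] }
    (by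
      intro x h
      change (SkewMonoidAlgebra.single 1 (ExteriorAlgebra.map f (h • x)) : ExteriorSkew H') *
          ((χ h : k) • (SkewMonoidAlgebra.single (g h) 1 : ExteriorSkew H')) =
        ((χ h : k) • (SkewMonoidAlgebra.single (g h) 1 : ExteriorSkew H')) *
          SkewMonoidAlgebra.single 1 (ExteriorAlgebra.map f x)
      rw [mul_smul_comm, smul_mul_assoc, SkewMonoidAlgebra.single_mul_single,
        SkewMonoidAlgebra.single_mul_single, one_smul, mul_one, one_mul, mul_one, one_mul,
        map_smul_of_comp_eq (hfg h)])

theorem skewHom_single {f : W →ₗ[k] W'} {g : H →* H'} {χ : H →* kˣ}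
    (hfg : ∀ h : H, f ∘ₗ ((h : W ≃ₗ[k] W) : W →ₗ[k] W) =
      ((g h : W' ≃ₗ[k] W') : W' →ₗ[k] W') ∘ₗ f) (h : H) (x : ExteriorAlgebra k W) :
    skewHom f g χ hfg (SkewMonoidAlgebra.single h x) =
      SkewMonoidAlgebra.single (g h) ((χ h : k) • ExteriorAlgebra.map f x) := by
  refine (SkewMonoidAlgebra.liftNC_single _ _ _ _).trans ?_
  change (SkewMonoidAlgebra.single 1 (ExteriorAlgebra.map f x) : ExteriorSkew H') *
    ((χ h : k) • (SkewMonoidAlgebra.single (g h) 1 : ExteriorSkew H')) = _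
  rw [mul_smul_comm, SkewMonoidAlgebra.single_mul_single, one_smul, mul_one, one_mul,
    SkewMonoidAlgebra.smul_single]

theorem single_mem_exteriorSkewDegree {d : ℕ} (h : H) {x : ExteriorAlgebra k W}
    (hx : x ∈ ⋀[k]^d W) : SkewMonoidAlgebra.single h x ∈ exteriorSkewDegree H d :=
  Submodule.subset_span ⟨x, hx, h, rfl⟩

theorem skewHom_mem {f : W →ₗ[k] W'} {g : H →* H'} {χ : H →* kˣ}
    (hfg : ∀ h : H, f ∘ₗ ((h : W ≃ₗ[k] W) : W →ₗ[k] W) =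
      ((g h : W' ≃ₗ[k] W') : W' →ₗ[k] W') ∘ₗ f) {d : ℕ} {a : ExteriorSkew H}
    (ha : a ∈ exteriorSkewDegree H d) : skewHom f g χ hfg a ∈ exteriorSkewDegree H' d := by
  have hle : exteriorSkewDegree H d ≤
      (exteriorSkewDegree H' d).comap (skewHom f g χ hfg).toLinearMap := by
    refine Submodule.span_le.2 ?_
    rintro _ ⟨x, hx, h, rfl⟩
    rw [SetLike.mem_coe, Submodule.mem_comap, AlgHom.toLinearMap_apply, skewHom_single]
    exact single_mem_exteriorSkewDegree _ (Submodule.smul_mem _ _ (map_mem_exteriorPower f hx))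
  exact hle ha

end SkewHom

section SkewTwist

variable {k : Type*} [Field k] {W : Type*} [AddCommGroup W] [Module k W]
  {H : Subgroup (W ≃ₗ[k] W)}

/-- The endomorphism `x h ↦ χ(h) c ^ d x h`, `x ∈ ⋀ᵈ W`, of the skew group algebra. -/
def skewTwistHom (c : k) (χ : H →* kˣ) : ExteriorSkew H →ₐ[k] ExteriorSkew H :=
  skewHom (c • LinearMap.id) (MonoidHom.id H) χ fun _ => by
    rw [LinearMap.smul_comp, LinearMap.comp_smul, LinearMap.id_comp, LinearMap.comp_id,
      MonoidHom.id_apply]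

theorem skewTwistHom_single (c : k) (χ : H →* kˣ) (h : H) (x : ExteriorAlgebra k W) :
    skewTwistHom c χ (SkewMonoidAlgebra.single h x) =
      SkewMonoidAlgebra.single h ((χ h : k) • exteriorScaling W c x) :=
  skewHom_single _ h x

theorem skewAlgHom_ext {A : Type*} [Semiring A] [Algebra k A] {f g : ExteriorSkew H →ₐ[k] A}
    (hfg : ∀ h x, f (SkewMonoidAlgebra.single h x) = g (SkewMonoidAlgebra.single h x)) : f = g := by
  refine AlgHom.ext fun a => ?_
  induction a using SkewMonoidAlgebra.induction_on with
  | zero => rw [map_zero, map_zero]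
  | single h x => exact hfg h x
  | add x y hx hy => rw [map_add, map_add, hx, hy]

theorem skewTwistHom_mem (c : k) (χ : H →* kˣ) {d : ℕ} {a : ExteriorSkew H}
    (ha : a ∈ exteriorSkewDegree H d) : skewTwistHom c χ a ∈ exteriorSkewDegree H d := by
  unfold skewTwistHom
  exact skewHom_mem _ ha

theorem skewTwistHom_one : skewTwistHom (1 : k) (1 : H →* kˣ) = AlgHom.id k _ :=
  skewAlgHom_ext fun h x => by
    rw [skewTwistHom_single, exteriorScaling_one, MonoidHom.one_apply, Units.val_one, one_smul]
    rfl

theorem skewTwistHom_comp (c d : k) (χ ψ : H →* kˣ) :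
    (skewTwistHom c χ).comp (skewTwistHom d ψ) = skewTwistHom (c * d) (χ * ψ) :=
  skewAlgHom_ext fun h x => by
    rw [AlgHom.comp_apply, skewTwistHom_single, skewTwistHom_single, skewTwistHom_single, map_smul,
      smul_smul, exteriorScaling_exteriorScaling, MonoidHom.mul_apply, Units.val_mul]

/-- The automorphism `x h ↦ χ(h) c ^ d x h`, `x ∈ ⋀ᵈ W`, of the skew group algebra. -/
def skewTwist (c : kˣ) (χ : H →* kˣ) : ExteriorSkew H ≃ₐ[k] ExteriorSkew H :=
  AlgEquiv.ofAlgHom (skewTwistHom (c : k) χ) (skewTwistHom ((c⁻¹ : kˣ) : k) χ⁻¹)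
    (by rw [skewTwistHom_comp, Units.mul_inv, mul_inv_cancel χ, skewTwistHom_one])
    (by rw [skewTwistHom_comp, Units.inv_mul, inv_mul_cancel χ, skewTwistHom_one])

theorem skewTwist_single (c : kˣ) (χ : H →* kˣ) (h : H) (x : ExteriorAlgebra k W) :
    skewTwist c χ (SkewMonoidAlgebra.single h x) =
      SkewMonoidAlgebra.single h ((χ h : k) • exteriorScaling W (c : k) x) :=
  skewTwistHom_single _ _ _ _

theorem skewTwist_trans (c d : kˣ) (χ ψ : H →* kˣ) :
    (skewTwist c χ).trans (skewTwist d ψ) = skewTwist (d * c) (ψ * χ) :=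
  AlgEquiv.ext (AlgHom.congr_fun (skewTwistHom_comp (d : k) c ψ χ))

theorem skewTwist_mem (c : kˣ) (χ : H →* kˣ) {d : ℕ} {a : ExteriorSkew H}
    (ha : a ∈ exteriorSkewDegree H d) : skewTwist c χ a ∈ exteriorSkewDegree H d :=
  skewTwistHom_mem _ _ ha

theorem skewTwist_one_of_mem (c : kˣ) {d : ℕ} {a : ExteriorSkew H}
    (ha : a ∈ exteriorSkewDegree H d) : skewTwist c 1 a = (c : k) ^ d • a := by
  have hle : exteriorSkewDegree H d ≤
      LinearMap.eqLocus (skewTwist c (1 : H →* kˣ)).toLinearMap ((c : k) ^ d • LinearMap.id) := by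
    refine Submodule.span_le.2 ?_
    rintro _ ⟨x, hx, h, rfl⟩
    change skewTwist c 1 (SkewMonoidAlgebra.single h x) =
      (c : k) ^ d • SkewMonoidAlgebra.single h x
    rw [skewTwist_single, exteriorScaling_of_mem hx, MonoidHom.one_apply, Units.val_one, one_smul,
      SkewMonoidAlgebra.smul_single]
  exact hle ha

end SkewTwist

section SkewGrading

variable {k : Type*} [Field k] {W : Type*} [AddCommGroup W] [Module k W]
  {H : Subgroup (W ≃ₗ[k] W)}

theorem coeff_mem_of_mem_exteriorSkewDegree {d : ℕ} {a : ExteriorSkew H}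
    (ha : a ∈ exteriorSkewDegree H d) (h : H) : a.coeff h ∈ ⋀[k]^d W := by
  classical
  induction ha using Submodule.span_induction with
  | mem a ha =>
    obtain ⟨x, hx, g, rfl⟩ := ha
    rw [SkewMonoidAlgebra.coeff_single_apply]
    split_ifs
    · exact hx
    · exact Submodule.zero_mem _
  | zero => exact Submodule.zero_mem _
  | add x y _ _ hx hy =>
    rw [SkewMonoidAlgebra.coeff_add, Finsupp.add_apply]
    exact Submodule.add_mem _ hx hy
  | smul c x _ hx =>
    rw [SkewMonoidAlgebra.coeff_smul, Finsupp.smul_apply]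
    exact Submodule.smul_mem _ c hx

theorem iSupIndep_exteriorSkewDegree : iSupIndep (exteriorSkewDegree H) := by
  have hind : iSupIndep fun d : ℕ => ⋀[k]^d W :=
    (DirectSum.Decomposition.isInternal _).submodule_iSupIndep
  rw [iSupIndep_iff_finsetSum_eq_zero_imp_eq_zero] at hind ⊢
  intro s a ha hsum d hd
  refine SkewMonoidAlgebra.ext fun h => ?_
  refine hind s (fun d => (a d).coeff h)
    (fun d hd => coeff_mem_of_mem_exteriorSkewDegree (ha d hd) h) ?_ d hd
  let coeffAt : ExteriorSkew H →ₗ[k] ExteriorAlgebra k W :=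
    Finsupp.lapply h ∘ₗ (SkewMonoidAlgebra.coeffLinearEquiv (S := k)).toLinearMap
  exact (map_sum coeffAt a s).symm.trans ((congrArg coeffAt hsum).trans (map_zero coeffAt))

theorem iSup_exteriorSkewDegree : ⨆ d, exteriorSkewDegree H d = ⊤ := by
  classical
  refine eq_top_iff.2 fun a _ => ?_
  induction a using SkewMonoidAlgebra.induction_on with
  | zero => exact Submodule.zero_mem _
  | add x y hx hy => exact Submodule.add_mem _ (hx trivial) (hy trivial)
  | single h x =>
    rw [← DirectSum.sum_support_decompose (fun i : ℕ => ⋀[k]^i W) x,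
      ← SkewMonoidAlgebra.singleAddHom_apply, map_sum]
    exact Submodule.sum_mem _ fun i _ =>
      Submodule.mem_iSup_of_mem i (single_mem_exteriorSkewDegree h (SetLike.coe_mem _))

instance exteriorSkewDegree_gradedMonoid : SetLike.GradedMonoid (exteriorSkewDegree H) where
  one_mem :=
    single_mem_exteriorSkewDegree 1 (SetLike.GradedOne.one_mem (A := fun i : ℕ => ⋀[k]^i W))
  mul_mem i j a b ha hb := by
    have hmul : exteriorSkewDegree H i * exteriorSkewDegree H j ≤ exteriorSkewDegree H (i + j) := by
      rw [exteriorSkewDegree, exteriorSkewDegree, Submodule.span_mul_span, Submodule.span_le]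
      rintro _ ⟨_, ⟨x, hx, h, rfl⟩, _, ⟨y, hy, g, rfl⟩, rfl⟩
      change SkewMonoidAlgebra.single h x * SkewMonoidAlgebra.single g y ∈ _
      rw [SkewMonoidAlgebra.single_mul_single]
      exact single_mem_exteriorSkewDegree _
        (SetLike.GradedMul.mul_mem (A := fun i : ℕ => ⋀[k]^i W) hx (map_mem_exteriorPower _ hy))
    exact hmul (Submodule.mul_mem_mul ha hb)

instance exteriorSkewDegree_gradedAlgebra : GradedAlgebra (exteriorSkewDegree H) where
  toDecomposition := ((DirectSum.isInternal_submodule_iff_iSupIndep_and_iSup_eq_top _).2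
    ⟨iSupIndep_exteriorSkewDegree, iSup_exteriorSkewDegree⟩).chooseDecomposition

variable [FiniteDimensional k W]

theorem exteriorSkewDegree_eq_bot {d : ℕ} (hd : Module.finrank k W < d) :
    exteriorSkewDegree H d = ⊥ := by
  refine Submodule.span_eq_bot.2 ?_
  rintro _ ⟨x, hx, h, rfl⟩
  rw [exteriorPower_eq_bot hd, Submodule.mem_bot] at hx
  rw [hx, SkewMonoidAlgebra.single_zero]

instance [Finite H] : FiniteDimensional k (ExteriorSkew H) :=
  Module.Finite.equiv (SkewMonoidAlgebra.coeffLinearEquiv (S := k)).symm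

theorem finrank_exteriorSkew [Finite H] :
    Module.finrank k (ExteriorSkew H) = Nat.card H * 2 ^ Module.finrank k W := by
  have := Fintype.ofFinite H
  rw [(SkewMonoidAlgebra.coeffLinearEquiv (S := k)).finrank_eq,
    (Finsupp.linearEquivFunOnFinite k (ExteriorAlgebra k W) H).finrank_eq,
    Module.finrank_pi_fintype, Finset.sum_const, finrank_exteriorAlgebra, Finset.card_univ,
    smul_eq_mul, Nat.card_eq_fintype_card]

end SkewGrading

section SkewForm

variable {k : Type*} [Field k] {W : Type*} [AddCommGroup W] [Module k W]
  {H : Subgroup (W ≃ₗ[k] W)}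

/-- The determinant character of a subgroup of `GL(W)`. -/
def subgroupDet (H : Subgroup (W ≃ₗ[k] W)) : H →* kˣ := LinearEquiv.det.comp H.subtype

theorem subgroupDet_apply (h : H) :
    (subgroupDet H h : k) = LinearMap.det ((h : W ≃ₗ[k] W) : W →ₗ[k] W) :=
  LinearEquiv.coe_det _

variable [FiniteDimensional k W]

theorem topForm_smul (h : H) (x : ExteriorAlgebra k W) :
    topForm k W (h • x) = subgroupDet H h * topForm k W x := by
  rw [subgroup_smul_eq_map, topForm_map, subgroupDet_apply]

/-- The form `∑ x_h h ↦ topForm x_1` on the skew group algebra. -/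
def skewForm (H : Subgroup (W ≃ₗ[k] W)) : ExteriorSkew H →ₗ[k] k :=
  topForm k W ∘ₗ Finsupp.lapply 1 ∘ₗ
    (SkewMonoidAlgebra.coeffLinearEquiv (S := k) (k := ExteriorAlgebra k W) (G := H)).toLinearMap

theorem skewForm_apply (a : ExteriorSkew H) : skewForm H a = topForm k W (a.coeff 1) := rfl

theorem eq_zero_of_skewForm_mul_eq_zero {a : ExteriorSkew H} (ha : ∀ b, skewForm H (b * a) = 0) :
    a = 0 := by
  refine SkewMonoidAlgebra.ext fun h => ?_
  have hcoeff : h⁻¹ • a.coeff h = 0 := by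
    refine eq_zero_of_topForm_mul_eq_zero fun y => ?_
    have hy := ha (SkewMonoidAlgebra.single h⁻¹ y)
    rwa [skewForm_apply, SkewMonoidAlgebra.coeff_single_mul, inv_inv, mul_one] at hy
  exact (smul_eq_zero_iff_eq _).1 hcoeff

theorem skewForm_single_mul (h : H) (x : ExteriorAlgebra k W) (b : ExteriorSkew H) :
    skewForm H (SkewMonoidAlgebra.single h x * b) =
      skewForm H (b * skewTwist (topSign k W) (subgroupDet H) (SkewMonoidAlgebra.single h x)) := by
  set x' := exteriorScaling W (topSign k W : k) x
  calc skewForm H (SkewMonoidAlgebra.single h x * b)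
      = topForm k W (h • b.coeff h⁻¹ * x') := by
        rw [skewForm_apply, SkewMonoidAlgebra.coeff_single_mul, mul_one, topForm_mul_comm]
    _ = topForm k W (h • (b.coeff h⁻¹ * h⁻¹ • x')) := by rw [smul_mul', smul_inv_smul]
    _ = subgroupDet H h * topForm k W (b.coeff h⁻¹ * h⁻¹ • x') := topForm_smul _ _
    _ = _ := by
        rw [skewTwist_single, skewForm_apply, SkewMonoidAlgebra.coeff_mul_single, one_mul]
        rw [smul_comm h⁻¹ (subgroupDet H h : k), mul_smul_comm (subgroupDet H h : k), map_smul,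
          smul_eq_mul]

theorem skewForm_mul_comm (a b : ExteriorSkew H) :
    skewForm H (a * b) = skewForm H (b * skewTwist (topSign k W) (subgroupDet H) a) := by
  induction a using SkewMonoidAlgebra.induction_on with
  | zero => rw [zero_mul, map_zero (skewTwist _ _), mul_zero]
  | add x y hx hy => rw [add_mul, map_add, hx, hy, map_add (skewTwist _ _), mul_add, map_add]
  | single h x => exact skewForm_single_mul h x b

theorem isGradedFrobenius_skewForm :
    IsGradedFrobenius (exteriorSkewDegree H) (Module.finrank k W) (skewForm H)
      (skewTwist (topSign k W) (subgroupDet H)) where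
  nondegenerate _ ha := eq_zero_of_skewForm_mul_eq_zero ha
  nakayama := skewForm_mul_comm
  eq_zero _ hd _ ha := topForm_of_mem hd (coeff_mem_of_mem_exteriorSkewDegree ha 1)
  map_mem _ _ ha := skewTwist_mem _ _ ha

end SkewForm

section RootIdempotent

variable {k : Type*} [Field k] {m : ℕ} {ξ : kˣ}

/-- The power `ξ ^ (-t)` of an `m`-th root of unity, for `t ∈ ℤ/m`. -/
def rootPow (ξ : kˣ) (t : ZMod m) : kˣ := (ξ⁻¹) ^ t.val

theorem rootPow_pow (hξ : ξ ^ m = 1) (t : ZMod m) : rootPow ξ t ^ m = 1 := by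
  rw [rootPow, ← pow_mul, mul_comm, pow_mul, inv_pow, hξ, inv_one, one_pow]

theorem rootPow_add_one [NeZero m] (hξ : ξ ^ m = 1) (t : ZMod m) :
    rootPow ξ (t + 1) = ξ⁻¹ * rootPow ξ t := by
  have hξ' : (ξ⁻¹) ^ m = 1 := by rw [inv_pow, hξ, inv_one]
  have hmod : ∀ n : ℕ, (ξ⁻¹) ^ (n % m) = (ξ⁻¹) ^ n := fun n => (pow_eq_pow_mod n hξ').symm
  rw [rootPow, rootPow, ZMod.val_add, ZMod.val_one_eq_one_mod, hmod, pow_add, hmod, pow_one,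
    mul_comm]

theorem rootPow_sub_one [NeZero m] (hξ : ξ ^ m = 1) (t : ZMod m) :
    rootPow ξ (t - 1) = rootPow ξ t * ξ := by
  have hadd := rootPow_add_one hξ (t - 1)
  rw [sub_add_cancel] at hadd
  rw [hadd, mul_right_comm, inv_mul_cancel, one_mul]

theorem rootPow_injective [NeZero m] (hξ : IsPrimitiveRoot ξ m) :
    Function.Injective (rootPow (m := m) ξ) := fun s t h =>
  ZMod.val_injective m (hξ.inv.pow_inj (ZMod.val_lt s) (ZMod.val_lt t) h)

theorem sum_rootPow_pow [NeZero m] (hξ : IsPrimitiveRoot ξ m) {a : ℕ} (ha₀ : a ≠ 0) (ha : a < m) :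
    ∑ t : ZMod m, (rootPow ξ t : k) ^ a = 0 := by
  have hshift : ∑ t : ZMod m, (rootPow ξ t : k) ^ a =
      ((ξ⁻¹ : kˣ) : k) ^ a * ∑ t : ZMod m, (rootPow ξ t : k) ^ a := by
    rw [Finset.mul_sum, ← Equiv.sum_comp (Equiv.addRight (1 : ZMod m))]
    refine Finset.sum_congr rfl fun t _ => ?_
    rw [Equiv.coe_addRight, rootPow_add_one hξ.pow_eq_one, Units.val_mul, mul_pow]
  by_contra hsum
  refine hξ.inv.pow_ne_one_of_pos_of_lt ha₀ ha (Units.ext ?_)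
  rw [Units.val_pow_eq_pow_val, Units.val_one]
  exact mul_right_cancel₀ hsum (hshift.symm.trans (one_mul _).symm)

theorem geom_sum_rootPow_eq_zero [NeZero m] (hξ : IsPrimitiveRoot ξ m) {s t : ZMod m}
    (hst : s ≠ t) :
    ∑ a ∈ Finset.range m, ((rootPow ξ s * (rootPow ξ t)⁻¹ : kˣ) : k) ^ a = 0 := by
  have hpow : ((rootPow ξ s * (rootPow ξ t)⁻¹ : kˣ) : k) ^ m = 1 := by
    rw [← Units.val_pow_eq_pow_val, mul_pow, inv_pow, rootPow_pow hξ.pow_eq_one,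
      rootPow_pow hξ.pow_eq_one, inv_one, mul_one, Units.val_one]
  have hne : ((rootPow ξ s * (rootPow ξ t)⁻¹ : kˣ) : k) ≠ 1 := fun h =>
    hst (rootPow_injective hξ (mul_inv_eq_one.1 (Units.ext h)))
  rw [geom_sum_eq hne, hpow, sub_self, zero_div]

variable {R : Type*} [Ring R] [Algebra k R] {c : R}

/-- The idempotent that projects onto the eigenspace of `c`, `c ^ m = 1`, with eigenvalue
`ξ ^ t`. -/
def rootIdempotent (ξ : kˣ) (c : R) (t : ZMod m) : R :=
  (m : k)⁻¹ • ∑ a ∈ Finset.range m, (rootPow ξ t : k) ^ a • c ^ a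

theorem commute_rootIdempotent {a : R} (h : Commute c a) (t : ZMod m) :
    Commute (rootIdempotent ξ c t) a :=
  (Commute.sum_left _ _ _ fun _ _ => (h.pow_left _).smul_left _).smul_left _

theorem rootPow_smul_mul_rootIdempotent (hξ : ξ ^ m = 1) (hc : c ^ m = 1) (t : ZMod m) :
    (rootPow ξ t : k) • (c * rootIdempotent ξ c t) = rootIdempotent ξ c t := by
  have hterm : ∀ a : ℕ, (rootPow ξ t : k) • (c * (rootPow ξ t : k) ^ a • c ^ a) =
      (rootPow ξ t : k) ^ (a + 1) • c ^ (a + 1) := fun a => by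
    rw [mul_smul_comm, smul_smul, ← pow_succ', ← pow_succ']
  have hsum := Finset.sum_range_succ (fun a : ℕ => (rootPow ξ t : k) ^ a • c ^ a) m
  rw [Finset.sum_range_succ', ← Units.val_pow_eq_pow_val _ m, rootPow_pow hξ, hc, pow_zero,
    pow_zero, Units.val_one] at hsum
  rw [rootIdempotent, mul_smul_comm, smul_comm, Finset.mul_sum, Finset.smul_sum,
    Finset.sum_congr rfl fun a _ => hterm a, add_right_cancel hsum]

theorem mul_rootIdempotent (hξ : ξ ^ m = 1) (hc : c ^ m = 1) (t : ZMod m) :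
    c * rootIdempotent ξ c t = (((rootPow ξ t)⁻¹ : kˣ) : k) • rootIdempotent ξ c t := by
  nth_rw 2 [← rootPow_smul_mul_rootIdempotent hξ hc t]
  rw [smul_smul, Units.inv_mul, one_smul]

theorem pow_mul_rootIdempotent (hξ : ξ ^ m = 1) (hc : c ^ m = 1) (t : ZMod m) (a : ℕ) :
    c ^ a * rootIdempotent ξ c t = (((rootPow ξ t)⁻¹ : kˣ) : k) ^ a • rootIdempotent ξ c t := by
  induction a with
  | zero => rw [pow_zero, pow_zero, one_mul, one_smul]
  | succ a ih =>
    rw [pow_succ, mul_assoc, mul_rootIdempotent hξ hc, mul_smul_comm, ih, smul_smul, pow_succ']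

theorem rootIdempotent_mul_rootIdempotent (hξ : ξ ^ m = 1) (hc : c ^ m = 1) (s t : ZMod m) :
    rootIdempotent ξ c s * rootIdempotent ξ c t =
      ((m : k)⁻¹ * ∑ a ∈ Finset.range m, ((rootPow ξ s * (rootPow ξ t)⁻¹ : kˣ) : k) ^ a) •
        rootIdempotent ξ c t := by
  nth_rw 1 [rootIdempotent]
  rw [smul_mul_assoc, Finset.sum_mul, mul_smul, Finset.sum_smul]
  congr 1
  refine Finset.sum_congr rfl fun a _ => ?_
  rw [smul_mul_assoc, pow_mul_rootIdempotent hξ hc, smul_smul, ← mul_pow, Units.val_mul]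

variable [NeZero m]

theorem sum_rootIdempotent (hξ : IsPrimitiveRoot ξ m) (hm : (m : k) ≠ 0) (c : R) :
    ∑ t : ZMod m, rootIdempotent ξ c t = 1 := by
  have hsum : ∑ t : ZMod m, ∑ a ∈ Finset.range m, (rootPow ξ t : k) ^ a • c ^ a =
      (m : k) • (1 : R) := by
    rw [Finset.sum_comm, Finset.sum_eq_single_of_mem 0 (Finset.mem_range.2 (NeZero.pos m))]
    · simp only [pow_zero, Finset.sum_const, Finset.card_univ, ZMod.card, one_smul,
        Nat.cast_smul_eq_nsmul]
    · intro a ha ha₀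
      rw [← Finset.sum_smul, sum_rootPow_pow hξ ha₀ (Finset.mem_range.1 ha), zero_smul]
  simp only [rootIdempotent]
  rw [← Finset.smul_sum, hsum, smul_smul, inv_mul_cancel₀ hm, one_smul]

theorem completeOrthogonalIdempotents_rootIdempotent (hξ : IsPrimitiveRoot ξ m)
    (hc : c ^ m = 1) : CompleteOrthogonalIdempotents (rootIdempotent (m := m) ξ c) := by
  have hm : (m : k) ≠ 0 := (IsPrimitiveRoot.coe_units_iff.2 hξ).neZero'.ne
  refine ⟨⟨fun t => ?_, fun s t hst => ?_⟩, sum_rootIdempotent hξ hm c⟩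
  · rw [IsIdempotentElem, rootIdempotent_mul_rootIdempotent hξ.pow_eq_one hc, mul_inv_cancel]
    simp only [Units.val_one, one_pow, Finset.sum_const, Finset.card_range, nsmul_eq_mul, mul_one]
    rw [inv_mul_cancel₀ hm, one_smul]
  · change rootIdempotent ξ c s * rootIdempotent ξ c t = 0
    rw [rootIdempotent_mul_rootIdempotent hξ.pow_eq_one hc, geom_sum_rootPow_eq_zero hξ hst,
      mul_zero, zero_smul]

theorem mul_rootIdempotent_of_mul (hξ : ξ ^ m = 1) {y : R} (hcy : c * y = (ξ : k) • (y * c))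
    (t : ZMod m) : y * rootIdempotent ξ c t = rootIdempotent ξ c (t + 1) * y := by
  have hyc : y * c = ((ξ⁻¹ : kˣ) : k) • (c * y) := by
    rw [hcy, smul_smul, Units.inv_mul, one_smul]
  have hpow : ∀ a : ℕ, y * c ^ a = ((ξ⁻¹ : kˣ) : k) ^ a • (c ^ a * y) := fun a => by
    induction a with
    | zero => rw [pow_zero, pow_zero, mul_one, one_mul, one_smul]
    | succ a ih =>
      rw [pow_succ', ← mul_assoc, hyc, smul_mul_assoc, mul_assoc, ih, mul_smul_comm, smul_smul,
        ← mul_assoc, ← pow_succ', ← pow_succ']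
  rw [rootIdempotent, rootIdempotent, mul_smul_comm, smul_mul_assoc, Finset.mul_sum,
    Finset.sum_mul]
  congr 1
  refine Finset.sum_congr rfl fun a _ => ?_
  rw [mul_smul_comm, hpow, smul_smul, smul_mul_assoc, rootPow_add_one hξ, Units.val_mul, mul_pow,
    mul_comm]

theorem map_rootIdempotent (hξ : ξ ^ m = 1) {σ : R ≃ₐ[k] R} (hσ : σ c = (ξ : k) • c)
    (t : ZMod m) : σ (rootIdempotent ξ c t) = rootIdempotent ξ c (t - 1) := by
  rw [rootIdempotent, rootIdempotent, map_smul, map_sum]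
  congr 1
  refine Finset.sum_congr rfl fun a _ => ?_
  rw [map_smul, map_pow, hσ, smul_pow, smul_smul, ← mul_pow, rootPow_sub_one hξ, Units.val_mul]

end RootIdempotent

section CyclicGroup

variable {k : Type*} [Field k] {V : Type*} [AddCommGroup V] [Module k V]
  {G : Subgroup (V ≃ₗ[k] V)} {ξ : kˣ} {m : ℕ}

/-- The embedding of `G` into its cyclic extension. -/
def toCyclicExtension (G : Subgroup (V ≃ₗ[k] V)) (ξ : kˣ) : G →* cyclicExtension G ξ :=
  (detEmbedding.comp G.subtype).codRestrict _ fun g =>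
    Subgroup.mem_sup_left ⟨g, g.2, rfl⟩

/-- The generator `diag(1, …, 1, ξ)` as an element of the cyclic extension. -/
def cyclicGenerator (G : Subgroup (V ≃ₗ[k] V)) (ξ : kˣ) : cyclicExtension G ξ :=
  ⟨lastScaling V ξ, Subgroup.mem_sup_right (Subgroup.mem_zpowers _)⟩

theorem toCyclicExtension_apply (g : G) (x : V × k) :
    (toCyclicExtension G ξ g : (V × k) ≃ₗ[k] (V × k)) x =
      ((g : V ≃ₗ[k] V) x.1, (((LinearEquiv.det (g : V ≃ₗ[k] V))⁻¹ : kˣ) : k) • x.2) := rfl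

theorem lastScaling_pow_apply (n : ℕ) (x : V × k) :
    (lastScaling V ξ ^ n) x = (x.1, ((ξ ^ n : kˣ) : k) • x.2) := by
  induction n with
  | zero => rw [pow_zero, pow_zero, Units.val_one, one_smul]; rfl
  | succ n ih =>
    rw [pow_succ', LinearEquiv.mul_apply, ih, pow_succ', Units.val_mul, mul_smul]
    rfl

theorem lastScaling_pow_eq_one (hξ : ξ ^ m = 1) : lastScaling V ξ ^ m = 1 :=
  LinearEquiv.ext fun x => by
    rw [lastScaling_pow_apply, hξ, Units.val_one, one_smul]; rfl

theorem cyclicGenerator_pow_apply (n : ℕ) (x : V × k) :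
    ((cyclicGenerator G ξ ^ n : cyclicExtension G ξ) : (V × k) ≃ₗ[k] (V × k)) x =
      (x.1, ((ξ ^ n : kˣ) : k) • x.2) :=
  lastScaling_pow_apply n x

theorem cyclicGenerator_pow_eq_one (hξ : ξ ^ m = 1) : cyclicGenerator G ξ ^ m = 1 :=
  Subtype.ext (lastScaling_pow_eq_one hξ)

theorem commute_lastScaling (g : V ≃ₗ[k] V) : Commute (detEmbedding g) (lastScaling V ξ) :=
  LinearEquiv.ext fun x => Prod.ext rfl (smul_comm ((LinearEquiv.det g)⁻¹ : kˣ) ξ x.2)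

theorem commute_cyclicGenerator (g : G) :
    Commute (toCyclicExtension G ξ g) (cyclicGenerator G ξ) :=
  Subtype.ext (commute_lastScaling (g : V ≃ₗ[k] V))

theorem exists_eq_mul_zpow {h : (V × k) ≃ₗ[k] (V × k)} (hh : h ∈ cyclicExtension G ξ) :
    ∃ g : G, ∃ z : ℤ, h = detEmbedding (g : V ≃ₗ[k] V) * lastScaling V ξ ^ z := by
  have hcomm : ∀ (g : G) (z : Multiplicative ℤ),
      Commute ((detEmbedding.comp G.subtype) g) (zpowersHom _ (lastScaling V ξ) z) :=
    fun g z => (commute_lastScaling (g : V ≃ₗ[k] V)).zpow_right _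
  have hrange : (MonoidHom.noncommCoprod _ _ hcomm).range = cyclicExtension G ξ := by
    rw [MonoidHom.noncommCoprod_range, MonoidHom.range_comp, Subgroup.range_subtype]
    rfl
  rw [← hrange] at hh
  obtain ⟨⟨g, z⟩, rfl⟩ := hh
  exact ⟨g, z.toAdd, rfl⟩

theorem injective_mul_pow (hξ : IsPrimitiveRoot ξ m) :
    Function.Injective fun x : G × Fin m =>
      toCyclicExtension G ξ x.1 * cyclicGenerator G ξ ^ (x.2 : ℕ) := by
  rintro ⟨g, n⟩ ⟨g', n'⟩ h
  have happly : ∀ x : V × k, _ = _ := fun x =>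
    congrArg (fun w : cyclicExtension G ξ => (w : (V × k) ≃ₗ[k] (V × k)) x) h
  simp only [Subgroup.coe_mul, LinearEquiv.mul_apply, cyclicGenerator_pow_apply,
    toCyclicExtension_apply] at happly
  obtain rfl : g = g' :=
    Subtype.ext (LinearEquiv.ext fun v => congrArg Prod.fst (happly (v, 0)))
  have hlast := congrArg Prod.snd (happly (0, 1))
  simp only [smul_eq_mul, mul_one] at hlast
  have hpow : ξ ^ (n : ℕ) = ξ ^ (n' : ℕ) := Units.ext (mul_left_cancel₀ (Units.ne_zero _) hlast)
  rw [Fin.ext (hξ.pow_inj n.2 n'.2 hpow)]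

variable [NeZero m]

theorem exists_eq_mul_pow (hξ : ξ ^ m = 1) (h : cyclicExtension G ξ) :
    ∃ g : G, ∃ n < m, h = toCyclicExtension G ξ g * cyclicGenerator G ξ ^ n := by
  obtain ⟨g, z, hgz⟩ := exists_eq_mul_zpow h.2
  have hpow : lastScaling V ξ ^ m = 1 := lastScaling_pow_eq_one hξ
  have hfin : IsOfFinOrder (lastScaling V ξ) :=
    isOfFinOrder_iff_pow_eq_one.2 ⟨m, NeZero.pos m, hpow⟩
  obtain ⟨n, hn⟩ : lastScaling V ξ ^ z ∈ Submonoid.powers (lastScaling V ξ) :=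
    hfin.mem_powers_iff_mem_zpowers.2 ⟨z, rfl⟩
  refine ⟨g, n % m, Nat.mod_lt _ (NeZero.pos m), Subtype.ext (hgz.trans ?_)⟩
  rw [← hn]
  exact congrArg (detEmbedding (g : V ≃ₗ[k] V) * ·) (pow_eq_pow_mod n hpow)

theorem surjective_mul_pow (hξ : ξ ^ m = 1) :
    Function.Surjective fun x : G × Fin m =>
      toCyclicExtension G ξ x.1 * cyclicGenerator G ξ ^ (x.2 : ℕ) := fun h => by
  obtain ⟨g, n, hn, rfl⟩ := exists_eq_mul_pow hξ h
  exact ⟨(g, ⟨n, hn⟩), rfl⟩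

theorem finite_cyclicExtension [Finite G] (hξ : ξ ^ m = 1) : Finite (cyclicExtension G ξ) :=
  Finite.of_surjective _ (surjective_mul_pow (G := G) hξ)

theorem card_cyclicExtension (hξ : IsPrimitiveRoot ξ m) :
    Nat.card (cyclicExtension G ξ) = Nat.card G * m := by
  rw [← Nat.card_congr (Equiv.ofBijective _
    ⟨injective_mul_pow (G := G) hξ, surjective_mul_pow hξ.pow_eq_one⟩), Nat.card_prod, Nat.card_fin]

end CyclicGroup

section CyclicDet

variable {k : Type*} [Field k] {V : Type*} [AddCommGroup V] [Module k V] [FiniteDimensional k V]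
  {G : Subgroup (V ≃ₗ[k] V)} {ξ : kˣ}

theorem subgroupDet_toCyclicExtension (g : G) :
    subgroupDet (cyclicExtension G ξ) (toCyclicExtension G ξ g) = 1 := by
  have hblock : (((toCyclicExtension G ξ g : (V × k) ≃ₗ[k] (V × k))) : (V × k) →ₗ[k] (V × k)) =
      LinearMap.prodMap ((g : V ≃ₗ[k] V) : V →ₗ[k] V)
        ((((LinearEquiv.det (g : V ≃ₗ[k] V))⁻¹ : kˣ) : k) • LinearMap.id) := rfl
  refine Units.ext ?_
  rw [subgroupDet_apply, hblock, LinearMap.det_prodMap, LinearMap.det_smul, LinearMap.det_id,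
    Module.finrank_self, pow_one, mul_one, ← LinearEquiv.coe_det, Units.mul_inv, Units.val_one]

theorem subgroupDet_cyclicGenerator :
    subgroupDet (cyclicExtension G ξ) (cyclicGenerator G ξ) = ξ := by
  have hblock : (((cyclicGenerator G ξ : (V × k) ≃ₗ[k] (V × k))) : (V × k) →ₗ[k] (V × k)) =
      LinearMap.prodMap LinearMap.id ((ξ : k) • LinearMap.id) := rfl
  refine Units.ext ?_
  rw [subgroupDet_apply, hblock, LinearMap.det_prodMap, LinearMap.det_smul, LinearMap.det_id,
    LinearMap.det_id, Module.finrank_self, pow_one, mul_one, one_mul]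

end CyclicDet

section CyclicSum

variable {k : Type*} [Field k] {A R : Type*} [Ring A] [Algebra k A] [Ring R] [Algebra k R]
  {m : ℕ} [NeZero m] {ι : A →ₐ[k] R} {y : R} {ε : ZMod m → R}

/-- The map `(a, b) ↦ ∑ t, (ι a_t + ι b_t y) ε_t`. -/
def cyclicSum (ι : A →ₐ[k] R) (y : R) (ε : ZMod m → R) :
    (ZMod m → A) × (ZMod m → A) →ₗ[k] R where
  toFun x := ∑ t, (ι (x.1 t) + ι (x.2 t) * y) * ε t
  map_add' x x' := by
    rw [← Finset.sum_add_distrib]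
    refine Finset.sum_congr rfl fun t _ => ?_
    rw [← add_mul, Prod.fst_add, Prod.snd_add, Pi.add_apply, Pi.add_apply, map_add, map_add,
      add_mul _ _ y, add_add_add_comm]
  map_smul' c x := by
    rw [RingHom.id_apply, Finset.smul_sum]
    refine Finset.sum_congr rfl fun t _ => ?_
    rw [Prod.smul_fst, Prod.smul_snd, Pi.smul_apply, Pi.smul_apply, map_smul, map_smul,
      smul_mul_assoc, ← smul_add, smul_mul_assoc]

theorem cyclicSum_apply (a b : ZMod m → A) :
    cyclicSum ι y ε (a, b) = ∑ t, (ι (a t) + ι (b t) * y) * ε t := rfl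

theorem map_mul_mem_range_cyclicSum (a : A) {r : R} (hr : r ∈ LinearMap.range (cyclicSum ι y ε)) :
    ι a * r ∈ LinearMap.range (cyclicSum ι y ε) := by
  obtain ⟨⟨b, c⟩, rfl⟩ := hr
  refine ⟨(fun t => a * b t, fun t => a * c t), ?_⟩
  rw [cyclicSum_apply, cyclicSum_apply, Finset.mul_sum]
  refine Finset.sum_congr rfl fun t _ => ?_
  rw [map_mul, map_mul, ← mul_assoc, mul_add, mul_assoc _ _ y]

theorem mul_mem_range_cyclicSum {τ : A → A} (hyι : ∀ a, y * ι a = ι (τ a) * y) (hy : y * y = 0)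
    {r : R} (hr : r ∈ LinearMap.range (cyclicSum ι y ε)) :
    y * r ∈ LinearMap.range (cyclicSum ι y ε) := by
  obtain ⟨⟨a, b⟩, rfl⟩ := hr
  refine ⟨(0, fun t => τ (a t)), ?_⟩
  rw [cyclicSum_apply, cyclicSum_apply, Finset.mul_sum]
  refine Finset.sum_congr rfl fun t _ => ?_
  rw [Pi.zero_apply, map_zero, zero_add, ← mul_assoc, mul_add, ← mul_assoc, hyι, hyι,
    mul_assoc _ y y, hy, mul_zero, add_zero]

theorem mul_mem_range_cyclicSum_of_commute {c : R} (hcι : ∀ a, Commute c (ι a)) {z : k}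
    (hcy : c * y = z • (y * c)) {l : ZMod m → k} (hcε : ∀ t, c * ε t = l t • ε t)
    {r : R} (hr : r ∈ LinearMap.range (cyclicSum ι y ε)) :
    c * r ∈ LinearMap.range (cyclicSum ι y ε) := by
  obtain ⟨⟨a, b⟩, rfl⟩ := hr
  refine ⟨(fun t => l t • a t, fun t => l t • z • b t), ?_⟩
  rw [cyclicSum_apply, cyclicSum_apply, Finset.mul_sum]
  refine Finset.sum_congr rfl fun t _ => ?_
  have hcomm : c * (ι (a t) + ι (b t) * y) = (ι (a t) + z • ι (b t) * y) * c := by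
    rw [mul_add, add_mul, (hcι (a t)).eq, ← mul_assoc, (hcι (b t)).eq, mul_assoc, hcy,
      mul_smul_comm, smul_mul_assoc, smul_mul_assoc, mul_assoc]
  rw [← mul_assoc, hcomm, mul_assoc, hcε, mul_smul_comm, ← smul_mul_assoc, smul_add,
    ← smul_mul_assoc, map_smul, map_smul, map_smul]

theorem pow_mul_mem {c : R} {S : Submodule k R} (hc : ∀ r ∈ S, c * r ∈ S) (n : ℕ) {r : R}
    (hr : r ∈ S) : c ^ n * r ∈ S := by
  induction n with
  | zero => rwa [pow_zero, one_mul]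
  | succ n ih => rw [pow_succ', mul_assoc]; exact hc _ ih

theorem one_mem_range_cyclicSum (hε : ∑ t, ε t = 1) : 1 ∈ LinearMap.range (cyclicSum ι y ε) := by
  refine ⟨(1, 0), ?_⟩
  rw [cyclicSum_apply, ← hε]
  refine Finset.sum_congr rfl fun t _ => ?_
  rw [Pi.one_apply, Pi.zero_apply, map_zero, zero_mul, add_zero, map_one, one_mul]

end CyclicSum

section CyclicSkew

variable {k : Type*} [Field k] {V : Type*} [AddCommGroup V] [Module k V]
  {G : Subgroup (V ≃ₗ[k] V)} {ξ : kˣ} {m : ℕ}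

/-- The embedding of `⋀V * G` into the skew group algebra of the cyclic extension. -/
def cyclicSkewHom (G : Subgroup (V ≃ₗ[k] V)) (ξ : kˣ) :
    ExteriorSkew G →ₐ[k] ExteriorSkew (cyclicExtension G ξ) :=
  skewHom (LinearMap.inl k V k) (toCyclicExtension G ξ) 1 fun g =>
    LinearMap.ext fun _ => Prod.ext rfl
      (smul_zero (A := k) ((LinearEquiv.det (g : V ≃ₗ[k] V))⁻¹ : kˣ)).symm

theorem cyclicSkewHom_single (g : G) (x : ExteriorAlgebra k V) :
    cyclicSkewHom G ξ (SkewMonoidAlgebra.single g x) = SkewMonoidAlgebra.single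
      (toCyclicExtension G ξ g) (ExteriorAlgebra.map (LinearMap.inl k V k) x) := by
  rw [cyclicSkewHom, skewHom_single, MonoidHom.one_apply, Units.val_one, one_smul]

theorem cyclicSkewHom_mem {d : ℕ} {a : ExteriorSkew G} (ha : a ∈ exteriorSkewDegree G d) :
    cyclicSkewHom G ξ a ∈ exteriorSkewDegree (cyclicExtension G ξ) d := by
  unfold cyclicSkewHom
  exact skewHom_mem _ ha

/-- The generator `diag(1, …, 1, ξ)` as an element of the skew group algebra. -/
def skewGenerator (G : Subgroup (V ≃ₗ[k] V)) (ξ : kˣ) : ExteriorSkew (cyclicExtension G ξ) :=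
  SkewMonoidAlgebra.single (cyclicGenerator G ξ) 1

/-- The last basis vector of `V ⊕ k` as an element of the skew group algebra. -/
def lastVector (G : Subgroup (V ≃ₗ[k] V)) (ξ : kˣ) : ExteriorSkew (cyclicExtension G ξ) :=
  SkewMonoidAlgebra.single 1 (ExteriorAlgebra.ι k (0, 1))

theorem skewGenerator_pow (n : ℕ) :
    skewGenerator G ξ ^ n = SkewMonoidAlgebra.single (cyclicGenerator G ξ ^ n) 1 := by
  induction n with
  | zero => rw [pow_zero, pow_zero, SkewMonoidAlgebra.one_def]
  | succ n ih =>
    rw [pow_succ, ih, skewGenerator, SkewMonoidAlgebra.single_mul_single, smul_one, mul_one,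
      ← pow_succ]

theorem skewGenerator_pow_eq_one (hξ : ξ ^ m = 1) : skewGenerator G ξ ^ m = 1 := by
  rw [skewGenerator_pow, cyclicGenerator_pow_eq_one hξ, SkewMonoidAlgebra.one_def]

theorem single_mul_pow (g : G) (n : ℕ) (x : ExteriorAlgebra k (V × k)) :
    SkewMonoidAlgebra.single (toCyclicExtension G ξ g * cyclicGenerator G ξ ^ n) x =
      exteriorToSkew (cyclicExtension G ξ) x *
        (cyclicSkewHom G ξ (SkewMonoidAlgebra.single g 1) * skewGenerator G ξ ^ n) := by
  rw [skewGenerator_pow, cyclicSkewHom_single, map_one, SkewMonoidAlgebra.single_mul_single,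
    smul_one, mul_one, exteriorToSkew_apply, SkewMonoidAlgebra.single_mul_single, smul_one,
    mul_one, one_mul]

theorem exteriorToSkew_ι (v : V × k) :
    exteriorToSkew (cyclicExtension G ξ) (ExteriorAlgebra.ι k v) =
      cyclicSkewHom G ξ (SkewMonoidAlgebra.single 1 (ExteriorAlgebra.ι k v.1)) +
        v.2 • lastVector G ξ := by
  have hv : v = (v.1, 0) + v.2 • ((0, 1) : V × k) :=
    Prod.ext ((congrArg (v.1 + ·) (smul_zero _)).trans (add_zero _)).symm
      ((zero_add _).trans (mul_one _)).symm
  rw [cyclicSkewHom_single, map_one, ExteriorAlgebra.map_apply_ι, LinearMap.inl_apply,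
    lastVector, ← exteriorToSkew_apply, ← exteriorToSkew_apply, ← map_smul, ← map_smul,
    ← map_add, ← map_add, ← hv]

theorem cyclicGenerator_smul_map_inl (x : ExteriorAlgebra k V) :
    cyclicGenerator G ξ • ExteriorAlgebra.map (LinearMap.inl k V k) x =
      ExteriorAlgebra.map (LinearMap.inl k V k) x := by
  rw [subgroup_smul_eq_map, ← AlgHom.comp_apply, ExteriorAlgebra.map_comp_map]
  congr 2
  exact LinearMap.ext fun _ => Prod.ext rfl (smul_zero (A := k) ξ)

theorem cyclicGenerator_smul_ι :
    cyclicGenerator G ξ • ExteriorAlgebra.ι k ((0, 1) : V × k) =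
      (ξ : k) • ExteriorAlgebra.ι k ((0, 1) : V × k) := by
  rw [subgroup_smul_eq_map, ExteriorAlgebra.map_apply_ι, ← map_smul]
  congr 1
  exact Prod.ext (smul_zero _).symm rfl

theorem toCyclicExtension_smul_ι (g : G) :
    toCyclicExtension G ξ g • ExteriorAlgebra.ι k ((0, 1) : V × k) =
      (((subgroupDet G g)⁻¹ : kˣ) : k) • ExteriorAlgebra.ι k ((0, 1) : V × k) := by
  rw [subgroup_smul_eq_map, ExteriorAlgebra.map_apply_ι, ← map_smul]
  congr 1
  exact Prod.ext ((map_zero (g : V ≃ₗ[k] V)).trans (smul_zero _).symm) rfl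

theorem commute_skewGenerator (a : ExteriorSkew G) :
    Commute (skewGenerator G ξ) (cyclicSkewHom G ξ a) := by
  induction a using SkewMonoidAlgebra.induction_on with
  | zero => rw [map_zero]; exact Commute.zero_right _
  | add x y hx hy => rw [map_add]; exact hx.add_right hy
  | single g x =>
    rw [Commute, SemiconjBy, cyclicSkewHom_single, skewGenerator,
      SkewMonoidAlgebra.single_mul_single, SkewMonoidAlgebra.single_mul_single, smul_one, mul_one,
      one_mul, cyclicGenerator_smul_map_inl, (commute_cyclicGenerator g).eq]

theorem skewGenerator_mul_lastVector :
    skewGenerator G ξ * lastVector G ξ = (ξ : k) • (lastVector G ξ * skewGenerator G ξ) := by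
  rw [skewGenerator, lastVector, SkewMonoidAlgebra.single_mul_single,
    SkewMonoidAlgebra.single_mul_single, cyclicGenerator_smul_ι, one_mul, smul_one, mul_one,
    mul_one, one_mul, SkewMonoidAlgebra.smul_single]

theorem lastVector_mul_self : lastVector G ξ * lastVector G ξ = 0 := by
  rw [lastVector, SkewMonoidAlgebra.single_mul_single, one_smul, ExteriorAlgebra.ι_sq_zero,
    SkewMonoidAlgebra.single_zero]

theorem lastVector_mul_cyclicSkewHom (a : ExteriorSkew G) :
    lastVector G ξ * cyclicSkewHom G ξ a =
      cyclicSkewHom G ξ (skewTwist (-1) (subgroupDet G) a) * lastVector G ξ := by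
  induction a using SkewMonoidAlgebra.induction_on with
  | zero => rw [map_zero (skewTwist _ _), map_zero, mul_zero, zero_mul]
  | add x y hx hy => rw [map_add (skewTwist _ _), map_add, map_add, mul_add, add_mul, hx, hy]
  | single g x =>
    rw [skewTwist_single, cyclicSkewHom_single, cyclicSkewHom_single, lastVector,
      SkewMonoidAlgebra.single_mul_single, SkewMonoidAlgebra.single_mul_single,
      toCyclicExtension_smul_ι, one_smul, one_mul, mul_one, map_smul, smul_mul_smul_comm,
      Units.mul_inv, one_smul, map_exteriorScaling, Units.val_neg, Units.val_one,
      ι_mul_eq_exteriorScaling_mul_ι]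

theorem lastVector_mem : lastVector G ξ ∈ exteriorSkewDegree (cyclicExtension G ξ) 1 :=
  single_mem_exteriorSkewDegree _
    ((pow_one (LinearMap.range (ExteriorAlgebra.ι k (M := V × k)))).ge ⟨_, rfl⟩)

theorem rootIdempotent_skewGenerator_mem (t : ZMod m) :
    rootIdempotent ξ (skewGenerator G ξ) t ∈ exteriorSkewDegree (cyclicExtension G ξ) 0 := by
  refine Submodule.smul_mem _ _ (Submodule.sum_mem _ fun a _ => Submodule.smul_mem _ _ ?_)
  rw [skewGenerator_pow]
  exact single_mem_exteriorSkewDegree _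
    (SetLike.GradedOne.one_mem (A := fun i : ℕ => ⋀[k]^i (V × k)))

end CyclicSkew

section CyclicSkewSum

variable {k : Type*} [Field k] {V : Type*} [AddCommGroup V] [Module k V]
  {G : Subgroup (V ≃ₗ[k] V)} {ξ : kˣ} {m : ℕ} [NeZero m]

theorem skewGenerator_mul_mem_range (hξ : ξ ^ m = 1) {r : ExteriorSkew (cyclicExtension G ξ)}
    (hr : r ∈ LinearMap.range (cyclicSum (cyclicSkewHom G ξ) (lastVector G ξ)
      (rootIdempotent (m := m) ξ (skewGenerator G ξ)))) :
    skewGenerator G ξ * r ∈ LinearMap.range (cyclicSum (cyclicSkewHom G ξ) (lastVector G ξ)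
      (rootIdempotent (m := m) ξ (skewGenerator G ξ))) :=
  mul_mem_range_cyclicSum_of_commute (ι := cyclicSkewHom G ξ) (y := lastVector G ξ)
    commute_skewGenerator skewGenerator_mul_lastVector
    (mul_rootIdempotent hξ (skewGenerator_pow_eq_one hξ)) hr

theorem exteriorToSkew_mul_mem_range (x : ExteriorAlgebra k (V × k))
    {ε : ZMod m → ExteriorSkew (cyclicExtension G ξ)} {r : ExteriorSkew (cyclicExtension G ξ)}
    (hr : r ∈ LinearMap.range (cyclicSum (cyclicSkewHom G ξ) (lastVector G ξ) ε)) :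
    exteriorToSkew _ x * r ∈
      LinearMap.range (cyclicSum (cyclicSkewHom G ξ) (lastVector G ξ) ε) := by
  induction x using ExteriorAlgebra.induction generalizing r with
  | algebraMap c =>
    rw [AlgHom.commutes, ← Algebra.smul_def]
    exact Submodule.smul_mem _ _ hr
  | ι v =>
    rw [exteriorToSkew_ι, add_mul, smul_mul_assoc]
    exact Submodule.add_mem _ (map_mul_mem_range_cyclicSum _ hr)
      (Submodule.smul_mem _ _ (mul_mem_range_cyclicSum
        lastVector_mul_cyclicSkewHom lastVector_mul_self hr))
  | mul x y hx hy => rw [map_mul, mul_assoc]; exact hx (hy hr)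
  | add x y hx hy => rw [map_add, add_mul]; exact Submodule.add_mem _ (hx hr) (hy hr)

theorem surjective_cyclicSkewSum (hξ : IsPrimitiveRoot ξ m) :
    Function.Surjective (cyclicSum (cyclicSkewHom G ξ) (lastVector G ξ)
      (rootIdempotent (m := m) ξ (skewGenerator G ξ))) := by
  have hone : 1 ∈ LinearMap.range (cyclicSum (cyclicSkewHom G ξ) (lastVector G ξ)
      (rootIdempotent (m := m) ξ (skewGenerator G ξ))) :=
    one_mem_range_cyclicSum (completeOrthogonalIdempotents_rootIdempotent hξ
      (c := skewGenerator G ξ) (skewGenerator_pow_eq_one hξ.pow_eq_one)).complete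
  refine LinearMap.range_eq_top.1 (eq_top_iff.2 fun r _ => ?_)
  induction r using SkewMonoidAlgebra.induction_on with
  | zero => exact Submodule.zero_mem _
  | add x y hx hy => exact Submodule.add_mem _ (hx trivial) (hy trivial)
  | single h x =>
    obtain ⟨g, n, -, rfl⟩ := exists_eq_mul_pow hξ.pow_eq_one h
    rw [single_mul_pow, ← mul_one (skewGenerator G ξ ^ n)]
    exact exteriorToSkew_mul_mem_range _ (map_mul_mem_range_cyclicSum _
      (pow_mul_mem (fun _ => skewGenerator_mul_mem_range hξ.pow_eq_one) n hone))

variable [FiniteDimensional k V] [Finite G]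

theorem injective_cyclicSkewSum (hξ : IsPrimitiveRoot ξ m) :
    Function.Injective (cyclicSum (cyclicSkewHom G ξ) (lastVector G ξ)
      (rootIdempotent (m := m) ξ (skewGenerator G ξ))) := by
  have := finite_cyclicExtension (G := G) hξ.pow_eq_one
  refine (LinearMap.injective_iff_surjective_of_finrank_eq_finrank ?_).2
    (surjective_cyclicSkewSum hξ)
  rw [finrank_exteriorSkew, card_cyclicExtension hξ, Module.finrank_prod, Module.finrank_prod,
    Module.finrank_self, Module.finrank_pi_fintype, Finset.sum_const, Finset.card_univ, ZMod.card,
    finrank_exteriorSkew, smul_eq_mul]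
  ring

theorem isCyclicExtension_exteriorSkewDegree (hξ : IsPrimitiveRoot ξ m) :
    IsCyclicExtension (exteriorSkewDegree G) (exteriorSkewDegree (cyclicExtension G ξ))
      (cyclicSkewHom G ξ) (skewTwist (-1) (subgroupDet G))
      (rootIdempotent (m := m) ξ (skewGenerator G ξ)) (lastVector G ξ) where
  complete := completeOrthogonalIdempotents_rootIdempotent hξ
    (skewGenerator_pow_eq_one hξ.pow_eq_one)
  commute t a := commute_rootIdempotent (commute_skewGenerator a) t
  mul_map := lastVector_mul_cyclicSkewHom
  mul_self := lastVector_mul_self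
  shift := mul_rootIdempotent_of_mul hξ.pow_eq_one skewGenerator_mul_lastVector
  map_mem _ _ ha := cyclicSkewHom_mem ha
  idem_mem := rootIdempotent_skewGenerator_mem
  mem := lastVector_mem
  exists_eq r := by
    obtain ⟨⟨a, b⟩, h⟩ := surjective_cyclicSkewSum (G := G) hξ r
    exact ⟨a, b, h.symm⟩
  eq_zero _ _ h := Prod.mk_eq_zero.1 (injective_cyclicSkewSum hξ (h.trans (map_zero _).symm))

end CyclicSkewSum

section Shift

open PathAlgebra

variable {k : Type w} [Field k] {V : Type*} [AddCommGroup V] [Module k V]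
  {G : Subgroup (V ≃ₗ[k] V)} {ξ : kˣ}

theorem skewTwist_neg_one_eq_trans :
    skewTwist (-1) (subgroupDet G) = (skewTwist ((-1) ^ Module.finrank k V) 1).trans
      (skewTwist (topSign k V) (subgroupDet G)) := by
  rw [skewTwist_trans, mul_one (subgroupDet G), topSign, pow_succ', mul_assoc, ← mul_pow,
    neg_mul_neg, one_mul, one_pow, mul_one]

variable [FiniteDimensional k V]

theorem skewTwist_cyclicSkewHom_of_mem (c : kˣ) {a : ExteriorSkew G}
    (ha : a ∈ exteriorSkewDegree G 0) :
    skewTwist c (subgroupDet (cyclicExtension G ξ)) (cyclicSkewHom G ξ a) =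
      cyclicSkewHom G ξ a := by
  induction ha using Submodule.span_induction with
  | mem a ha =>
    obtain ⟨x, hx, g, rfl⟩ := ha
    rw [cyclicSkewHom_single, skewTwist_single, subgroupDet_toCyclicExtension,
      exteriorScaling_of_mem (map_mem_exteriorPower _ hx), pow_zero, one_smul, Units.val_one,
      one_smul]
  | zero => rw [map_zero, map_zero (skewTwist _ _)]
  | add x y _ _ hx hy => rw [map_add, map_add (skewTwist _ _), hx, hy]
  | smul r x _ hx => rw [map_smul, map_smul (skewTwist _ _), hx]

theorem skewTwist_skewGenerator (c : kˣ) :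
    skewTwist c (subgroupDet (cyclicExtension G ξ)) (skewGenerator G ξ) =
      (ξ : k) • skewGenerator G ξ := by
  rw [skewGenerator, skewTwist_single, subgroupDet_cyclicGenerator, map_one,
    SkewMonoidAlgebra.smul_single]

theorem skewTwist_cyclicIdempotent {m : ℕ} [NeZero m] (hξ : ξ ^ m = 1) (c : kˣ) {Q : Type*}
    (ν : Equiv.Perm Q) {e : Q → ExteriorSkew G} (he : ∀ i, e i ∈ exteriorSkewDegree G 0)
    (x : CyclicVertex ν m) :
    skewTwist c (subgroupDet (cyclicExtension G ξ))
        (cyclicIdempotent ν e (cyclicSkewHom G ξ) (rootIdempotent ξ (skewGenerator G ξ)) x) =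
      cyclicIdempotent ν e (cyclicSkewHom G ξ) (rootIdempotent ξ (skewGenerator G ξ))
        (cyclicShift ν m x) := by
  rw [cyclicIdempotent, map_mul, skewTwist_cyclicSkewHom_of_mem c (he _),
    map_rootIdempotent hξ (skewTwist_skewGenerator c)]
  rfl

theorem IsRealization.exists_isIntertwiner_skewTwist_neg_one [Finite G] {Q : Type u}
    [Quiver.{v} Q] [Fintype Q] {θ : Set (PathAlgebra k Q)} {e : Q → ExteriorSkew G}
    {φ : BoundAlgebra θ →ₙₐ[k] ExteriorSkew G} (h : IsRealization (exteriorSkewDegree G) θ e φ)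
    {ν : Equiv.Perm Q} {N : BoundAlgebra θ ≃ₐ[k] BoundAlgebra θ}
    (hN : IsNakayamaAutomorphism θ ν N) :
    ∃ u ∈ exteriorSkewDegree G 0, ∃ M : BoundAlgebra θ ≃ₐ[k] BoundAlgebra θ,
      IsIntertwiner φ (skewTwist (-1) (subgroupDet G)) M u ∧
      (∀ i, M (toBound θ (vertex k i)) = toBound θ (vertex k (ν i))) ∧
      ∀ {i j : Q} (a : i ⟶ j),
        M (N.symm (toBound θ ((-1 : k) ^ Module.finrank k V • arrow k a))) =
          toBound θ (arrow k a) := by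
  have := Module.Finite.of_injective (φ : BoundAlgebra θ →ₗ[k] ExteriorSkew G) h.injective
  obtain ⟨u, hu₀, hu⟩ :=
    h.exists_isIntertwiner (fun _ => exteriorSkewDegree_eq_bot) isGradedFrobenius_skewForm hN
  rw [skewTwist_neg_one_eq_trans]
  refine ⟨u, hu₀, h.exists_isIntertwiner_trans hN hu (fun a ha => ?_) (fun a ha => ?_) ?_⟩
  · rw [skewTwist_one_of_mem _ ha, pow_zero, one_smul]
  · rw [skewTwist_one_of_mem _ ha, pow_one, Units.val_pow_eq_pow_val, Units.val_neg, Units.val_one]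
  · rw [← mul_pow, neg_mul_neg, one_mul, one_pow]

end Shift

theorem mainTheorem2_general {k : Type*} [Field k]
    {V : Type*} [AddCommGroup V] [Module k V] [FiniteDimensional k V]
    (G : Subgroup (V ≃ₗ[k] V)) [Finite G]
    (m : ℕ) [NeZero m] (ξ : kˣ) (hξ : IsPrimitiveRoot ξ m)
    {Q : Type*} [Quiver Q] [Fintype Q] (θ : Set (PathAlgebra k Q))
    (hθ : IsBoundQuiverOfBasic (exteriorSkewDegree G) θ)
    (ν : Equiv.Perm Q) (N : BoundAlgebra θ ≃ₐ[k] BoundAlgebra θ)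
    (hN : IsNakayamaAutomorphism θ ν N) :
    IsBoundQuiverOfBasic (exteriorSkewDegree (cyclicExtension G ξ))
        (cyclicRelations θ ν N (Module.finrank k V) m) ∧
      IsStableTranslationQuiver (cyclicRelations θ ν N (Module.finrank k V) m)
        (cyclicShift ν m) (Module.finrank k V + 1) ∧
      ∃ N' : BoundAlgebra (cyclicRelations θ ν N (Module.finrank k V) m) ≃ₐ[k]
          BoundAlgebra (cyclicRelations θ ν N (Module.finrank k V) m),
        IsNakayamaAutomorphism (cyclicRelations θ ν N (Module.finrank k V) m)
          (cyclicShift ν m) N' := by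
  have := finite_cyclicExtension (G := G) hξ.pow_eq_one
  have := IsArtinianRing.of_finite k (ExteriorSkew G)
  obtain ⟨e, φ, h⟩ := hθ.exists_isRealization
  have := Module.Finite.of_injective (φ : BoundAlgebra θ →ₗ[k] ExteriorSkew G) h.injective
  obtain ⟨u, hu₀, M, hu, hM, hMN⟩ := h.exists_isIntertwiner_skewTwist_neg_one hN
  obtain ⟨Φ, hΦ⟩ := h.exists_cyclic hN (isCyclicExtension_exteriorSkewDegree hξ) hu hu₀ hM hMN
  have hbot : ∀ d, Module.finrank k (V × k) < d →
      exteriorSkewDegree (cyclicExtension G ξ) d = ⊥ := fun _ => exteriorSkewDegree_eq_bot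
  have hrank : Module.finrank k (V × k) = Module.finrank k V + 1 := by
    rw [Module.finrank_prod, Module.finrank_self]
  have hshift := skewTwist_cyclicIdempotent hξ.pow_eq_one (topSign k (V × k)) ν h.degree_zero
  exact ⟨hΦ.isBoundQuiverOfBasic hbot,
    hrank ▸ hΦ.isStableTranslationQuiver hbot isGradedFrobenius_skewForm hshift,
    hΦ.exists_isNakayamaAutomorphism isGradedFrobenius_skewForm hshift⟩

theorem mainTheorem2 {k : Type*} [Field k] [IsAlgClosed k] [CharZero k]
    {V : Type*} [AddCommGroup V] [Module k V] [FiniteDimensional k V]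
    (G : Subgroup (V ≃ₗ[k] V)) [Finite G]
    (m : ℕ) [NeZero m] (ξ : kˣ) (hξ : IsPrimitiveRoot ξ m)
    {Q : Type*} [Quiver Q] [Fintype Q] (θ : Set (PathAlgebra k Q))
    (hθ : IsBoundQuiverOfBasic (exteriorSkewDegree G) θ)
    (ν : Equiv.Perm Q) (N : BoundAlgebra θ ≃ₐ[k] BoundAlgebra θ)
    (hN : IsNakayamaAutomorphism θ ν N) :
    IsBoundQuiverOfBasic (exteriorSkewDegree (cyclicExtension G ξ))
        (cyclicRelations θ ν N (Module.finrank k V) m) ∧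
      IsStableTranslationQuiver (cyclicRelations θ ν N (Module.finrank k V) m)
        (cyclicShift ν m) (Module.finrank k V + 1) ∧
      ∃ N' : BoundAlgebra (cyclicRelations θ ν N (Module.finrank k V) m) ≃ₐ[k]
          BoundAlgebra (cyclicRelations θ ν N (Module.finrank k V) m),
        IsNakayamaAutomorphism (cyclicRelations θ ν N (Module.finrank k V) m)
          (cyclicShift ν m) N' :=
  mainTheorem2_general G m ξ hξ θ hθ ν N hN

end
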